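/- Conventions. A Frölicher space is a set with a class of structure curves $\mathbb{R}\to X$ and a class of structure functions $X\to\mathbb{R}$, each of which is determined by the other as the maximal class for which all composites $\mathbb{R}\to\mathbb{R}$ are smooth; $[Y\to X]=X^Y$ denotes the Frölicher space of smooth maps. For a Weil algebra $W=C^\infty(\mathbb{R}^n)/I$, the Weil prolongation $X\otimes W$ is the quotient of $X^{\mathbb{R}^n}$ by the relation: $f\sim g$ if $f(0)=g(0)$ and $\chi\circ f-\chi\circ g\in I$ for every structure function $\chi$. It is functorial in $X$ and $W$, with projection $\pi:X\otimes W\to X$. Write $\mathcal{W}_{D^n}=\mathbb{R}[x_1,\dots,x_n]/(x_1^2,\dots,x_n^2)$, $D=D^1$; a map between infinitesimal objects such as $D^n$ induces a homomorphism of Weil algebras in the opposite direction. A Frölicher space $X$ is microlinear if $X\otimes\cdot$ sends every finite diagram of Weil algebras that is a limit diagram of algebras (equivalently, every limit diagram of Weil algebras over a finite connected index category) to a limit diagram of Frölicher spaces, and Weil exponentiable if the canonical identification $(X\otimes(W_1\otimes W_2))^Y=(X\otimes W_1)^Y\otimes W_2$ holds naturally for all Frölicher spaces $Y$ and all Weil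 algebras $W_1,W_2$. In such a space the sum of tangent vectors $t_1,t_2\in X\otimes\mathcal{W}_D$ at the same point is $d\mapsto\zeta(d,d)$, where $\zeta\in X\otimes\mathcal{W}_{D(2)}$, $D(2)=\{(d_1,d_2)\in D^2\mid d_1d_2=0\}$, has $\zeta(d,0)=t_1(d)$ and $\zeta(0,d)=t_2(d)$; $(\alpha t)(d)=t(\alpha d)$; and for $\gamma_1,\gamma_2\in X\otimes\mathcal{W}_{D^2}$ with equal restrictions to $D(2)$ the strong difference $\gamma_1\overset{\cdot}{-}\gamma_2\in X\otimes\mathcal{W}_D$ is $d\mapsto\zeta(0,0,d)$, where $\zeta\in X\otimes\mathcal{W}_{D^2\oplus D}$, $D^2\oplus D=\{(d_1,d_2,e)\in D^3\mid d_1e=d_2e=0\}$, has $\zeta(d_1,d_2,0)=\gamma_2(d_1,d_2)$ and $\zeta(d_1,d_2,d_1d_2)=\gamma_1(d_1,d_2)$. Let $M$ be a microlinear, Weil exponentiable Frölicher space. A tangent-vector-valued $p$-form on $M$ is an element $\xi\in[M\otimes\mathcal{W}_{D^p}\to M]\otimes\mathcal{W}_D$ that lies over the projection $\delta^p_M:M\otimes\mathcal{W}_{D^p}\to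 M$, is homogeneous (replacing the $i$-th argument $d_i$ by $\alpha d_i$ turns $\xi$ into $\alpha\xi$, for all $\alpha\in\mathbb{R}$ and $1\le i\le p$) and alternating ($\xi^\sigma=\varepsilon_\sigma\xi$ for every $\sigma\in\mathbb{S}_p$, where $\xi^\sigma$ is obtained from $(d_1,\dots,d_p)\mapsto(d_{\sigma(1)},\dots,d_{\sigma(p)})$). For $\eta_1\in[M\otimes\mathcal{W}_{D^p}\to M]$ and $\eta_2\in[M\otimes\mathcal{W}_{D^q}\to M]$ let $$\eta_1*\eta_2:\ M\otimes\mathcal{W}_{D^{p+q}}=(M\otimes\mathcal{W}_{D^q})\otimes\mathcal{W}_{D^p}\xrightarrow{\eta_2\otimes\mathrm{id}}M\otimes\mathcal{W}_{D^p}\xrightarrow{\eta_1}M,$$ $$\eta_1\,\widetilde{*}\,\eta_2:\ M\otimes\mathcal{W}_{D^{p+q}}=(M\otimes\mathcal{W}_{D^p})\otimes\mathcal{W}_{D^q}\xrightarrow{\eta_1\otimes\mathrm{id}}M\otimes\mathcal{W}_{D^q}\xrightarrow{\eta_2}M.$$ Applying $*\otimes\mathrm{id}$ and $\widetilde{*}\otimes\mathrm{id}$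 with $\xi_1$ depending on $d_1$ and $\xi_2$ on $d_2$ gives $\xi_1\circledast\xi_2,\ \xi_1\widetilde{\circledast}\xi_2\in[M\otimes\mathcal{W}_{D^{p+q}}\to M]\otimes\mathcal{W}_{D^2}$. Put $[\xi_1,\xi_2]_L=\xi_1\widetilde{\circledast}\xi_2\overset{\cdot}{-}\xi_1\circledast\xi_2$ and define the Frölicher–Nijenhuis bracket of a $p$-form $\xi_1$ and a $q$-form $\xi_2$ by $$[\xi_1,\xi_2]_{FN}=\frac{1}{p!\,q!}\sum_{\sigma\in\mathbb{S}_{p+q}}\varepsilon_\sigma\,([\xi_1,\xi_2]_L)^\sigma .$$ Theorem. If $\xi_1,\xi_2,\xi_3$ are tangent-vector-valued $p$-, $q$- and $r$-forms on $M$, then the brackets $[\xi_2,\xi_3]_{FN}$, $[\xi_3,\xi_1]_{FN}$, $[\xi_1,\xi_2]_{FN}$ are again tangent-vector-valued forms, and $$[\xi_1,[\xi_2,\xi_3]_{FN}]_{FN}+(-1)^{p(q+r)}[\xi_2,[\xi_3,\xi_1]_{FN}]_{FN}+(-1)^{r(p+q)}[\xi_3,[\xi_1,\xi_2]_{FN}]_{FN}=0,$$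 an identity of tangent vectors of $[M\otimes\mathcal{W}_{D^{p+q+r}}\to M]$ at $\delta_M^{p+q+r}$. -/

import Mathlib

open CategoryTheory
open scoped ContDiff TensorProduct

universe u

noncomputable section

/-! # Frölicher spaces -/

/-- A Frölicher space: a set with a class of structure curves and a class of structure functions
which determine each other through smoothness of the composites `ℝ → ℝ`. -/
structure FrolicherSpace : Type (u + 1) where
  carrier : Type u
  curves : Set (ℝ → carrier)
  functions : Set (carrier → ℝ)
  mem_curves_iff : ∀ c, c ∈ curves ↔ ∀ f ∈ functions, ContDiff ℝ ∞ (f ∘ c)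
  mem_functions_iff : ∀ f, f ∈ functions ↔ ∀ c ∈ curves, ContDiff ℝ ∞ (f ∘ c)

namespace FrolicherSpace

instance : CoeSort FrolicherSpace.{u} (Type u) := ⟨FrolicherSpace.carrier⟩

/-- A map of Frölicher spaces is smooth if it pulls structure functions back to structure
functions. -/
def IsSmooth {X Y : FrolicherSpace.{u}} (f : X → Y) : Prop :=
  ∀ χ ∈ Y.functions, χ ∘ f ∈ X.functions

/-- Equivalently, a smooth map sends structure curves to structure curves. -/
theorem isSmooth_iff_curves {X Y : FrolicherSpace.{u}} (f : X → Y) :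
    IsSmooth f ↔ ∀ c ∈ X.curves, f ∘ c ∈ Y.curves := by
  constructor
  · intro h c hc
    rw [Y.mem_curves_iff]
    intro χ hχ
    exact (X.mem_functions_iff _).1 (h χ hχ) c hc
  · intro h χ hχ
    rw [X.mem_functions_iff]
    intro c hc
    exact (Y.mem_curves_iff _).1 (h c hc) χ hχ

/-- The category of Frölicher spaces and smooth maps. -/
instance : Category FrolicherSpace.{u} where
  Hom X Y := {f : X → Y // IsSmooth f}
  id X := ⟨fun x => x, fun _ h => h⟩
  comp f g := ⟨fun x => g.1 (f.1 x), fun χ h => f.2 _ (g.2 χ h)⟩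

/-- The Frölicher space generated by a set `S` of curves: the structure functions are all the
functions that are smooth along the curves in `S`. -/
def generate (A : Type u) (S : Set (ℝ → A)) : FrolicherSpace.{u} where
  carrier := A
  curves := {c | ∀ f : A → ℝ, (∀ s ∈ S, ContDiff ℝ ∞ (f ∘ s)) → ContDiff ℝ ∞ (f ∘ c)}
  functions := {f | ∀ s ∈ S, ContDiff ℝ ∞ (f ∘ s)}
  mem_curves_iff _ := Iff.rfl
  mem_functions_iff f := ⟨fun hf c hc => hc f hf, fun hf s hs => hf s (fun _ hg => hg s hs)⟩

theorem isSmooth_generate {A : Type u} {S : Set (ℝ → A)} {Y : FrolicherSpace.{u}}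
    (f : generate A S → Y) (h : ∀ s ∈ S, f ∘ s ∈ Y.curves) : IsSmooth f :=
  fun χ hχ s hs => (Y.mem_curves_iff _).1 (h s hs) χ hχ

theorem mem_curves_generate {A : Type u} {S : Set (ℝ → A)} {s : ℝ → A} (hs : s ∈ S) :
    s ∈ (generate A S).curves :=
  fun _ hf => hf s hs

/-- The one-point Frölicher space. -/
def point : FrolicherSpace.{u} := generate PUnit.{u + 1} Set.univ

/-- The product of two Frölicher spaces. -/
def prod (X Y : FrolicherSpace.{u}) : FrolicherSpace.{u} where
  carrier := X × Y
  curves := {c | (fun t => (c t).1) ∈ X.curves ∧ (fun t => (c t).2) ∈ Y.curves}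
  functions := {f | ∀ c : ℝ → X × Y,
    (fun t => (c t).1) ∈ X.curves ∧ (fun t => (c t).2) ∈ Y.curves → ContDiff ℝ ∞ (f ∘ c)}
  mem_curves_iff _ := by
    constructor
    · intro hc f hf
      exact hf _ hc
    · intro h
      refine ⟨(X.mem_curves_iff _).2 fun χ hχ => ?_, (Y.mem_curves_iff _).2 fun χ hχ => ?_⟩
      · exact h (fun z => χ z.1) fun _ hc' => (X.mem_curves_iff _).1 hc'.1 χ hχ
      · exact h (fun z => χ z.2) fun _ hc' => (Y.mem_curves_iff _).1 hc'.2 χ hχ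
  mem_functions_iff _ := Iff.rfl

def fst (X Y : FrolicherSpace.{u}) : prod X Y ⟶ X :=
  ⟨fun z => z.1, fun χ hχ _ hc => (X.mem_curves_iff _).1 hc.1 χ hχ⟩

def snd (X Y : FrolicherSpace.{u}) : prod X Y ⟶ Y :=
  ⟨fun z => z.2, fun χ hχ _ hc => (Y.mem_curves_iff _).1 hc.2 χ hχ⟩

/-- The exponential `X ^ Y = [Y → X]`: the set of smooth maps `Y → X`, with the structure generated
by the curves `c` for which `ℝ × Y → X`, `(s, y) ↦ c s y`, is smooth. -/
def exp (Y X : FrolicherSpace.{u}) : FrolicherSpace.{u} :=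
  generate (Y ⟶ X) {c | ∀ s : ℝ → ℝ, ContDiff ℝ ∞ s → ∀ y ∈ Y.curves,
    (fun t => (c (s t)).1 (y t)) ∈ X.curves}

theorem const_mem_curves (X : FrolicherSpace.{u}) (x : X) : (fun _ : ℝ => x) ∈ X.curves := by
  rw [X.mem_curves_iff]
  intro f _
  exact contDiff_const (c := f x)

/-- Evaluation `[Y → X] → X` at a point `y`. -/
def evalAt {Y : FrolicherSpace.{u}} (X : FrolicherSpace.{u}) (y : Y) : exp Y X ⟶ X :=
  ⟨fun η => η.1 y, isSmooth_generate _ fun _ hc =>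
    hc (fun t => t) contDiff_id (fun _ => y) (const_mem_curves Y y)⟩

/-- The canonical map `X → [1 → X]`. -/
def toExpPoint (X : FrolicherSpace.{u}) : X ⟶ exp point X :=
  ⟨fun x => ⟨fun _ => x, (isSmooth_iff_curves _).2 fun _ _ => const_mem_curves X x⟩,
    (isSmooth_iff_curves _).2 fun c hc => mem_curves_generate fun _ hs _ _ =>
      (X.mem_curves_iff _).2 fun f hf => ((X.mem_curves_iff c).1 hc f hf).comp hs⟩

/-- Precomposition `h* : [Y → X] → [Y' → X]` with `h : Y' → Y`. -/
def precomp {Y' Y : FrolicherSpace.{u}} (h : Y' ⟶ Y) (X : FrolicherSpace.{u}) :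
    exp Y X ⟶ exp Y' X :=
  ⟨fun η => h ≫ η, isSmooth_generate _ fun _ hc => mem_curves_generate fun s hs y hy =>
    hc s hs (fun t => h.1 (y t)) ((isSmooth_iff_curves _).1 h.2 y hy)⟩

/-- Smooth maps from a finite dimensional vector space `E` (with its usual smooth structure) to a
Frölicher space. -/
def IsPlot {E : Type*} [NormedAddCommGroup E] [NormedSpace ℝ E] (X : FrolicherSpace.{u})
    (f : E → X) : Prop :=
  ∀ χ ∈ X.functions, ContDiff ℝ ∞ (χ ∘ f)

end FrolicherSpace

/-! # Weil algebras -/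

/-- A Weil algebra: a finite dimensional commutative real algebra `W = ℝ ⊕ 𝔪` with an augmentation
`W → ℝ` whose kernel `𝔪` consists of nilpotent elements. -/
structure WeilAlgebra : Type 1 where
  carrier : Type
  [commRing : CommRing carrier]
  [algebra : Algebra ℝ carrier]
  [finite : Module.Finite ℝ carrier]
  aug : carrier →ₐ[ℝ] ℝ
  nil : ∀ x, aug x = 0 → IsNilpotent x

namespace WeilAlgebra

attribute [instance] WeilAlgebra.commRing WeilAlgebra.algebra WeilAlgebra.finite

instance : CoeSort WeilAlgebra Type := ⟨WeilAlgebra.carrier⟩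

/-- The category of Weil algebras and algebra homomorphisms. -/
instance : Category WeilAlgebra where
  Hom W V := W →ₐ[ℝ] V
  id W := AlgHom.id ℝ W
  comp φ ψ := AlgHom.comp ψ φ

/-- The underlying algebra homomorphism. -/
def toAlgHom {W V : WeilAlgebra} (φ : W ⟶ V) : W →ₐ[ℝ] V := φ

/-- Homomorphisms of Weil algebras commute with the augmentations. -/
theorem aug_hom {W V : WeilAlgebra} (φ : W →ₐ[ℝ] V) (x : W) : V.aug (φ x) = W.aug x := by
  have h : IsNilpotent (x - algebraMap ℝ W (W.aug x)) := W.nil _ (by simp)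
  have h2 : IsNilpotent (V.aug (φ (x - algebraMap ℝ W (W.aug x)))) :=
    (h.map φ).map V.aug
  have h3 := h2.eq_zero
  simp only [map_sub, AlgHom.commutes] at h3
  exact sub_eq_zero.1 (by simpa using h3)

theorem exists_ker_pow (W : WeilAlgebra) :
    ∃ N : ℕ, (RingHom.ker W.aug) ^ N = ⊥ := by
  have : IsNoetherianRing W := IsNoetherianRing.of_finite ℝ W
  obtain ⟨N, hN⟩ := IsNoetherianRing.isNilpotent_nilradical W
  refine ⟨N, ?_⟩
  have hle : RingHom.ker W.aug ≤ nilradical W := fun x hx => by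
    rw [mem_nilradical]
    exact W.nil x hx
  exact le_bot_iff.1 ((Ideal.pow_right_mono hle N).trans (by rw [hN]; exact le_of_eq rfl))

open Classical in
/-- An order of nilpotency of the maximal ideal. -/
def order (W : WeilAlgebra) : ℕ := Nat.find W.exists_ker_pow

theorem prod_eq_zero (W : WeilAlgebra) {k : ℕ} (hk : W.order ≤ k) (a : Fin k → W)
    (ha : ∀ i, W.aug (a i) = 0) : ∏ i, a i = 0 := by
  classical
  have h0 : (RingHom.ker W.aug) ^ W.order = ⊥ := Nat.find_spec W.exists_ker_pow
  have h1 : ∏ i, a i ∈ (RingHom.ker W.aug) ^ k := by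
    have := Ideal.prod_mem_prod (s := Finset.univ) (I := fun _ : Fin k => RingHom.ker W.aug)
      (x := a) (fun i _ => ha i)
    simpa using this
  have h2 := Ideal.pow_le_pow_right hk h1
  rw [h0] at h2
  simpa using h2

/-- The part of degree `k` of the Taylor expansion at `0` of `h : ℝⁿ → ℝ`, evaluated at
`a : Fin n → W`. -/
def taylorTerm (W : WeilAlgebra) {n : ℕ} (h : (Fin n → ℝ) → ℝ) (a : Fin n → W) (k : ℕ) : W :=
  ((k.factorial : ℝ)⁻¹) • ∑ i : Fin k → Fin n,
    iteratedFDeriv ℝ k h 0 (fun j => Pi.single (i j) (1 : ℝ)) • ∏ j, a (i j)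

/-- The value `h(a) ∈ W` of a smooth function `h : ℝⁿ → ℝ` at a tuple `a` of elements of the maximal
ideal of a Weil algebra, given by the Taylor expansion of `h` at `0` (a finite sum). -/
def taylor (W : WeilAlgebra) {n : ℕ} (h : (Fin n → ℝ) → ℝ) (a : Fin n → W) : W :=
  ∑ k ∈ Finset.range W.order, W.taylorTerm h a k

theorem taylor_eq (W : WeilAlgebra) {n : ℕ} (h : (Fin n → ℝ) → ℝ) (a : Fin n → W)
    (ha : ∀ i, W.aug (a i) = 0) {N : ℕ} (hN : W.order ≤ N) :
    W.taylor h a = ∑ k ∈ Finset.range N, W.taylorTerm h a k := by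
  refine Finset.sum_subset (Finset.range_mono hN) fun k _ hk => ?_
  have hk' : W.order ≤ k := by simpa using hk
  unfold taylorTerm
  rw [Finset.sum_eq_zero, smul_zero]
  intro i _
  rw [W.prod_eq_zero hk' _ fun j => ha (i j), smul_zero]

theorem taylor_hom {W V : WeilAlgebra} (φ : W →ₐ[ℝ] V) {n : ℕ} (h : (Fin n → ℝ) → ℝ)
    (a : Fin n → W) (ha : ∀ i, W.aug (a i) = 0) :
    V.taylor h (fun i => φ (a i)) = φ (W.taylor h a) := by
  rw [W.taylor_eq h a ha (le_max_left W.order V.order),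
    V.taylor_eq h _ (fun i => by rw [aug_hom, ha]) (le_max_right W.order V.order), map_sum]
  refine Finset.sum_congr rfl fun k _ => ?_
  simp [taylorTerm, map_sum, map_prod]

/-- The tensor product of two Weil algebras. -/
def tensor (W V : WeilAlgebra) : WeilAlgebra where
  carrier := W ⊗[ℝ] V
  aug := Algebra.TensorProduct.lift W.aug V.aug fun _ _ => mul_comm _ _
  nil := by
    set ε : (W ⊗[ℝ] V) →ₐ[ℝ] ℝ :=
      Algebra.TensorProduct.lift W.aug V.aug fun _ _ => mul_comm _ _ with hε
    have key : ∀ z, IsNilpotent (z - algebraMap ℝ (W ⊗[ℝ] V) (ε z)) := by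
      intro z
      induction z using TensorProduct.induction_on with
      | zero => simp
      | tmul x y =>
        have h1 : IsNilpotent (x - algebraMap ℝ W (W.aug x)) := W.nil _ (by simp)
        have h2 : IsNilpotent (y - algebraMap ℝ V (V.aug y)) := V.nil _ (by simp)
        have e1 := h1.map (Algebra.TensorProduct.includeLeft : W →ₐ[ℝ] W ⊗[ℝ] V)
        have e2 := h2.map (Algebra.TensorProduct.includeRight : V →ₐ[ℝ] W ⊗[ℝ] V)
        have he : ε (x ⊗ₜ[ℝ] y) = W.aug x * V.aug y := Algebra.TensorProduct.lift_tmul ..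
        have hs : x ⊗ₜ[ℝ] y - algebraMap ℝ (W ⊗[ℝ] V) (ε (x ⊗ₜ[ℝ] y)) =
            ((1 : W) ⊗ₜ[ℝ] y) * (Algebra.TensorProduct.includeLeft : W →ₐ[ℝ] W ⊗[ℝ] V)
                (x - algebraMap ℝ W (W.aug x)) +
              algebraMap ℝ (W ⊗[ℝ] V) (W.aug x) *
                (Algebra.TensorProduct.includeRight : V →ₐ[ℝ] W ⊗[ℝ] V)
                (y - algebraMap ℝ V (V.aug y)) := by
          simp only [map_sub, AlgHom.commutes, mul_sub, he, map_mul, Algebra.TensorProduct.includeLeft_apply,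
            Algebra.TensorProduct.includeRight_apply, Algebra.TensorProduct.tmul_mul_tmul,
            one_mul, mul_one]
          rw [mul_comm ((1 : W) ⊗ₜ[ℝ] y)]
          abel
        rw [hs]
        exact (Commute.all _ _).isNilpotent_add ((Commute.all _ _).isNilpotent_mul_left e1)
          ((Commute.all _ _).isNilpotent_mul_left e2)
      | add x y hx hy =>
        have : x + y - algebraMap ℝ (W ⊗[ℝ] V) (ε (x + y)) =
            (x - algebraMap ℝ (W ⊗[ℝ] V) (ε x)) + (y - algebraMap ℝ (W ⊗[ℝ] V) (ε y)) := by
          rw [map_add, map_add]; ring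
        rw [this]
        exact (Commute.all _ _).isNilpotent_add hx hy
    intro z hz
    have := key z
    rwa [hz, map_zero, sub_zero] at this

/-- The element `x ⊗ 1`. -/
def inl {W V : WeilAlgebra} (x : W) : tensor W V := (x ⊗ₜ[ℝ] (1 : V) : W ⊗[ℝ] V)

/-- The element `1 ⊗ y`. -/
def inr {W V : WeilAlgebra} (y : V) : tensor W V := ((1 : W) ⊗ₜ[ℝ] y : W ⊗[ℝ] V)

theorem inl_mul {W V : WeilAlgebra} (x y : W) : (inl x * inl y : tensor W V) = inl (x * y) := by
  change (x ⊗ₜ[ℝ] (1 : V) : W ⊗[ℝ] V) * (y ⊗ₜ[ℝ] (1 : V)) = (x * y) ⊗ₜ[ℝ] (1 : V)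
  rw [Algebra.TensorProduct.tmul_mul_tmul, one_mul]

theorem inr_mul {W V : WeilAlgebra} (x y : V) : (inr x * inr y : tensor W V) = inr (x * y) := by
  change ((1 : W) ⊗ₜ[ℝ] x : W ⊗[ℝ] V) * ((1 : W) ⊗ₜ[ℝ] y) = (1 : W) ⊗ₜ[ℝ] (x * y)
  rw [Algebra.TensorProduct.tmul_mul_tmul, one_mul]

theorem inl_zero {W V : WeilAlgebra} : (inl 0 : tensor W V) = 0 := TensorProduct.zero_tmul _ _

theorem inr_zero {W V : WeilAlgebra} : (inr 0 : tensor W V) = 0 := TensorProduct.tmul_zero _ _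

/-- The ideal generated by the squares `Xᵢ²` and by the products `Xᵢ Xⱼ` with `S i j`. -/
def relIdeal (n : ℕ) (S : Fin n → Fin n → Prop) : Ideal (MvPolynomial (Fin n) ℝ) :=
  Ideal.span {f | ∃ i j, (i = j ∨ S i j) ∧ f = MvPolynomial.X i * MvPolynomial.X j}

/-- The algebra of the infinitesimal object
`{(d₁, …, dₙ) ∈ Dⁿ | dᵢ dⱼ = 0 whenever S i j}`, where `D = {d | d² = 0}`. -/
def infinitesimal (n : ℕ) (S : Fin n → Fin n → Prop) : WeilAlgebra where
  carrier := MvPolynomial (Fin n) ℝ ⧸ relIdeal n S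
  finite := by
    have hint : Algebra.IsIntegral ℝ (MvPolynomial (Fin n) ℝ ⧸ relIdeal n S) := by
      constructor
      intro z
      obtain ⟨f, rfl⟩ := Ideal.Quotient.mk_surjective z
      induction f using MvPolynomial.induction_on with
      | C a => exact isIntegral_algebraMap (R := ℝ) (x := a)
      | add f g hf hg => rw [map_add]; exact hf.add hg
      | mul_X f i hf =>
        rw [map_mul]
        refine hf.mul ?_
        refine IsIntegral.of_pow (n := 2) (by norm_num) ?_
        have : (Ideal.Quotient.mk (relIdeal n S) (MvPolynomial.X i)) ^ 2 = 0 := by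
          rw [← map_pow, Ideal.Quotient.eq_zero_iff_mem, pow_two]
          exact Ideal.subset_span ⟨i, i, Or.inl rfl, rfl⟩
        rw [this]
        exact isIntegral_zero
    exact Algebra.IsIntegral.finite
  aug := Ideal.Quotient.liftₐ (relIdeal n S) (MvPolynomial.aeval fun _ => (0 : ℝ)) (by
    intro f hf
    have : relIdeal n S ≤ RingHom.ker (MvPolynomial.aeval (R := ℝ) fun _ : Fin n => (0 : ℝ)) := by
      refine Ideal.span_le.2 ?_
      rintro _ ⟨i, j, _, rfl⟩
      simp [RingHom.mem_ker]
    exact this hf)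
  nil := by
    intro z
    obtain ⟨f, rfl⟩ := Ideal.Quotient.mk_surjective z
    intro hz
    have hz' : MvPolynomial.aeval (R := ℝ) (fun _ : Fin n => (0 : ℝ)) f = 0 := hz
    have key : ∀ g : MvPolynomial (Fin n) ℝ, IsNilpotent (Ideal.Quotient.mk (relIdeal n S)
        (g - MvPolynomial.C (MvPolynomial.aeval (R := ℝ) (fun _ : Fin n => (0 : ℝ)) g))) := by
      intro g
      induction g using MvPolynomial.induction_on with
      | C a => simp
      | add f g hf hg =>
        have : f + g - MvPolynomial.C (MvPolynomial.aeval (R := ℝ) (fun _ => (0 : ℝ)) (f + g)) =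
            (f - MvPolynomial.C (MvPolynomial.aeval (R := ℝ) (fun _ => (0 : ℝ)) f)) +
            (g - MvPolynomial.C (MvPolynomial.aeval (R := ℝ) (fun _ => (0 : ℝ)) g)) := by
          rw [map_add, map_add]; ring
        rw [this, map_add]
        exact (Commute.all _ _).isNilpotent_add hf hg
      | mul_X f i _ =>
        rw [map_mul (MvPolynomial.aeval fun _ : Fin n => (0 : ℝ)), MvPolynomial.aeval_X, mul_zero,
          map_zero, sub_zero, map_mul]
        refine (Commute.all _ _).isNilpotent_mul_left ⟨2, ?_⟩
        rw [← map_pow, Ideal.Quotient.eq_zero_iff_mem, pow_two]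
        exact Ideal.subset_span ⟨i, i, Or.inl rfl, rfl⟩
    have := key f
    rwa [hz', map_zero, sub_zero] at this

/-- The coordinate `dᵢ`. -/
def coord {n : ℕ} {S : Fin n → Fin n → Prop} (i : Fin n) : infinitesimal n S :=
  Ideal.Quotient.mk (relIdeal n S) (MvPolynomial.X i)

theorem coord_mul_coord {n : ℕ} {S : Fin n → Fin n → Prop} {i j : Fin n} (h : i = j ∨ S i j) :
    (coord i * coord j : infinitesimal n S) = 0 := by
  change Ideal.Quotient.mk (relIdeal n S) (MvPolynomial.X i) *
    Ideal.Quotient.mk (relIdeal n S) (MvPolynomial.X j) = 0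
  rw [← map_mul, Ideal.Quotient.eq_zero_iff_mem]
  exact Ideal.subset_span ⟨i, j, h, rfl⟩

/-- The homomorphism out of the algebra of an infinitesimal object that sends the coordinate `dᵢ`
to `w i`. -/
def lift {n : ℕ} {S : Fin n → Fin n → Prop} {W : WeilAlgebra} (w : Fin n → W)
    (hw : ∀ i j, (i = j ∨ S i j) → w i * w j = 0) : infinitesimal n S ⟶ W :=
  Ideal.Quotient.liftₐ (relIdeal n S) (MvPolynomial.aeval w) (by
    intro f hf
    have : relIdeal n S ≤ RingHom.ker (MvPolynomial.aeval (R := ℝ) w) := by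
      refine Ideal.span_le.2 ?_
      rintro _ ⟨i, j, h, rfl⟩
      simpa [RingHom.mem_ker] using hw i j h
    exact this hf)

/-- The algebra of `Dⁿ = {(d₁, …, dₙ) | d₁² = ⋯ = dₙ² = 0}`. -/
abbrev cube (n : ℕ) : WeilAlgebra := infinitesimal n fun _ _ => False

/-- The algebra of `D(2) = {(d₁, d₂) ∈ D² | d₁ d₂ = 0}`. -/
abbrev axes : WeilAlgebra := infinitesimal 2 fun _ _ => True

/-- The algebra of `D² ⊕ D = {(d₁, d₂, e) ∈ D³ | d₁ e = d₂ e = 0}`. -/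
abbrev squarePlus : WeilAlgebra := infinitesimal 3 fun i j => i ≠ 2 ∧ j = 2

end WeilAlgebra

namespace FrolicherSpace

/-! # Weil prolongations -/

/-- An expression `f(a)` with `f : ℝⁿ → X` smooth and `a` a tuple of `n` elements of the maximal ideal
of the Weil algebra `W`. -/
structure WeilPoint (X : FrolicherSpace.{u}) (W : WeilAlgebra) : Type u where
  n : ℕ
  toFun : (Fin n → ℝ) → X
  isPlot : IsPlot X toFun
  arg : Fin n → W
  aug_arg : ∀ i, W.aug (arg i) = 0

/-- Two expressions `f(a)` and `g(b)` are identified if `f(0) = g(0)` and if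
`(χ ∘ f)(a) = (χ ∘ g)(b)` in `W` for every structure function `χ`. If the `aᵢ` generate `W`, so that
`W = C^∞(ℝⁿ)/I` with `I = {h | h(a) = 0}`, then every expression is identified with one of the form
`f(a)`, and `f(a)` is identified with `g(a)` if and only if `f(0) = g(0)` and
`χ ∘ f - χ ∘ g ∈ I` for every structure function `χ`. -/
instance weilSetoid (X : FrolicherSpace.{u}) (W : WeilAlgebra) : Setoid (WeilPoint X W) where
  r x y := x.toFun 0 = y.toFun 0 ∧
    ∀ χ ∈ X.functions, W.taylor (χ ∘ x.toFun) x.arg = W.taylor (χ ∘ y.toFun) y.arg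
  iseqv := ⟨fun _ => ⟨rfl, fun _ _ => rfl⟩, fun h => ⟨h.1.symm, fun χ hχ => (h.2 χ hχ).symm⟩,
    fun h h' => ⟨h.1.trans h'.1, fun χ hχ => (h.2 χ hχ).trans (h'.2 χ hχ)⟩⟩

/-- The class of `f(a)`. -/
def weilClass {X : FrolicherSpace.{u}} {W : WeilAlgebra} {n : ℕ} (f : (Fin n → ℝ) → X)
    (hf : IsPlot X f) (a : Fin n → W) (ha : ∀ i, W.aug (a i) = 0) : Quotient (weilSetoid X W) :=
  Quotient.mk _ ⟨n, f, hf, a, ha⟩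

theorem IsPlot.comp {E F : Type*} [NormedAddCommGroup E] [NormedSpace ℝ E] [NormedAddCommGroup F]
    [NormedSpace ℝ F] {X : FrolicherSpace.{u}} {f : F → X} (hf : IsPlot X f) {g : E → F}
    (hg : ContDiff ℝ ∞ g) : IsPlot X (fun x => f (g x)) :=
  fun χ hχ => (hf χ hχ).comp hg

theorem IsPlot.map {E : Type*} [NormedAddCommGroup E] [NormedSpace ℝ E] {X Y : FrolicherSpace.{u}}
    {f : E → X} (hf : IsPlot X f) (g : X ⟶ Y) : IsPlot Y (fun x => g.1 (f x)) :=
  fun χ hχ => hf (χ ∘ g.1) (g.2 χ hχ)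

theorem IsPlot.const {E : Type*} [NormedAddCommGroup E] [NormedSpace ℝ E] (X : FrolicherSpace.{u})
    (x : X) : IsPlot X (fun _ : E => x) :=
  fun χ _ => contDiff_const (c := χ x)

/-- The Weil prolongation `X ⊗ W`. It carries the final structure with respect to the maps
`X ^ (ℝⁿ) → X ⊗ W`, `f ↦ f(a)`: it is generated by the curves `t ↦ F(t, ·)(a)` with
`F : ℝ × ℝⁿ → X` smooth. -/
def prolong (X : FrolicherSpace.{u}) (W : WeilAlgebra) : FrolicherSpace.{u} :=
  generate (Quotient (weilSetoid X W))
    {c | ∃ (n : ℕ) (F : ℝ × (Fin n → ℝ) → X) (hF : IsPlot X F) (a : Fin n → W)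
      (ha : ∀ i, W.aug (a i) = 0),
      ∀ t, c t = weilClass (fun x => F (t, x)) (hF.comp (by fun_prop)) a ha}

/-- The map `f ⊗ id : X ⊗ W → Y ⊗ W` induced by a smooth map `f : X → Y`. -/
def prolongMap {X Y : FrolicherSpace.{u}} (f : X ⟶ Y) (W : WeilAlgebra) :
    prolong X W ⟶ prolong Y W :=
  ⟨Quotient.map (fun x => ⟨x.n, fun s => f.1 (x.toFun s), x.isPlot.map f, x.arg, x.aug_arg⟩)
    fun _ _ h => ⟨congrArg f.1 h.1, fun χ hχ => h.2 (χ ∘ f.1) (f.2 χ hχ)⟩,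
    isSmooth_generate _ fun _ ⟨n, F, hF, a, ha, hc⟩ => mem_curves_generate
      ⟨n, fun z => f.1 (F z), hF.map f, a, ha, fun t => (congrArg _ (hc t)).trans rfl⟩⟩

/-- The map `id ⊗ φ : X ⊗ W → X ⊗ V` induced by a homomorphism `φ : W → V`. -/
def prolongHom (X : FrolicherSpace.{u}) {W V : WeilAlgebra} (φ : W ⟶ V) :
    prolong X W ⟶ prolong X V :=
  ⟨Quotient.map (fun x => ⟨x.n, x.toFun, x.isPlot, fun i => WeilAlgebra.toAlgHom φ (x.arg i),
      fun i => by rw [WeilAlgebra.aug_hom, x.aug_arg]⟩)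
    fun x y h => ⟨h.1, fun χ hχ => by
      rw [WeilAlgebra.taylor_hom _ _ _ x.aug_arg, WeilAlgebra.taylor_hom _ _ _ y.aug_arg,
        h.2 χ hχ]⟩,
    isSmooth_generate _ fun _ ⟨n, F, hF, a, ha, hc⟩ => mem_curves_generate
      ⟨n, F, hF, fun i => WeilAlgebra.toAlgHom φ (a i), fun i => by rw [WeilAlgebra.aug_hom, ha],
        fun t => (congrArg _ (hc t)).trans rfl⟩⟩

/-- The point `f(0)` underlying the class of `f(a)`. -/
def weilFoot {X : FrolicherSpace.{u}} {W : WeilAlgebra} : Quotient (weilSetoid X W) → X :=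
  Quotient.lift (fun x : WeilPoint X W => x.toFun 0)
    fun x y (h : (weilSetoid X W).r x y) => h.1

/-- The canonical projection `X ⊗ W → X`, `f(a) ↦ f(0)`. -/
def proj (X : FrolicherSpace.{u}) (W : WeilAlgebra) : prolong X W ⟶ X :=
  ⟨weilFoot, isSmooth_generate _ fun _ ⟨n, F, hF, a, ha, hc⟩ =>
    (X.mem_curves_iff _).2 fun χ hχ => by
      have h : ContDiff ℝ ∞ (fun t : ℝ => χ (F (t, 0))) := (hF χ hχ).comp (by fun_prop)
      convert h using 2 with t
      exact congrArg (fun z => χ (weilFoot z)) (hc t)⟩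

/-- The constant element of `X ⊗ W` at `x`. -/
def weilConst {X : FrolicherSpace.{u}} (x : X) (W : WeilAlgebra) : prolong X W :=
  weilClass (n := 0) (fun _ => x) (IsPlot.const X x) Fin.elim0 (fun i => i.elim0)

/-- The functor `W ↦ X ⊗ W`. -/
def weilFunctor (X : FrolicherSpace.{u}) : WeilAlgebra ⥤ FrolicherSpace.{u} where
  obj W := prolong X W
  map φ := prolongHom X φ
  map_id W := by
    apply Subtype.ext
    funext z
    obtain ⟨x, rfl⟩ := Quotient.mk_surjective z
    rfl
  map_comp φ ψ := by
    apply Subtype.ext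
    funext z
    obtain ⟨x, rfl⟩ := Quotient.mk_surjective z
    rfl

/-- Microlinearity: `X ⊗ ·` transforms finite limit diagrams of Weil algebras into limit diagrams of
Frölicher spaces. The limits are those of algebras; a limit of a finite diagram of Weil algebras in
the category of algebras is a Weil algebra exactly if the index category is connected. -/
def Microlinear (X : FrolicherSpace.{u}) : Prop :=
  ∀ (J : Type) [SmallCategory J] [FinCategory J] [IsConnected J],
    Limits.PreservesLimitsOfShape J (weilFunctor X)

/-- Weil exponentiability: the canonical identification
`(X ⊗ W₁) ^ Y ⊗ W₂ = (X ⊗ (W₁ ⊗ W₂)) ^ Y` is an isomorphism. It is given pointwise: under it an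
element `z` of the left-hand side corresponds to the map `Y → X ⊗ (W₁ ⊗ W₂)` whose value at `y` is
`F(a ⊗ 1, 1 ⊗ b)` whenever the image of `z` in `(X ⊗ W₁) ⊗ W₂` under evaluation at `y` is
`(t ↦ F(·, t)(a))(b)`. These conditions determine the isomorphism, and make it natural in all
variables. -/
def WeilExponentiable (X : FrolicherSpace.{u}) : Prop :=
  ∀ (Y : FrolicherSpace.{u}) (W₁ W₂ : WeilAlgebra),
    ∃ Φ : prolong (exp Y (prolong X W₁)) W₂ ≅ exp Y (prolong X (W₁.tensor W₂)),
      ∀ (z : prolong (exp Y (prolong X W₁)) W₂) (y : Y) (n m : ℕ)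
        (F : (Fin (n + m) → ℝ) → X) (hF : IsPlot X F)
        (a : Fin n → W₁) (ha : ∀ i, W₁.aug (a i) = 0)
        (b : Fin m → W₂) (hb : ∀ i, W₂.aug (b i) = 0)
        (hab : ∀ i, (W₁.tensor W₂).aug (Fin.append (fun i => WeilAlgebra.inl (a i))
          (fun j => WeilAlgebra.inr (b j)) i) = 0)
        (hFt : ∀ t : Fin m → ℝ, IsPlot X fun x : Fin n → ℝ => F (Fin.append x t))
        (hg : IsPlot (prolong X W₁)
          fun t : Fin m → ℝ => weilClass (fun x => F (Fin.append x t)) (hFt t) a ha),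
        (prolongMap (evalAt (prolong X W₁) y) W₂).1 z = weilClass _ hg b hb →
        (Φ.hom.1 z).1 y = weilClass F hF _ hab

/-- The canonical map `X ⊗ (W₁ ⊗ W₂) → (X ⊗ W₁) ⊗ W₂` for a Weil exponentiable space `X`. -/
def WeilExponentiable.assoc {X : FrolicherSpace.{u}} (hX : X.WeilExponentiable)
    (W₁ W₂ : WeilAlgebra) : prolong X (W₁.tensor W₂) ⟶ prolong (prolong X W₁) W₂ :=
  toExpPoint _ ≫ (hX point W₁ W₂).choose.inv ≫
    prolongMap (evalAt (prolong X W₁) (PUnit.unit : PUnit.{u + 1})) W₂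

/-! # Tangent vectors -/

/-- The space of tangent vectors `X ⊗ W_D`. -/
abbrev tangent (X : FrolicherSpace.{u}) : FrolicherSpace.{u} := prolong X (WeilAlgebra.cube 1)

end FrolicherSpace

namespace WeilAlgebra

theorem cube_coord_sq {n : ℕ} (i : Fin n) : (coord i * coord i : cube n) = 0 :=
  coord_mul_coord (Or.inl rfl)

/-- A homomorphism out of the algebra of `Dⁿ`, given by the images of the coordinates. -/
def cubeLift {n : ℕ} {W : WeilAlgebra} (w : Fin n → W) (hw : ∀ i, w i * w i = 0) : cube n ⟶ W :=
  lift w fun i j h => by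
    rcases h with rfl | h
    · exact hw i
    · exact h.elim

/-- Induced by `(d₁, …, dₘ₊ₙ) ↦ (d₁, …, dₘ)`. -/
def cubeLeft (m n : ℕ) : cube m ⟶ cube (m + n) :=
  cubeLift (fun i => coord (Fin.castAdd n i)) fun _ => cube_coord_sq _

/-- Induced by `(d₁, …, dₘ₊ₙ) ↦ (dₘ₊₁, …, dₘ₊ₙ)`. -/
def cubeRight (m n : ℕ) : cube n ⟶ cube (m + n) :=
  cubeLift (fun i => coord (Fin.natAdd m i)) fun _ => cube_coord_sq _

/-- Induced by `(d₁, …, dₚ) ↦ (d_{σ(1)}, …, d_{σ(p)})`. -/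
def cubePerm {p : ℕ} (σ : Equiv.Perm (Fin p)) : cube p ⟶ cube p :=
  cubeLift (fun i => coord (σ i)) fun _ => cube_coord_sq _

/-- Induced by `(d₁, …, dₚ) ↦ (d₁, …, α dᵢ, …, dₚ)`. -/
def cubeScale {p : ℕ} (α : ℝ) (i : Fin p) : cube p ⟶ cube p :=
  cubeLift (fun j => if j = i then α • coord j else coord j) fun j => by
    split_ifs
    · rw [smul_mul_smul_comm, cube_coord_sq, smul_zero]
    · exact cube_coord_sq j

/-- The identification of the algebra of `Dᵖ⁺ᑫ` with the tensor product of those of `Dᵖ` and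
`Dᑫ`. -/
def cubeSplit (p q : ℕ) : cube (p + q) ⟶ tensor (cube p) (cube q) :=
  cubeLift (Fin.append (fun i => inl (coord i)) fun j => inr (coord j)) fun k => by
    refine Fin.addCases (fun i => ?_) (fun j => ?_) k
    · rw [Fin.append_left, inl_mul, cube_coord_sq, inl_zero]
    · rw [Fin.append_right, inr_mul, cube_coord_sq, inr_zero]

/-- The same identification, followed by the interchange of the two factors. -/
def cubeSplitSwap (p q : ℕ) : cube (p + q) ⟶ tensor (cube q) (cube p) :=
  cubeLift (Fin.append (fun i => inr (coord i)) fun j => inl (coord j)) fun k => by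
    refine Fin.addCases (fun i => ?_) (fun j => ?_) k
    · rw [Fin.append_left, inr_mul, cube_coord_sq, inr_zero]
    · rw [Fin.append_right, inl_mul, cube_coord_sq, inl_zero]

/-- Induced by the inclusion of the `i`-th axis `D → D(2)`: `d ↦ (d, 0)` for `i = 0`, `d ↦ (0, d)` for
`i = 1`. -/
def axesIncl (i : Fin 2) : axes ⟶ cube 1 :=
  lift (fun j => if j = i then coord 0 else 0) fun j k _ => by
    split_ifs <;> simp [cube_coord_sq]

/-- Induced by the diagonal `D → D(2)`, `d ↦ (d, d)`. -/
def axesDiag : axes ⟶ cube 1 :=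
  lift (fun _ => coord 0) fun _ _ _ => cube_coord_sq 0

/-- Induced by `φ : D² → D² ⊕ D`, `(d₁, d₂) ↦ (d₁, d₂, 0)`. -/
def squarePlusPhi : squarePlus ⟶ cube 2 :=
  lift ![coord 0, coord 1, 0] fun i j h => by
    fin_cases i <;> fin_cases j <;> simp_all [cube_coord_sq]

/-- Induced by `ψ : D² → D² ⊕ D`, `(d₁, d₂) ↦ (d₁, d₂, d₁ d₂)`. -/
def squarePlusPsi : squarePlus ⟶ cube 2 :=
  lift ![coord 0, coord 1, coord 0 * coord 1] fun i j h => by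
    have h0 := cube_coord_sq (0 : Fin 2)
    have h1 := cube_coord_sq (1 : Fin 2)
    have e0 : (coord 0 * (coord 0 * coord 1) : cube 2) = 0 := by rw [← mul_assoc, h0, zero_mul]
    have e1 : (coord 1 * (coord 0 * coord 1) : cube 2) = 0 := by
      rw [mul_left_comm, h1, mul_zero]
    have e2 : (coord 0 * coord 1 * (coord 0 * coord 1) : cube 2) = 0 := by
      rw [mul_assoc, e1, mul_zero]
    fin_cases i <;> fin_cases j <;> simp_all

/-- Induced by `D → D² ⊕ D`, `d ↦ (0, 0, d)`. -/
def squarePlusLast : squarePlus ⟶ cube 1 :=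
  lift ![0, 0, coord 0] fun i j h => by
    fin_cases i <;> fin_cases j <;> simp_all [cube_coord_sq]

end WeilAlgebra

namespace FrolicherSpace

open WeilAlgebra

instance {X : FrolicherSpace.{u}} [h : Nonempty X] (W : WeilAlgebra) : Nonempty (prolong X W) :=
  h.map fun x => weilConst x W

/-- The zero tangent vector at `x`. -/
def tzero {X : FrolicherSpace.{u}} (x : X) : tangent X := weilConst x (cube 1)

/-- Multiplication of tangent vectors by scalars, `(α t)(d) = t(α d)`. -/
def tsmul {X : FrolicherSpace.{u}} (α : ℝ) (t : tangent X) : tangent X :=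
  (prolongHom X (cubeScale α 0)).1 t

open Classical in
/-- Addition of tangent vectors at the same point: `(t₁ + t₂)(d) = ζ(d, d)`, where `ζ ∈ X ⊗ W_{D(2)}`
is the element with `ζ(d, 0) = t₁(d)` and `ζ(0, d) = t₂(d)`. For microlinear `X` there is exactly
one such `ζ`. -/
def tadd {X : FrolicherSpace.{u}} (t₁ t₂ : tangent X) : tangent X :=
  if h : ∃ ζ : prolong X axes,
      (prolongHom X (axesIncl 0)).1 ζ = t₁ ∧ (prolongHom X (axesIncl 1)).1 ζ = t₂ then
    (prolongHom X axesDiag).1 h.choose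
  else t₁

open Classical in
/-- The strong difference `γ₁ ∸ γ₂`: the tangent vector `d ↦ ζ(0, 0, d)`, where
`ζ ∈ X ⊗ W_{D² ⊕ D}` is the element with `ζ(d₁, d₂, 0) = γ₂(d₁, d₂)` and
`ζ(d₁, d₂, d₁ d₂) = γ₁(d₁, d₂)`. For microlinear `X` there is exactly one such `ζ` as soon as `γ₁`
and `γ₂` have the same restriction to `D(2)`. -/
def strongDiff {X : FrolicherSpace.{u}} (γ₁ γ₂ : prolong X (cube 2)) : tangent X :=
  if h : ∃ ζ : prolong X squarePlus,
      (prolongHom X squarePlusPhi).1 ζ = γ₂ ∧ (prolongHom X squarePlusPsi).1 ζ = γ₁ then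
    (prolongHom X squarePlusLast).1 h.choose
  else tzero ((proj X (cube 2)).1 γ₁)

open Classical in
/-- The identification `(X ⊗ W) × (Y ⊗ W) = (X × Y) ⊗ W`. -/
def prolongPair {X Y : FrolicherSpace.{u}} {W : WeilAlgebra} (x : prolong X W) (y : prolong Y W) :
    prolong (prod X Y) W :=
  if h : ∃ z : prolong (prod X Y) W,
      (prolongMap (fst X Y) W).1 z = x ∧ (prolongMap (snd X Y) W).1 z = y then
    h.choose
  else weilConst ((proj X W).1 x, (proj Y W).1 y) W

/-! # Convolution -/

/-- The space `[M ⊗ W_{Dᵖ} → M]`. -/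
abbrev distr (M : FrolicherSpace.{u}) (p : ℕ) : FrolicherSpace.{u} :=
  exp (prolong M (cube p)) M

/-- The Dirac distribution: the canonical projection `M ⊗ W_{Dᵖ} → M`. -/
def dirac (M : FrolicherSpace.{u}) (p : ℕ) : distr M p := proj M (cube p)

variable {M : FrolicherSpace.{u}}

/-- The first convolution `η₁ ∗ η₂`:
`M ⊗ W_{Dᵖ⁺ᑫ} = (M ⊗ W_{Dᑫ}) ⊗ W_{Dᵖ} → M ⊗ W_{Dᵖ} → M`. -/
def conv (hE : M.WeilExponentiable) {p q : ℕ} (η₁ : distr M p) (η₂ : distr M q) :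
    distr M (p + q) :=
  prolongHom M (cubeSplitSwap p q) ≫ hE.assoc (cube q) (cube p) ≫
    prolongMap (show prolong M (cube q) ⟶ M from η₂) (cube p) ≫ η₁

/-- The second convolution `η₁ ∗~ η₂`:
`M ⊗ W_{Dᵖ⁺ᑫ} = (M ⊗ W_{Dᵖ}) ⊗ W_{Dᑫ} → M ⊗ W_{Dᑫ} → M`. -/
def conv' (hE : M.WeilExponentiable) {p q : ℕ} (η₁ : distr M p) (η₂ : distr M q) :
    distr M (p + q) :=
  prolongHom M (cubeSplit p q) ≫ hE.assoc (cube p) (cube q) ≫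
    prolongMap (show prolong M (cube p) ⟶ M from η₁) (cube q) ≫ η₂

open Classical in
/-- The map `f ⊗ id : X ⊗ W → Y ⊗ W` for a map `f : X → Y` which is given without a proof of
smoothness (with an arbitrary value if `f` is not smooth). -/
def prolongFun {X Y : FrolicherSpace.{u}} (f : X → Y) (W : WeilAlgebra) (z : prolong X W) :
    prolong Y W :=
  if h : IsSmooth f then (prolongMap ⟨f, h⟩ W).1 z else weilConst (f ((proj X W).1 z)) W

/-- The operation `⊛` induced by the first convolution. Both convolutions
`[M ⊗ W_{Dᵖ} → M] × [M ⊗ W_{Dᑫ} → M] → [M ⊗ W_{Dᵖ⁺ᑫ} → M]` are smooth, since the category of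
Frölicher spaces is cartesian closed. -/
def circ (hE : M.WeilExponentiable) {p q m n : ℕ} (ξ₁ : prolong (distr M p) (cube m))
    (ξ₂ : prolong (distr M q) (cube n)) : prolong (distr M (p + q)) (cube (m + n)) :=
  prolongFun (X := prod (distr M p) (distr M q)) (fun η => conv hE η.1 η.2) (cube (m + n))
    (prolongPair ((prolongHom _ (cubeLeft m n)).1 ξ₁) ((prolongHom _ (cubeRight m n)).1 ξ₂))

/-- The operation `⊛~` induced by the second convolution. -/
def circ' (hE : M.WeilExponentiable) {p q m n : ℕ} (ξ₁ : prolong (distr M p) (cube m))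
    (ξ₂ : prolong (distr M q) (cube n)) : prolong (distr M (p + q)) (cube (m + n)) :=
  prolongFun (X := prod (distr M p) (distr M q)) (fun η => conv' hE η.1 η.2) (cube (m + n))
    (prolongPair ((prolongHom _ (cubeLeft m n)).1 ξ₁) ((prolongHom _ (cubeRight m n)).1 ξ₂))

/-! # Tangent-vector-valued forms and their brackets -/

/-- `ξ^σ`, for `ξ ∈ [M ⊗ W_{Dᵖ} → M] ⊗ W_D` and a permutation `σ`. -/
def permute {p : ℕ} (σ : Equiv.Perm (Fin p)) (ξ : tangent (distr M p)) : tangent (distr M p) :=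
  (prolongMap (precomp (prolongHom M (cubePerm σ)) M) (cube 1)).1 ξ

/-- The action of `α ∈ ℝ` on the `i`-th variable of `ξ ∈ [M ⊗ W_{Dᵖ} → M] ⊗ W_D`. -/
def scaleArg {p : ℕ} (α : ℝ) (i : Fin p) (ξ : tangent (distr M p)) : tangent (distr M p) :=
  (prolongMap (precomp (prolongHom M (cubeScale α i)) M) (cube 1)).1 ξ

/-- A tangent-vector-valued `p`-form on `M`: an element of `[M ⊗ W_{Dᵖ} → M] ⊗ W_D` over the Dirac
distribution which is homogeneous in each variable and alternating. -/
structure IsTangentForm {p : ℕ} (ξ : tangent (distr M p)) : Prop where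
  foot : (proj (distr M p) (cube 1)).1 ξ = dirac M p
  homogeneous : ∀ (α : ℝ) (i : Fin p), scaleArg α i ξ = tsmul α ξ
  alternating : ∀ σ : Equiv.Perm (Fin p), permute σ ξ = tsmul ((Equiv.Perm.sign σ : ℤ) : ℝ) ξ

/-- The Lie bracket `[ξ₁, ξ₂]_L = ξ₁ ⊛~ ξ₂ ∸ ξ₁ ⊛ ξ₂`. -/
def lieBracket (hE : M.WeilExponentiable) {p q : ℕ} (ξ₁ : tangent (distr M p))
    (ξ₂ : tangent (distr M q)) : tangent (distr M (p + q)) :=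
  strongDiff (circ' hE ξ₁ ξ₂ : prolong _ (cube (1 + 1))) (circ hE ξ₁ ξ₂ : prolong _ (cube (1 + 1)))

/-- The alternation `𝒜 ξ = ∑_σ ε_σ ξ^σ`, a sum of tangent vectors at the Dirac distribution. -/
def alternate {p : ℕ} (ξ : tangent (distr M p)) : tangent (distr M p) :=
  (Finset.univ : Finset (Equiv.Perm (Fin p))).toList.foldr
    (fun σ s => tadd (tsmul ((Equiv.Perm.sign σ : ℤ) : ℝ) (permute σ ξ)) s) (tzero (dirac M p))

/-- The Frölicher–Nijenhuis bracket `[ξ₁, ξ₂]_FN = (1 / (p! q!)) 𝒜 [ξ₁, ξ₂]_L`. -/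
def fnBracket (hE : M.WeilExponentiable) {p q : ℕ} (ξ₁ : tangent (distr M p))
    (ξ₂ : tangent (distr M q)) : tangent (distr M (p + q)) :=
  tsmul (1 / ((p.factorial : ℝ) * (q.factorial : ℝ))) (alternate (lieBracket hE ξ₁ ξ₂))

/-- The identification of the spaces of forms of degrees `p` and `p'` when `p = p'`. -/
def castDegree {p p' : ℕ} (h : p = p') (ξ : tangent (distr M p)) : tangent (distr M p') :=
  h ▸ ξ

end FrolicherSpace

end

/-!
The proof reduces the graded Jacobi identity to an identity between real numbers.

*Coefficients.* A point of `X ⊗ W` is determined by its base point and by the values in `W` of the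
structure functions of `X` (`FrolicherSpace.prolong_ext`). Each structure function gives a family of
functions `X ⊗ W → W`, natural in `W` (`FrolicherSpace.NatFamily`), and a tangent vector is
determined by its base point and by the coefficients of `d` in the values of such families
(`FrolicherSpace.tangent_ext`). Natural families can be pulled back along smooth maps and
differentiated along tangent vectors, so that iterated brackets can be treated with them. Since the
algebras of `D(2)` and of `D² ⊕ D` are pullbacks, sums and strong differences of tangent vectors of
`[Y → M]` exist, and their coefficients are the sums of the coefficients and the differences of the
coefficients of `d₁ d₂` (`FrolicherSpace.coef_tadd`, `FrolicherSpace.coef_strongDiff`). In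
particular, the coefficient of `[ξ₁, ξ₂]_L` is the difference of the coefficients of `d₁ d₂` in the
two convolutions (`FrolicherSpace.coef_lieBracket`).

*The Jacobi identity.* Write `c(η₁, η₂) = η₁ * η₂` and `c'(η₁, η₂) = η₁ *~ η₂` for the two
convolutions, which are compositions in the two possible orders. Hence `c(η₁, c'(η₂, η₃))` and
`c'(η₂, c'(η₃, η₁))` both apply `η₂`, `η₃`, `η₁` in this order and differ by a block rotation of the
coordinates; likewise `c'(η₁, c(η₂, η₃))` and `c(η₂, c(η₃, η₁))` (`FrolicherSpace.conv_conv'`,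
`FrolicherSpace.conv'_conv`). The cyclic sum of the iterated Lie brackets has twelve terms, which
therefore cancel in pairs (`FrolicherSpace.jacobi_lie`). In the Frölicher–Nijenhuis brackets the
inner alternation is absorbed by the outer one (`FrolicherSpace.coef_fnBracket_fnBracket`), and the
sign of the block rotation, `(-1) ^ (p * (q + r))`, turns the identity into the graded one. That the
brackets are homogeneous follows from the naturality of the convolutions in the algebras of the cubes
(`FrolicherSpace.coef_lie_precomp`).

*Weil exponentiability.* The hypothesis, applied to the one-point space, determines the
identification `M ⊗ (W ⊗ V) = (M ⊗ W) ⊗ V` on the classes of smooth maps of two groups of variables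
(`FrolicherSpace.assoc_weilClass`). This gives the identities for the convolutions. For general `Y`
it shows that `[Y → M] ⊗ W` is the set of smooth maps `Y → M ⊗ W`
(`FrolicherSpace.evaluate_injective`, `FrolicherSpace.evaluate_surjective`), and hence that `[Y → M]`
inherits the preservation of pullbacks from the microlinear space `M`
(`FrolicherSpace.exists_of_isPullback`).

*Analysis.* The convolutions have to be smooth maps of two arguments. This rests on the fact that a
curve in `[Y → X]`, which is defined by testing with functionals on `[Y → X]`, is jointly smooth when
it is evaluated along curves of `Y` (`contDiff_uncurry_of_functionals`), and on Boman's theorem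
(`contDiff_of_comp_curve`). Both are derived from one criterion: a function with compact support is
smooth if its `k`-th differences with step `h` along the coordinate axes are `O(|h|ᵏ)`
(`contDiff_of_fwdDiff_le`). Finally, Taylor expansion with values in a Weil algebra is compatible with
polynomial substitution (`WeilAlgebra.taylor_comp`) and can be done in one group of variables after
the other (`WeilAlgebra.taylor_append`). Therefore a point of `(X × Y) ⊗ W` is determined by its two
components (`FrolicherSpace.prolong_prod_ext`), and smooth maps `X × Y → Z` extend to
`(X ⊗ W) × (Y ⊗ W) → Z ⊗ W` (`FrolicherSpace.prolongMap₂`).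
-/

/-! ### Smoothness from bounds on iterated differences along the coordinate axes -/

section Differences

open MeasureTheory FourierTransform

theorem fwdDiff_iter_line {E G : Type*} [AddCommGroup E] [Module ℝ E] [AddCommGroup G] (f : E → G)
    (x v : E) (h : ℝ) (k : ℕ) :
    (fwdDiff (h • v))^[k] f x = (fwdDiff h)^[k] (fun τ : ℝ => f (x + τ • v)) 0 := by
  rw [fwdDiff_iter_eq_sum_shift, fwdDiff_iter_eq_sum_shift]
  refine Finset.sum_congr rfl fun j _ => ?_
  simp [mul_smul, Nat.cast_smul_eq_nsmul]

/-- Lipschitz continuity along the coordinate axes, uniform in the base point, gives continuity. -/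
theorem continuous_of_forall_single_le {n : ℕ} (f : EuclideanSpace ℝ (Fin n) → ℝ) (C : ℝ)
    (hC : ∀ (i : Fin n) (x : EuclideanSpace ℝ (Fin n)) (h : ℝ),
      |f (x + h • EuclideanSpace.single i (1 : ℝ)) - f x| ≤ C * |h|) : Continuous f := by
  have key : ∀ (s : Finset (Fin n)) (x y : EuclideanSpace ℝ (Fin n)),
      |f (x + ∑ i ∈ s, (y i) • EuclideanSpace.single i (1 : ℝ)) - f x| ≤ ∑ i ∈ s, C * |y i| := by
    intro s x y
    induction s using Finset.induction_on with
    | empty => simp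
    | insert i s hi ih =>
      rw [Finset.sum_insert hi, Finset.sum_insert hi]
      have h1 := hC i (x + ∑ i ∈ s, (y i) • EuclideanSpace.single i (1 : ℝ)) (y i)
      rw [show x + (y i • EuclideanSpace.single i (1 : ℝ) +
          ∑ i ∈ s, (y i) • EuclideanSpace.single i (1 : ℝ)) =
          (x + ∑ i ∈ s, (y i) • EuclideanSpace.single i (1 : ℝ)) +
            y i • EuclideanSpace.single i (1 : ℝ) by abel]
      calc _ ≤ _ := abs_sub_le _ (f (x + ∑ i ∈ s, (y i) • EuclideanSpace.single i (1 : ℝ))) _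
        _ ≤ _ := add_le_add h1 ih
  have hbasis : ∀ y : EuclideanSpace ℝ (Fin n),
      ∑ i, (y i) • EuclideanSpace.single i (1 : ℝ) = y := fun y => by
    ext j
    simp [Finset.sum_apply, Pi.single_apply]
  rw [continuous_iff_continuousAt]
  intro x
  rw [ContinuousAt, tendsto_iff_norm_sub_tendsto_zero]
  have hb : ∀ z, ‖f z - f x‖ ≤ ∑ i, C * |(z - x) i| := fun z => by
    have := key Finset.univ x (z - x)
    rwa [hbasis, add_sub_cancel] at this
  refine squeeze_zero (fun _ => norm_nonneg _) hb ?_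
  have hc : Continuous fun z : EuclideanSpace ℝ (Fin n) => ∑ i, C * |(z - x) i| := by fun_prop
  have := hc.tendsto x
  simpa using this

/-- Translation by `v` multiplies the Fourier transform at `w` by `exp (2πi ⟪v, w⟫) = -1`, so taking the
difference multiplies it by `-2`. -/
theorem fourier_fwdDiff {n : ℕ} {g : EuclideanSpace ℝ (Fin n) → ℂ} (hg : Integrable g)
    (v w : EuclideanSpace ℝ (Fin n)) (hvw : inner ℝ v w = 1 / 2) :
    Integrable (fwdDiff v g) ∧ 𝓕 (fwdDiff v g) w = (-2 : ℂ) * 𝓕 g w := by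
  have hs : Integrable (fun x => g (x + v)) := hg.comp_add_right v
  refine ⟨hs.sub hg, ?_⟩
  have h1 : 𝓕 (fun x => g (x + v)) w = - 𝓕 g w := by
    have := congrFun (VectorFourier.fourierIntegral_comp_add_right Real.fourierChar
      (volume : Measure (EuclideanSpace ℝ (Fin n))) (innerₗ _) g v) w
    refine this.trans ?_
    have h2 : (innerₗ (EuclideanSpace ℝ (Fin n))) v w = 1 / 2 := hvw
    rw [h2, Circle.smul_def, Real.fourierChar_apply]
    have h3 : Complex.exp (((2 * Real.pi * (1 / 2 : ℝ) : ℝ) : ℂ) * Complex.I) = -1 := by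
      rw [← Complex.exp_pi_mul_I]; congr 2; push_cast; ring
    rw [h3, neg_one_smul]
    rfl
  have h4 : 𝓕 (fwdDiff v g) w = 𝓕 (fun x => g (x + v)) w - 𝓕 g w := by
    simp only [Real.fourier_eq]
    rw [← integral_sub]
    · simp only [fwdDiff, smul_sub]
    · exact (Real.fourierIntegral_convergent_iff w).2 hs
    · exact (Real.fourierIntegral_convergent_iff w).2 hg
  rw [h4, h1]; ring

theorem fourier_fwdDiff_iter {n : ℕ} {g : EuclideanSpace ℝ (Fin n) → ℂ} (hg : Integrable g)
    (v w : EuclideanSpace ℝ (Fin n)) (hvw : inner ℝ v w = 1 / 2) (k : ℕ) :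
    Integrable ((fwdDiff v)^[k] g) ∧ 𝓕 ((fwdDiff v)^[k] g) w = (-2 : ℂ) ^ k * 𝓕 g w := by
  induction k with
  | zero => simpa using hg
  | succ k ih =>
    rw [Function.iterate_succ_apply']
    have := fourier_fwdDiff ih.1 v w hvw
    refine ⟨this.1, ?_⟩
    rw [this.2, ih.2]; ring

/-- A function with compact support is smooth if its `k`-th differences with step `h` along the
coordinate axes are `O(|h|ᵏ)`: the `k`-th difference with step `h = 1 / (2 wᵢ)` multiplies the Fourier
transform at `w` by `(-2)ᵏ`, so the Fourier transform decays faster than any power of `|wᵢ|`. -/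
theorem contDiff_of_fwdDiff_le {n : ℕ} (f : EuclideanSpace ℝ (Fin n) → ℝ)
    (hf : HasCompactSupport f)
    (hC : ∀ (i : Fin n) (k : ℕ), ∃ C : ℝ, ∀ (x : EuclideanSpace ℝ (Fin n)) (h : ℝ),
      |(fwdDiff (h • EuclideanSpace.single i (1 : ℝ)))^[k] f x| ≤ C * |h| ^ k) :
    ContDiff ℝ ∞ f := by
  choose C hC using hC
  have hcont : Continuous f := by
    refine continuous_of_forall_single_le f (∑ i, |C i 1|) fun i x h => ?_
    have := hC i 1 x h
    simp only [Function.iterate_one, fwdDiff, pow_one] at this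
    refine this.trans (mul_le_mul_of_nonneg_right ?_ (abs_nonneg h))
    exact (le_abs_self _).trans
      (Finset.single_le_sum (f := fun i => |C i 1|) (fun _ _ => abs_nonneg _) (Finset.mem_univ i))
  obtain ⟨R, hR0, hR⟩ : ∃ R : ℝ, 0 < R ∧ ∀ x, R < ‖x‖ → f x = 0 := by
    obtain ⟨R, hR0, hR⟩ := hf.isCompact.isBounded.exists_pos_norm_le
    refine ⟨R, hR0, fun x hx => ?_⟩
    by_contra hne
    exact absurd (hR x (subset_tsupport f hne)) (not_le.2 hx)
  set g : EuclideanSpace ℝ (Fin n) → ℂ := fun x => (f x : ℂ) with hg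
  have hgc : Continuous g := Complex.continuous_ofReal.comp hcont
  have hgs : HasCompactSupport g := hf.comp_left (g := fun r : ℝ => (r : ℂ)) rfl
  have hgi : Integrable g := hgc.integrable_of_hasCompactSupport hgs
  have hdiff : ∀ (v x : EuclideanSpace ℝ (Fin n)) (k : ℕ),
      (fwdDiff v)^[k] g x = (((fwdDiff v)^[k] f x : ℝ) : ℂ) := by
    intro v x k
    rw [fwdDiff_iter_eq_sum_shift, fwdDiff_iter_eq_sum_shift]
    simp [hg]
  -- decay of the Fourier transform in the `i`-th coordinate
  have hdecay : ∀ (i : Fin n) (k : ℕ), ∃ D : ℝ, ∀ w : EuclideanSpace ℝ (Fin n),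
      |w i| ^ k * ‖𝓕 g w‖ ≤ D := by
    intro i k
    set V : ℝ := (volume (Metric.closedBall (0 : EuclideanSpace ℝ (Fin n)) (R + k))).toReal
    refine ⟨max (∫ x, ‖g x‖) (|C i k| * V), fun w => ?_⟩
    have hbd : ‖𝓕 g w‖ ≤ ∫ x, ‖g x‖ := by
      rw [Real.fourier_eq]
      refine (norm_integral_le_integral_norm _).trans (le_of_eq ?_)
      simp
    rcases le_or_gt |w i| (1 / 2) with hw | hw
    · refine le_max_of_le_left ?_
      calc |w i| ^ k * ‖𝓕 g w‖ ≤ 1 * ‖𝓕 g w‖ := by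
            gcongr
            exact pow_le_one₀ (abs_nonneg _) (hw.trans (by norm_num))
        _ ≤ _ := by rw [one_mul]; exact hbd
    · refine le_max_of_le_right ?_
      have hw0 : w i ≠ 0 := fun h0 => by rw [h0, abs_zero] at hw; linarith
      -- with this step, the character takes the value `-1` on the difference vector
      set h : ℝ := 1 / (2 * w i) with hh
      set v : EuclideanSpace ℝ (Fin n) := h • EuclideanSpace.single i (1 : ℝ) with hv
      have hvw : inner ℝ v w = 1 / 2 := by
        rw [hv, real_inner_smul_left, EuclideanSpace.inner_single_left]
        simp only [map_one, one_mul, hh]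
        field_simp
      have habs : |h| = 1 / (2 * |w i|) := by
        rw [hh, abs_div, abs_mul, abs_one, abs_two]
      have hh1 : |h| ≤ 1 := by
        rw [habs, div_le_one (by positivity)]
        linarith
      have hvn : ‖v‖ ≤ 1 := by
        rw [hv, norm_smul, PiLp.norm_single, norm_one, mul_one]
        exact hh1
      obtain ⟨-, h2⟩ := fourier_fwdDiff_iter hgi v w hvw k
      have hsupp : ∀ x, x ∉ Metric.closedBall (0 : EuclideanSpace ℝ (Fin n)) (R + k) →
          (fwdDiff v)^[k] g x = 0 := by
        intro x hx
        rw [fwdDiff_iter_eq_sum_shift]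
        refine Finset.sum_eq_zero fun j hj => ?_
        have hj' : (j : ℝ) ≤ k := by
          exact_mod_cast Nat.lt_succ_iff.1 (Finset.mem_range.1 hj)
        have h5 : R + k < ‖x‖ := by simpa using hx
        have h6 : ‖(j : ℕ) • v‖ ≤ k := by
          refine (norm_nsmul_le).trans ?_
          calc (j : ℝ) * ‖v‖ ≤ k * 1 := by gcongr
            _ = k := mul_one _
        have h7 : ‖x‖ ≤ ‖x + j • v‖ + ‖j • v‖ := by
          simpa using norm_sub_le (x + j • v) (j • v)
        have : g (x + j • v) = 0 := by
          simp only [hg, hR (x + j • v) (by linarith), Complex.ofReal_zero]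
        rw [this, smul_zero]
      have h3 : ‖𝓕 ((fwdDiff v)^[k] g) w‖ ≤ |C i k| * |h| ^ k * V := by
        rw [Real.fourier_eq]
        rw [← setIntegral_eq_integral_of_forall_compl_eq_zero
          (s := Metric.closedBall (0 : EuclideanSpace ℝ (Fin n)) (R + k))
          (fun x hx => by rw [hsupp x hx, smul_zero])]
        refine norm_setIntegral_le_of_norm_le_const measure_closedBall_lt_top fun x _ => ?_
        rw [Circle.norm_smul, hdiff, Complex.norm_real, Real.norm_eq_abs]
        refine (hC i k x h).trans ?_
        gcongr
        exact le_abs_self _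
      rw [h2, norm_mul, norm_pow, norm_neg] at h3
      have h8 : |h| ^ k * (2 * |w i|) ^ k = 1 := by
        rw [← mul_pow, habs, one_div, inv_mul_cancel₀ (by positivity), one_pow]
      have h2' : ‖(2 : ℂ)‖ = 2 := by simp
      rw [h2'] at h3
      have h9 : (2 : ℝ) ^ k * ‖𝓕 g w‖ * |w i| ^ k * 2 ^ k ≤ |C i k| * V := by
        calc (2 : ℝ) ^ k * ‖𝓕 g w‖ * |w i| ^ k * 2 ^ k
            = (2 : ℝ) ^ k * ‖𝓕 g w‖ * (2 * |w i|) ^ k := by rw [mul_pow]; ring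
          _ ≤ |C i k| * |h| ^ k * V * (2 * |w i|) ^ k := by gcongr
          _ = |C i k| * V * (|h| ^ k * (2 * |w i|) ^ k) := by ring
          _ = _ := by rw [h8, mul_one]
      have h10 : (1 : ℝ) ≤ 2 ^ k * 2 ^ k := by
        rw [← mul_pow]; exact one_le_pow₀ (by norm_num)
      calc |w i| ^ k * ‖𝓕 g w‖ = 1 * (|w i| ^ k * ‖𝓕 g w‖) := (one_mul _).symm
        _ ≤ 2 ^ k * 2 ^ k * (|w i| ^ k * ‖𝓕 g w‖) := by gcongr
        _ = (2 : ℝ) ^ k * ‖𝓕 g w‖ * |w i| ^ k * 2 ^ k := by ring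
        _ ≤ _ := h9
  have hFc : Continuous (𝓕 g) :=
    VectorFourier.fourierIntegral_continuous Real.continuous_fourierChar continuous_inner hgi
  choose D hD using hdecay
  have hFint : ∀ m : ℕ, Integrable (fun w => ‖w‖ ^ m * ‖𝓕 g w‖) := by
    intro m
    have hpow : ∀ k : ℕ, ∀ w : EuclideanSpace ℝ (Fin n), ‖w‖ ^ k * ‖𝓕 g w‖ ≤
        (∫ x, ‖g x‖) + ∑ i, (n : ℝ) ^ k * |D i k| := by
      intro k w
      have hint0 : 0 ≤ ∫ x, ‖g x‖ := integral_nonneg fun _ => norm_nonneg _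
      have hsum0 : 0 ≤ ∑ i : Fin n, (n : ℝ) ^ k * |D i k| :=
        Finset.sum_nonneg fun _ _ => by positivity
      rcases isEmpty_or_nonempty (Fin n) with hn | hn
      · have hw : w = 0 := by ext i; exact hn.elim i
        have hbd : ‖𝓕 g w‖ ≤ ∫ x, ‖g x‖ := by
          rw [Real.fourier_eq]
          refine (norm_integral_le_integral_norm _).trans (le_of_eq ?_)
          simp
        have h1 : ‖w‖ ^ k ≤ 1 := pow_le_one₀ (norm_nonneg _) (by rw [hw, norm_zero]; exact zero_le_one)
        calc ‖w‖ ^ k * ‖𝓕 g w‖ ≤ 1 * ‖𝓕 g w‖ := by gcongr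
          _ ≤ _ := by linarith
      · obtain ⟨i, -, hi⟩ := Finset.exists_max_image (Finset.univ : Finset (Fin n))
          (fun i => |w i|) Finset.univ_nonempty
        have hnorm : ‖w‖ ≤ n * |w i| := by
          have hbasis : ∑ j, (w j) • EuclideanSpace.single j (1 : ℝ) = w := by
            ext j
            simp [Finset.sum_apply, Pi.single_apply]
          calc ‖w‖ = ‖∑ j, (w j) • EuclideanSpace.single j (1 : ℝ)‖ := by rw [hbasis]
            _ ≤ ∑ j, ‖(w j) • EuclideanSpace.single j (1 : ℝ)‖ := norm_sum_le _ _
            _ ≤ ∑ _j : Fin n, |w i| := Finset.sum_le_sum fun j _ => by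
                rw [norm_smul, PiLp.norm_single, norm_one, mul_one]
                exact hi j (Finset.mem_univ j)
            _ = n * |w i| := by simp
        calc ‖w‖ ^ k * ‖𝓕 g w‖ ≤ (n * |w i|) ^ k * ‖𝓕 g w‖ := by gcongr
          _ = (n : ℝ) ^ k * (|w i| ^ k * ‖𝓕 g w‖) := by rw [mul_pow]; ring
          _ ≤ (n : ℝ) ^ k * |D i k| := by
              gcongr
              exact (hD i k w).trans (le_abs_self _)
          _ ≤ ∑ i, (n : ℝ) ^ k * |D i k| :=
              Finset.single_le_sum (f := fun i => (n : ℝ) ^ k * |D i k|)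
                (fun _ _ => by positivity) (Finset.mem_univ i)
          _ ≤ _ := by linarith
    exact integrable_of_le_of_pow_mul_le (fun w => by simpa only [pow_zero, one_mul] using hpow 0 w)
      (fun w => hpow _ w) hFc.aestronglyMeasurable
  have hFi : Integrable (𝓕 g) := by
    have := hFint 0
    simp only [pow_zero, one_mul] at this
    exact (integrable_norm_iff hFc.aestronglyMeasurable).1 this
  have hinv := hgc.fourierInv_fourier_eq hgi hFi
  have hsm : ContDiff ℝ ∞ (𝓕 (𝓕 g)) := Real.contDiff_fourier fun m _ => hFint m
  have hfe : f = fun x => Complex.reCLM (𝓕 (𝓕 g) (-x)) := by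
    funext x
    rw [← Real.fourierInv_eq_fourier_neg, hinv]
    simp [hg]
  rw [hfe]
  exact Complex.reCLM.contDiff.comp (hsm.comp contDiff_neg)

end Differences

/-! ### Functions that are smooth along smooth curves -/

section Boman

open Filter Topology

theorem exists_bound_iteratedFDeriv {u : ℝ → ℝ} (hu : ContDiff ℝ ∞ u) (hs : HasCompactSupport u)
    (N : ℕ) : ∃ B : ℝ, 0 ≤ B ∧ ∀ k ≤ N, ∀ s, ‖iteratedFDeriv ℝ k u s‖ ≤ B := by
  have h : ∀ k, ∃ B : ℝ, ∀ s, ‖iteratedFDeriv ℝ k u s‖ ≤ B := fun k =>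
    (hs.iteratedFDeriv k).exists_bound_of_continuous
      (hu.continuous_iteratedFDeriv (by exact_mod_cast le_top))
  choose B hB using h
  refine ⟨∑ k ∈ Finset.range (N + 1), |B k|, Finset.sum_nonneg fun _ _ => abs_nonneg _,
    fun k hk s => ((hB k s).trans (le_abs_self _)).trans ?_⟩
  exact Finset.single_le_sum (f := fun k => |B k|) (fun _ _ => abs_nonneg _)
    (Finset.mem_range.2 (Nat.lt_succ_of_le hk))

/-- The special curve lemma: points which converge to zero fast enough lie on a single smooth curve,
which near the `j`-th point is a straight line in a prescribed direction. -/
theorem exists_contDiff_curve {E : Type*} [NormedAddCommGroup E] [NormedSpace ℝ E]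
    [CompleteSpace E] (v : E) :
    ∃ t ε δ : ℕ → ℝ, Tendsto t atTop (𝓝 0) ∧ (∀ j, 0 < ε j) ∧ (∀ j, 0 < δ j) ∧
      ∀ x : ℕ → E, (∀ j, ‖x j‖ ≤ δ j) → ∃ c : ℝ → E, ContDiff ℝ ∞ c ∧
        ∀ j, ∀ᶠ s in 𝓝 (t j), c s = x j + (ε j * (s - t j)) • v := by
  set t : ℕ → ℝ := fun j => (1 / 2 : ℝ) ^ j with ht
  have ht0 : ∀ j, 0 < t j := fun j => by positivity
  let φ : ∀ j, ContDiffBump (t j) := fun j =>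
    { rIn := t j / 8, rOut := t j / 4, rIn_pos := by have := ht0 j; positivity,
      rIn_lt_rOut := by have := ht0 j; linarith }
  have hu : ∀ j, ContDiff ℝ ∞ (φ j) := fun j => (φ j).contDiff
  have hw : ∀ j, ContDiff ℝ ∞ fun s => φ j s * (s - t j) := fun j =>
    (hu j).mul (contDiff_id.sub contDiff_const)
  have hus : ∀ j, HasCompactSupport (φ j) := fun j => (φ j).hasCompactSupport
  have hws : ∀ j, HasCompactSupport fun s => φ j s * (s - t j) := fun j => (hus j).mul_right
  -- The bumps `φ j` have disjoint supports. Dividing by bounds for the derivatives of order `≤ j` of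
  -- the `j`-th bump makes the series below converge together with all its derivatives.
  choose B hB0 hB using fun j => exists_bound_iteratedFDeriv (hu j) (hus j) j
  choose B' hB0' hB' using fun j => exists_bound_iteratedFDeriv (hw j) (hws j) j
  refine ⟨t, fun j => (1 / 2 : ℝ) ^ j / ((B' j + 1) * (‖v‖ + 1)),
    fun j => (1 / 2 : ℝ) ^ j / (B j + 1),
    tendsto_pow_atTop_nhds_zero_of_lt_one (by norm_num) (by norm_num),
    fun j => by have := hB0' j; positivity, fun j => by have := hB0 j; positivity, ?_⟩
  intro x hx
  set ε : ℕ → ℝ := fun j => (1 / 2 : ℝ) ^ j / ((B' j + 1) * (‖v‖ + 1)) with hε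
  have hε0 : ∀ j, 0 ≤ ε j := fun j => by have := hB0' j; positivity
  set f : ℕ → ℝ → E := fun j s => φ j s • x j + (φ j s * (s - t j)) • (ε j • v) with hf
  have hfs : ∀ j, ContDiff ℝ ∞ (f j) := fun j =>
    ((hu j).smul contDiff_const).add ((hw j).smul contDiff_const)
  have hconst : ∀ (u : ℝ → ℝ) (_ : ContDiff ℝ ∞ u) (y : E) (k : ℕ) (s : ℝ),
      ‖iteratedFDeriv ℝ k (fun s => u s • y) s‖ ≤ ‖iteratedFDeriv ℝ k u s‖ * ‖y‖ := by
    intro u hu y k s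
    have := (ContinuousLinearMap.toSpanSingleton ℝ y).norm_iteratedFDeriv_comp_left
      (hu.contDiffAt (x := s)) (n := k) (by exact_mod_cast le_top)
    rw [ContinuousLinearMap.norm_toSpanSingleton, mul_comm] at this
    exact this
  refine ⟨fun s => ∑' j, f j s, ?_, fun j => ?_⟩
  · refine contDiff_tsum_of_eventually (v := fun _ j => 2 * (1 / 2 : ℝ) ^ j) hfs
      (fun k _ => (summable_geometric_of_lt_one (by norm_num) (by norm_num)).mul_left 2) ?_
    intro k _
    rw [Nat.cofinite_eq_atTop]
    filter_upwards [eventually_ge_atTop k] with j hj s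
    have e1 : iteratedFDeriv ℝ k (f j) s = iteratedFDeriv ℝ k (fun s => φ j s • x j) s +
        iteratedFDeriv ℝ k (fun s => (φ j s * (s - t j)) • (ε j • v)) s :=
      iteratedFDeriv_add_apply
        (((hu j).smul contDiff_const).of_le (by exact_mod_cast le_top)).contDiffAt
        (((hw j).smul contDiff_const).of_le (by exact_mod_cast le_top)).contDiffAt
    rw [e1]
    have hb0 := hB0 j
    have hb0' := hB0' j
    have b1 : ‖iteratedFDeriv ℝ k (fun s => φ j s • x j) s‖ ≤ (1 / 2 : ℝ) ^ j := by
      refine (hconst _ (hu j) _ _ _).trans ?_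
      calc ‖iteratedFDeriv ℝ k (φ j) s‖ * ‖x j‖
          ≤ (B j + 1) * ((1 / 2 : ℝ) ^ j / (B j + 1)) := by
            gcongr
            · exact (hB j k hj s).trans (by linarith)
            · exact hx j
        _ = (1 / 2 : ℝ) ^ j := by field_simp
    have b2 : ‖iteratedFDeriv ℝ k (fun s => (φ j s * (s - t j)) • (ε j • v)) s‖ ≤
        (1 / 2 : ℝ) ^ j := by
      refine (hconst _ (hw j) _ _ _).trans ?_
      rw [norm_smul, Real.norm_of_nonneg (hε0 j)]
      calc ‖iteratedFDeriv ℝ k (fun s => φ j s * (s - t j)) s‖ * (ε j * ‖v‖)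
          ≤ (B' j + 1) * (ε j * (‖v‖ + 1)) := by
            have := hε0 j
            gcongr
            · exact (hB' j k hj s).trans (by linarith)
            · linarith
        _ = (1 / 2 : ℝ) ^ j := by simp only [hε]; field_simp
    calc _ ≤ _ := norm_add_le _ _
      _ ≤ 2 * (1 / 2 : ℝ) ^ j := by linarith
  · filter_upwards [Metric.ball_mem_nhds (t j) (show 0 < t j / 8 by have := ht0 j; positivity)]
      with s hs
    rw [Metric.mem_ball, Real.dist_eq, abs_lt] at hs
    have hone : φ j s = 1 := (φ j).one_of_mem_closedBall (by
      rw [Metric.mem_closedBall, Real.dist_eq, abs_le]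
      exact ⟨hs.1.le, hs.2.le⟩)
    rw [tsum_eq_single j]
    · simp only [hf, hone, one_smul, one_mul, smul_smul, mul_comm (ε j)]
    · intro i hij
      have h2 : 2 * t i ≤ t j ∨ 2 * t j ≤ t i := by
        rcases lt_or_gt_of_ne hij with h | h
        · right
          have : t j ≤ t (i + 1) := pow_le_pow_of_le_one (by norm_num) (by norm_num) h
          simp only [ht, pow_succ] at this ⊢
          linarith
        · left
          have : t i ≤ t (j + 1) := pow_le_pow_of_le_one (by norm_num) (by norm_num) h
          simp only [ht, pow_succ] at this ⊢
          linarith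
      have hz : φ i s = 0 := (φ i).zero_of_le_dist (by
        change t i / 4 ≤ dist s (t i)
        rw [Real.dist_eq]
        have := ht0 i
        have := ht0 j
        rcases h2 with h | h
        · exact (by linarith [hs.1] : t i / 4 ≤ s - t i).trans (le_abs_self _)
        · exact (by linarith [hs.2] : t i / 4 ≤ -(s - t i)).trans (neg_le_abs _))
      simp [hf, hz]

/-- If `f` is smooth along smooth curves, its directional derivatives are locally bounded: otherwise a
smooth curve which passes through points with huge derivatives in the direction `v` would have an
unbounded derivative of `f` along it. -/
theorem exists_bound_iteratedDeriv_line {E : Type*} [NormedAddCommGroup E] [NormedSpace ℝ E]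
    [CompleteSpace E] {f : E → ℝ}
    (hf : ∀ c : ℝ → E, ContDiff ℝ ∞ c → ContDiff ℝ ∞ (f ∘ c)) (v x₀ : E) (k : ℕ) :
    ∃ r > 0, ∃ C : ℝ, ∀ x, ‖x - x₀‖ ≤ r → |iteratedDeriv k (fun τ : ℝ => f (x + τ • v)) 0| ≤ C := by
  obtain ⟨t, ε, δ, ht, hε, hδ, H⟩ := exists_contDiff_curve v
  by_contra! hcon
  -- along the curve, the `k`-th derivative at `y j` is multiplied by `ε j ^ k`
  choose y hy1 hy2 using fun j => hcon (δ j) (hδ j) (j / ε j ^ k)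
  obtain ⟨c, hc, hcj⟩ := H (fun j => y j - x₀) hy1
  have hline : ∀ x, ContDiff ℝ ∞ fun τ : ℝ => f (x + τ • v) := fun x =>
    hf (fun τ => x + τ • v) (contDiff_const.add (contDiff_id.smul contDiff_const))
  have hg : ContDiff ℝ ∞ fun s => f (x₀ + c s) := hf (fun s => x₀ + c s) (contDiff_const.add hc)
  have hval : ∀ j, iteratedDeriv k (fun s => f (x₀ + c s)) (t j) =
      ε j ^ k * iteratedDeriv k (fun τ : ℝ => f (y j + τ • v)) 0 := by
    intro j
    have e1 : (fun s => f (x₀ + c s)) =ᶠ[𝓝 (t j)]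
        fun s => (fun r => f (y j + (ε j * r) • v)) (s + -t j) := by
      filter_upwards [hcj j] with s hs
      rw [hs]
      congr 1
      rw [← sub_eq_add_neg]
      abel
    rw [e1.iteratedDeriv_eq,
      iteratedDeriv_comp_add_const k (fun r => f (y j + (ε j * r) • v)) (-t j)]
    beta_reduce
    have := congrFun (iteratedDeriv_comp_const_mul (n := k)
      ((hline (y j)).of_le (by exact_mod_cast le_top)) (ε j)) (t j + -t j)
    rw [this]
    simp
  have hcont : Continuous (iteratedDeriv k fun s => f (x₀ + c s)) :=
    hg.continuous_iteratedDeriv k (by exact_mod_cast le_top)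
  have hlim := ((hcont.tendsto 0).comp ht).abs
  obtain ⟨C, hC⟩ := hlim.bddAbove_range
  obtain ⟨j, hj⟩ := exists_nat_gt C
  have h1 := hC ⟨j, rfl⟩
  simp only [Function.comp_apply] at h1
  rw [hval, abs_mul, abs_of_pos (pow_pos (hε j) k)] at h1
  have h2 := hy2 j
  rw [div_lt_iff₀ (pow_pos (hε j) k)] at h2
  linarith

theorem abs_fwdDiff_iter_le {C : ℝ} (k : ℕ) (h : ℝ) :
    ∀ {g : ℝ → ℝ}, ContDiff ℝ ∞ g → (∀ τ, |iteratedDeriv k g τ| ≤ C) →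
      ∀ τ, |(fwdDiff h)^[k] g τ| ≤ C * |h| ^ k := by
  induction k generalizing C with
  | zero => intro g _ hC τ; simpa using hC τ
  | succ k ih =>
    intro g hg hC τ
    rw [Function.iterate_succ_apply]
    have hsh : ContDiff ℝ ∞ fun x => g (x + h) := hg.comp (contDiff_id.add contDiff_const)
    have h1 : ContDiff ℝ ∞ (fwdDiff h g) := hsh.sub hg
    have h2 : ∀ τ, |iteratedDeriv k (fwdDiff h g) τ| ≤ C * |h| := by
      intro τ
      have e1 : iteratedDeriv k (fwdDiff h g) τ =
          iteratedDeriv k g (τ + h) - iteratedDeriv k g τ := by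
        have : fwdDiff h g = (fun x => g (x + h)) - g := rfl
        rw [this, iteratedDeriv_sub (hsh.of_le (by exact_mod_cast le_top)).contDiffAt
          (hg.of_le (by exact_mod_cast le_top)).contDiffAt, iteratedDeriv_comp_add_const]
      rw [e1]
      have hd : Differentiable ℝ (iteratedDeriv k g) :=
        hg.differentiable_iteratedDeriv k (by exact_mod_cast WithTop.coe_lt_top k)
      have := Convex.norm_image_sub_le_of_norm_deriv_le (f := iteratedDeriv k g) (C := C)
        (s := Set.univ) (x := τ) (y := τ + h) (fun x _ => hd x)
        (fun x _ => by rw [← iteratedDeriv_succ]; exact hC x) convex_univ trivial trivial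
      simpa using this
    have := ih h1 h2 τ
    rwa [mul_assoc, ← pow_succ'] at this

theorem contDiff_of_comp_curve_of_hasCompactSupport {n : ℕ} {f : EuclideanSpace ℝ (Fin n) → ℝ}
    (hs : HasCompactSupport f)
    (hf : ∀ c : ℝ → EuclideanSpace ℝ (Fin n), ContDiff ℝ ∞ c → ContDiff ℝ ∞ (f ∘ c)) :
    ContDiff ℝ ∞ f := by
  refine contDiff_of_fwdDiff_le f hs fun i k => ?_
  set v : EuclideanSpace ℝ (Fin n) := EuclideanSpace.single i (1 : ℝ)
  have hcomp : ∃ C, ∀ x ∈ tsupport f, |iteratedDeriv k (fun τ : ℝ => f (x + τ • v)) 0| ≤ C := by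
    refine hs.isCompact.induction_on (p := fun s => ∃ C, ∀ x ∈ s,
      |iteratedDeriv k (fun τ : ℝ => f (x + τ • v)) 0| ≤ C) ⟨0, by simp⟩ ?_ ?_ ?_
    · rintro s t hst ⟨C, hC⟩
      exact ⟨C, fun x hx => hC x (hst hx)⟩
    · rintro s t ⟨C, hC⟩ ⟨D, hD⟩
      refine ⟨max C D, fun x hx => ?_⟩
      rcases hx with hx | hx
      · exact (hC x hx).trans (le_max_left _ _)
      · exact (hD x hx).trans (le_max_right _ _)
    · intro x _
      obtain ⟨r, hr, C, hC⟩ := exists_bound_iteratedDeriv_line hf v x k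
      refine ⟨Metric.closedBall x r, mem_nhdsWithin_of_mem_nhds (Metric.closedBall_mem_nhds x hr),
        C, fun y hy => hC y ?_⟩
      rwa [Metric.mem_closedBall, dist_eq_norm] at hy
  obtain ⟨C, hC⟩ := hcomp
  have hall : ∀ x, |iteratedDeriv k (fun τ : ℝ => f (x + τ • v)) 0| ≤ max C 0 := by
    intro x
    by_cases hx : x ∈ tsupport f
    · exact (hC x hx).trans (le_max_left _ _)
    · have hev : (fun τ : ℝ => f (x + τ • v)) =ᶠ[𝓝 0] fun _ => 0 := by
        have h1 : f =ᶠ[𝓝 (x + (0 : ℝ) • v)] 0 := by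
          rw [zero_smul, add_zero]
          exact notMem_tsupport_iff_eventuallyEq.1 hx
        have hc : Continuous fun τ : ℝ => x + τ • v := by fun_prop
        exact (hc.tendsto 0).eventually h1
      rw [hev.iteratedDeriv_eq]
      simp
  refine ⟨max C 0, fun x h => ?_⟩
  rw [fwdDiff_iter_line]
  refine abs_fwdDiff_iter_le k h
    (hf (fun τ => x + τ • v) (contDiff_const.add (contDiff_id.smul contDiff_const))) ?_ 0
  intro τ
  have := congrFun (iteratedDeriv_comp_const_add k (fun τ : ℝ => f (x + τ • v)) τ) 0
  simp only [add_zero] at this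
  rw [Function.comp_def, ← this]
  have h2 := hall (x + τ • v)
  simpa only [add_assoc, ← add_smul] using h2

/-- Boman's theorem: a function on a finite dimensional space is smooth as soon as it is smooth along
all smooth curves. -/
theorem contDiff_of_comp_curve {E : Type*} [NormedAddCommGroup E] [NormedSpace ℝ E]
    [FiniteDimensional ℝ E] {f : E → ℝ}
    (hf : ∀ c : ℝ → E, ContDiff ℝ ∞ c → ContDiff ℝ ∞ (f ∘ c)) : ContDiff ℝ ∞ f := by
  let L : E ≃L[ℝ] EuclideanSpace ℝ (Fin (Module.finrank ℝ E)) := toEuclidean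
  rw [contDiff_iff_contDiffAt]
  intro x₀
  let χ : ContDiffBump (L x₀) := ⟨1, 2, zero_lt_one, one_lt_two⟩
  have hχ : ContDiff ℝ ∞ χ := χ.contDiff
  have hF : ContDiff ℝ ∞ fun y => χ y * f (L.symm y) := by
    refine contDiff_of_comp_curve_of_hasCompactSupport χ.hasCompactSupport.mul_right fun c hc => ?_
    exact (hχ.comp hc).mul (hf (fun s => L.symm (c s)) (L.symm.contDiff.comp hc))
  have h1 : ContDiff ℝ ∞ fun x => χ (L x) * f x := by
    have := hF.comp L.contDiff
    simpa [Function.comp_def] using this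
  refine h1.contDiffAt.congr_of_eventuallyEq ?_
  have : ∀ᶠ x in 𝓝 x₀, χ (L x) = 1 :=
    (L.continuous.tendsto x₀).eventually χ.eventuallyEq_one
  filter_upwards [this] with x hx
  rw [hx, one_mul]

end Boman

/-! ### Curves of smooth functions -/

section FunctionCurves

open Filter Topology

theorem contDiff_iteratedDeriv_snd {g : ℝ → ℝ → ℝ} (hg : ContDiff ℝ ∞ (Function.uncurry g)) (k : ℕ) :
    ContDiff ℝ ∞ (Function.uncurry fun s t => iteratedDeriv k (g s) t) := by
  induction k with
  | zero => simpa using hg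
  | succ k ih =>
    have h1 : ContDiff ℝ ∞ fun z : ℝ × ℝ =>
        fderiv ℝ (Function.uncurry fun s t => iteratedDeriv k (g s) t) z ((0 : ℝ), (1 : ℝ)) :=
      (ih.fderiv_right (m := ∞) (by simp)).clm_apply contDiff_const
    convert h1 using 1
    funext ⟨s, t⟩
    simp only [Function.uncurry, iteratedDeriv_succ]
    have h2 : HasDerivAt (fun t : ℝ => (s, t)) ((0 : ℝ), (1 : ℝ)) t :=
      (hasDerivAt_const t s).prodMk (hasDerivAt_id t)
    have h3 := ((ih.differentiable (by simp)) (s, t)).hasFDerivAt.comp_hasDerivAt t h2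
    exact h3.deriv

theorem summable_lp_one_mul (l : lp (fun _ : ℝ => ℝ) 1) {b : ℝ → ℝ} {C : ℝ} (hb : ∀ t, |b t| ≤ C) :
    Summable fun t => l t * b t := by
  have h1 : Summable fun t => ‖l t‖ := by
    have := (lp.memℓp l).summable (by simp)
    simpa using this
  refine Summable.of_norm_bounded (h1.mul_right C) fun t => ?_
  rw [norm_mul]
  exact mul_le_mul_of_nonneg_left (hb t) (norm_nonneg _)

/-- The pairing of summable families with a bounded function. -/
theorem exists_clm_tsum_mul {b : ℝ → ℝ} {C : ℝ} (hb : ∀ t, |b t| ≤ C) :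
    ∃ T : lp (fun _ : ℝ => ℝ) 1 →L[ℝ] ℝ, ∀ l, T l = ∑' t, l t * b t := by
  have hs := fun l => summable_lp_one_mul l hb
  refine ⟨LinearMap.mkContinuous
    { toFun := fun l => ∑' t, l t * b t
      map_add' := fun l m => by
        rw [← (hs l).tsum_add (hs m)]
        simp [add_mul]
      map_smul' := fun a l => by
        rw [RingHom.id_apply, smul_eq_mul, ← tsum_mul_left]
        simp [mul_assoc] } C fun l => ?_, fun l => rfl⟩
  have h1 : Summable fun t => ‖l t‖ := by
    have := (lp.memℓp l).summable (by simp)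
    simpa using this
  have h2 : ‖l‖ = ∑' t, ‖l t‖ := by
    have := lp.norm_eq_tsum_rpow (p := 1) (by simp) l
    simpa using this
  change ‖∑' t, l t * b t‖ ≤ C * ‖l‖
  rw [h2, ← tsum_mul_left]
  refine tsum_of_norm_bounded (h1.mul_left C).hasSum fun t => ?_
  rw [norm_mul, mul_comm]
  exact mul_le_mul_of_nonneg_right (hb t) (norm_nonneg _)

/-- Superpositions of point evaluations of derivatives depend smoothly on a function that varies
smoothly. -/
theorem contDiff_tsum_iteratedDeriv (l : lp (fun _ : ℝ => ℝ) 1) {χ : ℝ → ℝ} (hχ : ContDiff ℝ ∞ χ)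
    (hχs : HasCompactSupport χ) (k : ℕ) {g : ℝ → ℝ → ℝ} (hg : ContDiff ℝ ∞ (Function.uncurry g)) :
    ContDiff ℝ ∞ fun s => ∑' t, l t * iteratedDeriv k (fun x => χ x * g s x) t := by
  rw [contDiff_iff_contDiffAt]
  intro s₀
  let φ : ContDiffBump s₀ := ⟨1, 2, zero_lt_one, one_lt_two⟩
  have hφ : ContDiff ℝ ∞ φ := φ.contDiff
  set G : ℝ → ℝ → ℝ := fun s x => φ s * (χ x * g s x) with hG
  have hGs : ContDiff ℝ ∞ (Function.uncurry G) :=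
    (hφ.comp contDiff_fst).mul ((hχ.comp contDiff_snd).mul hg)
  set H : ℝ × ℝ → ℝ := Function.uncurry fun s t => iteratedDeriv k (G s) t with hH
  have hHs : ContDiff ℝ ∞ H := contDiff_iteratedDeriv_snd hGs k
  have hHc : HasCompactSupport H := by
    refine HasCompactSupport.intro (φ.hasCompactSupport.isCompact.prod hχs.isCompact) ?_
    rintro ⟨s, t⟩ hst
    rw [Set.mem_prod, not_and_or] at hst
    change iteratedDeriv k (G s) t = 0
    rcases hst with h | h
    · have : G s = fun _ => 0 := by
        funext x
        simp only [hG, image_eq_zero_of_notMem_tsupport h, zero_mul]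
      rw [this]; simp
    · have : G s =ᶠ[𝓝 t] fun _ => 0 := by
        filter_upwards [notMem_tsupport_iff_eventuallyEq.1 h] with x hx
        have hx' : χ x = 0 := hx
        simp only [hG, hx', zero_mul, mul_zero]
      rw [this.iteratedDeriv_eq]; simp
  have hbd : ∀ m : ℕ, ∃ B, ∀ z, ‖iteratedFDeriv ℝ m H z‖ ≤ B := fun m =>
    (hHc.iteratedFDeriv m).exists_bound_of_continuous
      (hHs.continuous_iteratedFDeriv (by exact_mod_cast le_top))
  choose B hB using hbd
  have hsl : ∀ t, ContDiff ℝ ∞ fun s => H (s, t) := fun t =>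
    hHs.comp (contDiff_id.prodMk contDiff_const)
  have hslb : ∀ (m : ℕ) (t s : ℝ), ‖iteratedFDeriv ℝ m (fun s => H (s, t)) s‖ ≤ B m := by
    intro m t s
    have h1 : (fun s => H (s, t)) =
        (fun z => H (z + ((0 : ℝ), t))) ∘ (ContinuousLinearMap.inl ℝ ℝ ℝ) := by
      funext s; simp
    have h2 : ContDiff ℝ ∞ fun z => H (z + ((0 : ℝ), t)) :=
      hHs.comp (contDiff_id.add contDiff_const)
    rw [h1, (ContinuousLinearMap.inl ℝ ℝ ℝ).iteratedFDeriv_comp_right h2 s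
      (by exact_mod_cast le_top : (m : WithTop ℕ∞) ≤ ∞)]
    refine (ContinuousMultilinearMap.norm_compContinuousLinearMap_le _ _).trans ?_
    rw [iteratedFDeriv_comp_add_right]
    calc _ ≤ B m * ∏ _i : Fin m, (1 : ℝ) := by
          have hB0 : 0 ≤ B m := (norm_nonneg _).trans (hB m 0)
          refine mul_le_mul (hB m _) ?_ (Finset.prod_nonneg fun _ _ => norm_nonneg _) hB0
          exact Finset.prod_le_prod (fun _ _ => norm_nonneg _) fun _ _ =>
            ContinuousLinearMap.norm_inl_le_one ℝ ℝ ℝ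
      _ = B m := by simp
  have hl : Summable fun t => ‖l t‖ := by
    have := (lp.memℓp l).summable (by simp)
    simpa using this
  have hmain : ContDiff ℝ ∞ fun s => ∑' t, l t * H (s, t) := by
    refine contDiff_tsum (v := fun m t => ‖l t‖ * B m) (fun t => contDiff_const.mul (hsl t))
      (fun m _ => hl.mul_right _) fun m t s _ => ?_
    have h3 : iteratedFDeriv ℝ m (fun s => l t * H (s, t)) s =
        l t • iteratedFDeriv ℝ m (fun s => H (s, t)) s :=
      iteratedFDeriv_const_smul_apply (a := l t)
        ((hsl t).of_le (by exact_mod_cast le_top)).contDiffAt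
    rw [h3, norm_smul]
    exact mul_le_mul_of_nonneg_left (hslb m t s) (norm_nonneg _)
  refine hmain.contDiffAt.congr_of_eventuallyEq ?_
  filter_upwards [φ.eventuallyEq_one] with s hs
  have hs' : φ s = 1 := hs
  refine tsum_congr fun t => ?_
  simp only [hH, hG, hs', one_mul, Function.uncurry]

/-- A curve of smooth functions is jointly smooth if it is smooth when tested with all functionals
that are smooth along jointly smooth curves. The bounds on its partial derivatives come from the
uniform boundedness principle. -/
theorem contDiff_uncurry_of_functionals {c : ℝ → ℝ → ℝ} (hc : ∀ s, ContDiff ℝ ∞ (c s))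
    (h : ∀ Ψ : (ℝ → ℝ) → ℝ, (∀ g : ℝ → ℝ → ℝ, ContDiff ℝ ∞ (Function.uncurry g) →
      ContDiff ℝ ∞ fun s => Ψ (g s)) → ContDiff ℝ ∞ fun s => Ψ (c s)) :
    ContDiff ℝ ∞ (Function.uncurry c) := by
  rw [contDiff_iff_contDiffAt]
  rintro ⟨s₀, t₀⟩
  let χ : ContDiffBump s₀ := ⟨1, 2, zero_lt_one, one_lt_two⟩
  let φ : ContDiffBump t₀ := ⟨1, 2, zero_lt_one, one_lt_two⟩
  have hχ : ContDiff ℝ ∞ χ := χ.contDiff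
  have hφ : ContDiff ℝ ∞ φ := φ.contDiff
  -- `l ↦ χ(s) ∑ l(t) ∂ₜᵏ(φ c)(s, t)` is a functional on `ℓ¹(ℝ)`, which depends smoothly on `s` for each
  -- `l`, and whose norm bounds the values of `χ ∂ₜᵏ(φ c)` at all `t`
  have hP : ∀ (l : lp (fun _ : ℝ => ℝ) 1) (k : ℕ), ContDiff ℝ ∞ fun s =>
      χ s * ∑' t, l t * iteratedDeriv k (fun x => φ x * c s x) t := fun l k =>
    hχ.mul (h (fun g => ∑' t, l t * iteratedDeriv k (fun x => φ x * g x) t) fun g hg =>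
      contDiff_tsum_iteratedDeriv l hφ φ.hasCompactSupport k hg)
  have hφc : ∀ s, ContDiff ℝ ∞ fun x => φ x * c s x := fun s => hφ.mul (hc s)
  have hS : ∀ (s : ℝ) (k : ℕ), ∃ T : lp (fun _ : ℝ => ℝ) 1 →L[ℝ] ℝ,
      ∀ l, T l = χ s * ∑' t, l t * iteratedDeriv k (fun x => φ x * c s x) t := by
    intro s k
    obtain ⟨B, -, hB⟩ := exists_bound_iteratedFDeriv (hφc s)
      (φ.hasCompactSupport.mul_right (f' := c s)) k
    obtain ⟨T, hT⟩ := exists_clm_tsum_mul (b := iteratedDeriv k fun x => φ x * c s x) (C := B)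
      fun t => by
        have := hB k le_rfl t
        rwa [norm_iteratedFDeriv_eq_norm_iteratedDeriv] at this
    exact ⟨χ s • T, fun l => by rw [smul_apply, hT, smul_eq_mul]⟩
  choose S hS using hS
  have hsingle : ∀ (s t : ℝ) (k : ℕ), S s k (lp.single 1 t (1 : ℝ)) =
      χ s * iteratedDeriv k (fun x => φ x * c s x) t := by
    intro s t k
    rw [hS, tsum_eq_single t]
    · simp
    · intro t' ht'
      simp [lp.single_apply, ht']
  have hsn : ∀ t : ℝ, ‖(lp.single 1 t (1 : ℝ) : lp (fun _ : ℝ => ℝ) 1)‖ = 1 := fun t => by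
    rw [lp.norm_single (by simp)]; simp
  set F : EuclideanSpace ℝ (Fin 2) → ℝ := fun x => χ (x 0) * (φ (x 1) * c (x 0) (x 1)) with hF
  have hFs : HasCompactSupport F := by
    refine HasCompactSupport.intro (K := {x | x 0 ∈ tsupport χ ∧ x 1 ∈ tsupport φ}) ?_ ?_
    · have hK : IsCompact ((EuclideanSpace.equiv (Fin 2) ℝ) ⁻¹'
          (Set.univ.pi ![tsupport χ, tsupport φ])) := by
        refine (EuclideanSpace.equiv (Fin 2) ℝ).toHomeomorph.isCompact_preimage.2 ?_
        refine isCompact_univ_pi fun i => ?_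
        fin_cases i
        · exact χ.hasCompactSupport.isCompact
        · exact φ.hasCompactSupport.isCompact
      convert hK using 1
      ext x
      simp [Set.mem_pi, Fin.forall_fin_two]
    · intro x hx
      rw [Set.mem_ofPred_eq, not_and_or] at hx
      rcases hx with hx | hx
      · simp only [hF, image_eq_zero_of_notMem_tsupport hx, zero_mul]
      · simp only [hF, image_eq_zero_of_notMem_tsupport hx, zero_mul, mul_zero]
  have hFd : ContDiff ℝ ∞ F := by
    refine contDiff_of_fwdDiff_le F hFs fun i k => ?_
    fin_cases i
    · -- the differences in `s`, divided by `hᵏ`, are bounded for each `l`, hence uniformly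
      obtain ⟨C, hC⟩ := banach_steinhaus
        (g := fun p : ℝ × ℝ => (p.2 ^ k)⁻¹ • (fwdDiff p.2)^[k] (fun s => S s 0) p.1) (by
          intro l
          obtain ⟨B, hB0, hB⟩ := exists_bound_iteratedFDeriv (hP l 0)
            (χ.hasCompactSupport.mul_right) k
          refine ⟨B, fun p => ?_⟩
          have e1 : ((fwdDiff p.2)^[k] (fun s => S s 0) p.1) l = (fwdDiff p.2)^[k]
              (fun s => χ s * ∑' t, l t * iteratedDeriv 0 (fun x => φ x * c s x) t) p.1 := by
            rw [fwdDiff_iter_eq_sum_shift, fwdDiff_iter_eq_sum_shift, sum_apply]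
            refine Finset.sum_congr rfl fun j _ => ?_
            rw [← hS]
            rfl
          rw [smul_apply, e1, norm_smul, norm_inv, norm_pow]
          have h1 := abs_fwdDiff_iter_le (C := B) k p.2 (hP l 0) (fun τ => by
            have := hB k le_rfl τ
            rwa [norm_iteratedFDeriv_eq_norm_iteratedDeriv] at this) p.1
          rcases eq_or_ne (‖p.2‖ ^ k) 0 with h0 | h0
          · rw [h0]; simpa using hB0
          · rw [inv_mul_le_iff₀ (lt_of_le_of_ne (by positivity) h0.symm), mul_comm]
            exact h1)
      refine ⟨C, fun x h => ?_⟩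
      rw [fwdDiff_iter_line]
      have e1 : (fun τ : ℝ => F (x + τ • EuclideanSpace.single ((fun i => i) (⟨0, by norm_num⟩ : Fin 2)) (1 : ℝ))) =
          fun τ => (fun s => χ s * (φ (x 1) * c s (x 1))) (τ + x 0) := by
        funext τ
        simp [hF, add_comm τ]
      rw [e1, fwdDiff_iter_comp_add h (fun s => χ s * (φ (x 1) * c s (x 1))) (x 0), zero_add]
      -- the quotients by `hᵏ` carry no information at `h = 0`
      rcases eq_or_ne h 0 with rfl | h0
      · cases k with
        | zero =>
          have h1 := (hC (x 0, 1))
          have h2 := ContinuousLinearMap.le_of_opNorm_le _ h1 (lp.single 1 (x 1) (1 : ℝ))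
          rw [hsn] at h2
          simpa [hsingle] using h2
        | succ k =>
          rw [Function.iterate_succ_apply']
          simp [fwdDiff]
      · have h1 := ContinuousLinearMap.le_of_opNorm_le _ (hC (x 0, h)) (lp.single 1 (x 1) (1 : ℝ))
        rw [hsn, mul_one] at h1
        have e2 : ((fwdDiff h)^[k] (fun s => S s 0) (x 0)) (lp.single 1 (x 1) (1 : ℝ)) =
            (fwdDiff h)^[k] (fun s => χ s * (φ (x 1) * c s (x 1))) (x 0) := by
          rw [fwdDiff_iter_eq_sum_shift, fwdDiff_iter_eq_sum_shift, sum_apply]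
          refine Finset.sum_congr rfl fun j _ => ?_
          have := hsingle (x 0 + j • h) (x 1) 0
          rw [iteratedDeriv_zero] at this
          rw [← this]
          rfl
        change ‖(h ^ k)⁻¹ • ((fwdDiff h)^[k] (fun s => S s 0) (x 0)) (lp.single 1 (x 1) (1 : ℝ))‖ ≤ C at h1
        rw [e2, norm_smul, norm_inv, norm_pow, inv_mul_le_iff₀ (by positivity), mul_comm] at h1
        exact h1
    · -- for the differences in `t`, the derivatives are bounded uniformly in `s`
      obtain ⟨C, hC⟩ := banach_steinhaus (g := fun s : ℝ => S s k) (by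
        intro l
        obtain ⟨B, hB⟩ := (χ.hasCompactSupport.mul_right
          (f' := fun s => ∑' t, l t * iteratedDeriv k (fun x => φ x * c s x) t)).exists_bound_of_continuous
          (hP l k).continuous
        exact ⟨B, fun s => by rw [hS]; exact hB s⟩)
      have hbd : ∀ s t, |χ s * iteratedDeriv k (fun x => φ x * c s x) t| ≤ C := by
        intro s t
        have h1 := ContinuousLinearMap.le_of_opNorm_le _ (hC s) (lp.single 1 t (1 : ℝ))
        rwa [hsn, mul_one, hsingle] at h1
      refine ⟨C, fun x h => ?_⟩
      rw [fwdDiff_iter_line]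
      have e1 : (fun τ : ℝ => F (x + τ • EuclideanSpace.single ((fun i => i) (⟨1, by norm_num⟩ : Fin 2)) (1 : ℝ))) =
          fun τ => (fun t => χ (x 0) * (φ t * c (x 0) t)) (τ + x 1) := by
        funext τ
        simp [hF, add_comm τ]
      rw [e1, fwdDiff_iter_comp_add h (fun t => χ (x 0) * (φ t * c (x 0) t)) (x 1), zero_add]
      refine abs_fwdDiff_iter_le k h (contDiff_const.mul (hφc (x 0))) (fun τ => ?_) (x 1)
      rw [iteratedDeriv_const_mul_field]
      exact hbd _ _
  let L : ℝ × ℝ → EuclideanSpace ℝ (Fin 2) := fun z => !₂[z.1, z.2]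
  have hL : ContDiff ℝ ∞ L := by
    rw [contDiff_euclidean]
    intro i
    fin_cases i
    · exact contDiff_fst
    · exact contDiff_snd
  refine (hFd.comp hL).contDiffAt.congr_of_eventuallyEq ?_
  have h1 : ∀ᶠ z : ℝ × ℝ in 𝓝 (s₀, t₀), χ z.1 = 1 :=
    (continuous_fst.tendsto (s₀, t₀)).eventually χ.eventuallyEq_one
  have h2 : ∀ᶠ z : ℝ × ℝ in 𝓝 (s₀, t₀), φ z.2 = 1 :=
    (continuous_snd.tendsto (s₀, t₀)).eventually φ.eventuallyEq_one
  filter_upwards [h1, h2] with z hz1 hz2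
  simp [hF, L, hz1, hz2, Function.uncurry]

end FunctionCurves

/-! ### Taylor expansions with values in Weil algebras -/

section Symmetry

theorem fderiv_multilinear_apply {E F : Type*} [NormedAddCommGroup E] [NormedSpace ℝ E]
    [NormedAddCommGroup F] [NormedSpace ℝ F] {m : ℕ}
    {D : E → ContinuousMultilinearMap ℝ (fun _ : Fin m => E) F} {x : E}
    (hD : DifferentiableAt ℝ D x) (a : E) (u : Fin m → E) :
    fderiv ℝ D x a u = fderiv ℝ (fun y => D y u) x a := by
  have := ((ContinuousMultilinearMap.apply ℝ (fun _ : Fin m => E) F u).hasFDerivAt.comp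
    x hD.hasFDerivAt).fderiv
  change _ = fderiv ℝ ((ContinuousMultilinearMap.apply ℝ (fun _ : Fin m => E) F u) ∘ D) x a
  rw [this]
  rfl

theorem iteratedFDeriv_comp_swap {E : Type*} [NormedAddCommGroup E] [NormedSpace ℝ E] {f : E → ℝ}
    (hf : ContDiff ℝ ∞ f) (k : ℕ) (i : Fin k) (x : E) (v : Fin (k + 1) → E) :
    iteratedFDeriv ℝ (k + 1) f x (v ∘ Equiv.swap i.castSucc i.succ) =
      iteratedFDeriv ℝ (k + 1) f x v := by
  induction k generalizing x with
  | zero => exact i.elim0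
  | succ k ih =>
    have hd : ∀ m : ℕ, ContDiff ℝ ∞ (iteratedFDeriv ℝ m f) := fun m =>
      hf.iteratedFDeriv_right (by exact_mod_cast le_top)
    induction i using Fin.cases with
    | zero =>
      have h2 : IsSymmSndFDerivAt ℝ (iteratedFDeriv ℝ k f) x :=
        (hd k).contDiffAt.isSymmSndFDerivAt (by
          simpa using (WithTop.coe_le_coe.2 (le_top : (2 : ℕ∞) ≤ ⊤)))
      have key : ∀ w : Fin (k + 1 + 1) → E, iteratedFDeriv ℝ (k + 1 + 1) f x w =
          fderiv ℝ (fderiv ℝ (iteratedFDeriv ℝ k f)) x (w 0) (w 1) (fun j => w j.succ.succ) := by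
        intro w
        rw [iteratedFDeriv_succ_apply_left,
          fderiv_multilinear_apply ((hd (k + 1)).differentiable (by simp) x)]
        have e2 : HasFDerivAt (fderiv ℝ (iteratedFDeriv ℝ k f))
            (fderiv ℝ (fderiv ℝ (iteratedFDeriv ℝ k f)) x) x :=
          (((hd k).fderiv_right (m := ∞) (by simp)).differentiable (by simp) x).hasFDerivAt
        have e3 := e2.clm_apply (hasFDerivAt_const (w 1) x)
        simp only [iteratedFDeriv_succ_apply_left]
        refine (fderiv_multilinear_apply (D := fun y => fderiv ℝ (iteratedFDeriv ℝ k f) y (w 1))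
          e3.differentiableAt (w 0) _).symm.trans ?_
        rw [e3.fderiv]
        simp
        rfl
      rw [key, key]
      have e0 : ((v ∘ Equiv.swap (Fin.castSucc 0) (Fin.succ 0)) 0 : E) = v 1 := by simp
      have e1 : ((v ∘ Equiv.swap (Fin.castSucc 0) (Fin.succ 0)) 1 : E) = v 0 := by simp
      have e2 : (fun j : Fin k => (v ∘ Equiv.swap (Fin.castSucc 0) (Fin.succ 0)) j.succ.succ) =
          fun j => v j.succ.succ := by
        funext j
        simp only [Function.comp_apply]
        rw [Equiv.swap_apply_of_ne_of_ne]
        · simp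
        · exact fun h => Fin.succ_ne_zero j (Fin.succ_injective _ h)
      rw [e0, e1, e2]
      exact congrArg (fun g => g fun j => v j.succ.succ) (h2 (v 1) (v 0))
    | succ i =>
      rw [iteratedFDeriv_succ_apply_left, iteratedFDeriv_succ_apply_left]
      have e0 : (v ∘ Equiv.swap (i.succ).castSucc (i.succ).succ) 0 = v 0 := by
        simp only [Function.comp_apply]
        rw [Equiv.swap_apply_of_ne_of_ne]
        · exact fun h => Fin.succ_ne_zero i.castSucc (by rw [Fin.succ_castSucc]; exact h.symm)
        · exact (Fin.succ_ne_zero _).symm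
      have e1 : Fin.tail (v ∘ Equiv.swap (i.succ).castSucc (i.succ).succ) =
          Fin.tail v ∘ Equiv.swap i.castSucc i.succ := by
        funext j
        simp only [Fin.tail, Function.comp_apply, ← Fin.succ_castSucc]
        congr 1
        exact (Fin.succ_injective _).swap_apply _ _ _
      rw [e0, e1]
      have hdiff : DifferentiableAt ℝ (iteratedFDeriv ℝ (k + 1) f) x :=
        (hd (k + 1)).differentiable (by simp) x
      rw [fderiv_multilinear_apply hdiff, fderiv_multilinear_apply hdiff]
      simp only [ih]

/-- The higher derivatives of a smooth function are symmetric. -/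
theorem iteratedFDeriv_comp_perm {E : Type*} [NormedAddCommGroup E] [NormedSpace ℝ E] {f : E → ℝ}
    (hf : ContDiff ℝ ∞ f) {k : ℕ} (σ : Equiv.Perm (Fin k)) (x : E) (v : Fin k → E) :
    iteratedFDeriv ℝ k f x (v ∘ σ) = iteratedFDeriv ℝ k f x v := by
  cases k with
  | zero => congr 1; exact Subsingleton.elim _ _
  | succ k =>
    have hσ : σ ∈ Submonoid.closure
        (Set.range fun i : Fin k => Equiv.swap i.castSucc i.succ) := by
      rw [Equiv.Perm.mclosure_swap_castSucc_succ]; trivial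
    induction hσ using Submonoid.closure_induction generalizing v with
    | mem τ hτ =>
      obtain ⟨i, rfl⟩ := hτ
      exact iteratedFDeriv_comp_swap hf k i x v
    | one => rfl
    | mul σ τ _ _ h1 h2 =>
      rw [Equiv.Perm.coe_mul, ← Function.comp_assoc, h2, h1]

end Symmetry

section TaylorPolynomials

/-- All derivatives of order less than `N` vanish at the origin. -/
def IsFlat {E : Type*} [NormedAddCommGroup E] [NormedSpace ℝ E] {F : Type*} [NormedAddCommGroup F]
    [NormedSpace ℝ F] (N : ℕ) (h : E → F) : Prop :=
  ∀ k < N, iteratedFDeriv ℝ k h 0 = 0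

variable {E E' F : Type*} [NormedAddCommGroup E] [NormedSpace ℝ E] [NormedAddCommGroup E']
  [NormedSpace ℝ E'] [NormedAddCommGroup F] [NormedSpace ℝ F]

theorem IsFlat.comp {N : ℕ} {h : E → F} (hN : IsFlat N h) (hh : ContDiff ℝ ∞ h) {g : E' → E}
    (hg : ContDiff ℝ ∞ g) (h0 : g 0 = 0) : IsFlat N (h ∘ g) := by
  intro k hk
  obtain ⟨D, hD⟩ : ∃ D : ℝ, ∀ i, 1 ≤ i → i ≤ k → ‖iteratedFDeriv ℝ i g 0‖ ≤ D ^ i := by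
    refine ⟨∑ i ∈ Finset.range (k + 1), (‖iteratedFDeriv ℝ i g 0‖ + 1), fun i h1 hi => ?_⟩
    set D := ∑ i ∈ Finset.range (k + 1), (‖iteratedFDeriv ℝ i g 0‖ + 1)
    have h2 : ‖iteratedFDeriv ℝ i g 0‖ + 1 ≤ D :=
      Finset.single_le_sum (f := fun i => ‖iteratedFDeriv ℝ i g 0‖ + 1)
        (fun _ _ => by positivity) (Finset.mem_range.2 (Nat.lt_succ_of_le hi))
    have h3 : 1 ≤ D := by linarith [norm_nonneg (iteratedFDeriv ℝ i g 0)]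
    calc _ ≤ D := by linarith
      _ ≤ D ^ i := le_self_pow₀ h3 (by omega)
  have := norm_iteratedFDeriv_comp_le hh hg (n := k) (by exact_mod_cast le_top) 0 (C := 0)
    (fun i hi => by rw [h0, hN i (by omega), norm_zero]) hD
  rw [mul_zero, zero_mul] at this
  exact norm_le_zero_iff.1 this

theorem IsFlat.clm_comp {F' : Type*} [NormedAddCommGroup F'] [NormedSpace ℝ F'] {N : ℕ} {h : E → F}
    (hN : IsFlat N h) (hh : ContDiff ℝ ∞ h) (L : F →L[ℝ] F') : IsFlat N (fun x => L (h x)) := by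
  intro k hk
  have := L.iteratedFDeriv_comp_left (hh.contDiffAt (x := 0)) (i := k) (by exact_mod_cast le_top)
  rw [hN k hk] at this
  exact this.trans (by ext; simp)

theorem IsFlat.iteratedFDeriv {N k : ℕ} {h : E → F} (hN : IsFlat (N + k) h)
    (hh : ContDiff ℝ ∞ h) (v : Fin k → E) : IsFlat N fun x => iteratedFDeriv ℝ k h x v := by
  induction k generalizing h with
  | zero => simpa only [iteratedFDeriv_zero_apply, add_zero] using hN
  | succ k ih =>
    have hd : ContDiff ℝ ∞ (fderiv ℝ h) := hh.fderiv_right (m := ∞) (by simp)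
    have hflat : IsFlat (N + k) (fderiv ℝ h) := fun j hj => by
      rw [← norm_eq_zero, norm_iteratedFDeriv_fderiv, hN (j + 1) (by omega), norm_zero]
    have h1 := ih (hflat.clm_comp hd (ContinuousLinearMap.apply ℝ F (v (Fin.last k))))
      ((ContinuousLinearMap.apply ℝ F (v (Fin.last k))).contDiff.comp hd) (Fin.init v)
    convert h1 using 2 with x
    rw [iteratedFDeriv_succ_apply_right]
    have h2 := (ContinuousLinearMap.apply ℝ F (v (Fin.last k))).iteratedFDeriv_comp_left
      (hd.contDiffAt (x := x)) (i := k) (by exact_mod_cast le_top)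
    exact (congrArg (fun A => A (Fin.init v)) h2).symm

theorem contDiff_mvPolynomial_eval {n : ℕ} (p : MvPolynomial (Fin n) ℝ) :
    ContDiff ℝ ∞ fun x : Fin n → ℝ => MvPolynomial.eval x p := by
  induction p using MvPolynomial.induction_on with
  | C a => simpa using contDiff_const
  | add p q hp hq => simpa using hp.add hq
  | mul_X p i hp => simpa using hp.mul (contDiff_apply ℝ ℝ i)

theorem monomial_eq_prod_X {n : ℕ} (s : Fin n →₀ ℕ) (c : ℝ) :
    ∃ (k : ℕ) (I : Fin k → Fin n),
      MvPolynomial.monomial s c = MvPolynomial.C c * ∏ j, MvPolynomial.X (I j) := by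
  have : ∃ (c' : ℝ) (k : ℕ) (I : Fin k → Fin n), c' = c ∧
      MvPolynomial.monomial s c = MvPolynomial.C c' * ∏ j, MvPolynomial.X (I j) := by
    induction s using Finsupp.induction_linear generalizing c with
    | zero => exact ⟨c, 0, Fin.elim0, rfl, by simp⟩
    | add s t hs ht =>
      obtain ⟨c1, k, I, rfl, h1⟩ := hs c
      obtain ⟨c2, l, J, rfl, h2⟩ := ht 1
      refine ⟨c1, k + l, Fin.append I J, rfl, ?_⟩
      rw [← mul_one c1, ← MvPolynomial.monomial_mul, mul_one, h1, h2, Fin.prod_univ_add]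
      simp [mul_assoc]
    | single i m =>
      refine ⟨c, m, fun _ => i, rfl, ?_⟩
      rw [Finset.prod_const, Finset.card_univ, Fintype.card_fin, ← MvPolynomial.C_mul_X_pow_eq_monomial]
  obtain ⟨c', k, I, rfl, h⟩ := this
  exact ⟨k, I, h⟩

theorem mvPolynomial_induction {n : ℕ} {P : MvPolynomial (Fin n) ℝ → Prop}
    (hadd : ∀ p q, P p → P q → P (p + q))
    (hmon : ∀ (c : ℝ) (k : ℕ) (I : Fin k → Fin n), P (MvPolynomial.C c * ∏ j, MvPolynomial.X (I j)))
    (p : MvPolynomial (Fin n) ℝ) : P p := by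
  induction p using MvPolynomial.induction_on' with
  | monomial s c =>
    obtain ⟨k, I, h⟩ := monomial_eq_prod_X s c
    rw [h]; exact hmon c k I
  | add p q hp hq => exact hadd p q hp hq

/-- The derivatives at the origin of a monomial. -/
theorem iteratedFDeriv_monomial {n k : ℕ} (c : ℝ) (I : Fin k → Fin n) (m : ℕ)
    (v : Fin m → Fin n → ℝ) :
    iteratedFDeriv ℝ m (fun x : Fin n → ℝ => c * ∏ j, x (I j)) 0 v =
      if h : m = k then c * ∑ σ : Equiv.Perm (Fin m), ∏ j, v (σ j) (I (Fin.cast h j)) else 0 := by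
  let A : ContinuousMultilinearMap ℝ (fun _ : Fin k => Fin n → ℝ) ℝ :=
    c • (ContinuousMultilinearMap.mkPiAlgebra ℝ (Fin k) ℝ).compContinuousLinearMap
      fun j => ContinuousLinearMap.proj (I j)
  have hA : ∀ w, A w = c * ∏ j, w j (I j) := fun w => by simp [A]
  let p : FormalMultilinearSeries ℝ (Fin n → ℝ) ℝ :=
    fun l => if h : l = k then h ▸ A else 0
  have hpk : p k = A := by simp [p]
  have hpl : ∀ l, l ≠ k → p l = 0 := fun l hl => by simp [p, hl]
  have hp : HasFPowerSeriesOnBall (fun x : Fin n → ℝ => c * ∏ j, x (I j)) p 0 ⊤ := by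
    refine ⟨?_, ENNReal.zero_lt_top, fun {y} _ => ?_⟩
    · refine le_of_eq (p.radius_eq_top_of_eventually_eq_zero ?_).symm
      filter_upwards [Filter.eventually_gt_atTop k] with l hl
      exact hpl l (by omega)
    · have := hasSum_single (f := fun l => p l fun _ => y) k fun l hl => by
        rw [hpl l hl]; rfl
      have e : (p k fun _ => y) = c * ∏ j, (0 + y) (I j) := by
        rw [hpk, hA, zero_add]
      rwa [e] at this
  rw [hp.iteratedFDeriv_eq_sum_of_completeSpace]
  split_ifs with h
  · subst h
    rw [hpk, Finset.mul_sum]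
    refine Finset.sum_congr rfl fun σ _ => ?_
    rw [hA]
    rfl
  · simp [hpl m h]

/-- A smooth function agrees with a polynomial up to a function which is flat of given order. -/
theorem exists_polynomial_isFlat {n : ℕ} {h : (Fin n → ℝ) → ℝ} (hh : ContDiff ℝ ∞ h) (N : ℕ) :
    ∃ T : MvPolynomial (Fin n) ℝ, IsFlat N fun x => h x - MvPolynomial.eval x T := by
  let e : Fin n → Fin n → ℝ := fun i => Pi.single i 1
  let T : MvPolynomial (Fin n) ℝ := ∑ k ∈ Finset.range N, ∑ i : Fin k → Fin n,
    MvPolynomial.C ((k.factorial : ℝ)⁻¹ * iteratedFDeriv ℝ k h 0 fun j => e (i j)) *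
      ∏ j, MvPolynomial.X (i j)
  refine ⟨T, fun m hm => ?_⟩
  have hmle : (m : WithTop ℕ∞) ≤ ∞ := by exact_mod_cast le_top
  have hT : ContDiff ℝ ∞ fun x : Fin n → ℝ => MvPolynomial.eval x T :=
    contDiff_mvPolynomial_eval T
  have e1 : iteratedFDeriv ℝ m (fun x => h x - MvPolynomial.eval x T) 0 =
      iteratedFDeriv ℝ m h 0 - iteratedFDeriv ℝ m (fun x => MvPolynomial.eval x T) 0 :=
    iteratedFDeriv_sub_apply (hh.of_le hmle).contDiffAt (hT.of_le hmle).contDiffAt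
  rw [e1, sub_eq_zero]
  have hmono : ∀ (k : ℕ) (c : ℝ) (i : Fin k → Fin n),
      ContDiff ℝ ∞ fun x : Fin n → ℝ => c * ∏ j, x (i j) := by
    intro k c i
    exact contDiff_const.mul (contDiff_prod fun j _ => contDiff_apply ℝ ℝ (i j))
  have e2 : iteratedFDeriv ℝ m (fun x => MvPolynomial.eval x T) 0 =
      ∑ k ∈ Finset.range N, ∑ i : Fin k → Fin n, iteratedFDeriv ℝ m
        (fun x : Fin n → ℝ => ((k.factorial : ℝ)⁻¹ * iteratedFDeriv ℝ k h 0 fun j => e (i j)) *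
          ∏ j, x (i j)) 0 := by
    have : (fun x => MvPolynomial.eval x T) = fun x : Fin n → ℝ => ∑ k ∈ Finset.range N,
        ∑ i : Fin k → Fin n, ((k.factorial : ℝ)⁻¹ * iteratedFDeriv ℝ k h 0 fun j => e (i j)) *
          ∏ j, x (i j) := by
      funext x
      simp [T, map_sum, map_prod]
    rw [this, iteratedFDeriv_fun_sum_apply]
    · refine Finset.sum_congr rfl fun k _ => ?_
      rw [iteratedFDeriv_fun_sum_apply]
      intro i _
      exact ((hmono k _ i).of_le hmle).contDiffAt
    · intro k _
      exact ((ContDiff.sum fun i _ => hmono k _ i).of_le hmle).contDiffAt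
  rw [e2]
  apply ContinuousMultilinearMap.toMultilinearMap_injective
  refine Module.Basis.ext_multilinear (fun _ => Pi.basisFun ℝ (Fin n)) fun J => ?_
  simp only [Pi.basisFun_apply]
  change iteratedFDeriv ℝ m h 0 (fun j => e (J j)) = (∑ k ∈ Finset.range N, ∑ i : Fin k → Fin n,
    iteratedFDeriv ℝ m (fun x : Fin n → ℝ =>
      ((k.factorial : ℝ)⁻¹ * iteratedFDeriv ℝ k h 0 fun j => e (i j)) * ∏ j, x (i j)) 0)
    (fun j => e (J j))
  rw [sum_apply, Finset.sum_eq_single m]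
  · rw [sum_apply]
    simp only [iteratedFDeriv_monomial, dif_pos, Fin.cast_eq_self]
    simp only [Finset.mul_sum]
    rw [Finset.sum_comm]
    have hσ : ∀ σ : Equiv.Perm (Fin m), (∑ i : Fin m → Fin n,
        ((m.factorial : ℝ)⁻¹ * iteratedFDeriv ℝ m h 0 fun j => e (i j)) *
          ∏ j, e (J (σ j)) (i j)) =
        (m.factorial : ℝ)⁻¹ * iteratedFDeriv ℝ m h 0 fun j => e (J j) := by
      intro σ
      rw [Finset.sum_eq_single (fun j => J (σ j))]
      · have := iteratedFDeriv_comp_perm hh σ 0 fun j => e (J j)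
        simp only [Function.comp_def] at this
        rw [this]
        simp [e]
      · intro i _ hi
        obtain ⟨j, hj⟩ := Function.ne_iff.1 hi
        rw [Finset.prod_eq_zero (Finset.mem_univ j), mul_zero]
        exact Pi.single_eq_of_ne hj 1
      · simp
    rw [Finset.sum_congr rfl fun σ _ => hσ σ, Finset.sum_const, Finset.card_univ,
      Fintype.card_perm, Fintype.card_fin, nsmul_eq_mul, ← mul_assoc, mul_inv_cancel₀, one_mul]
    exact_mod_cast m.factorial_ne_zero
  · intro k _ hk
    rw [sum_apply]
    refine Finset.sum_eq_zero fun i _ => ?_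
    rw [iteratedFDeriv_monomial, dif_neg (Ne.symm hk)]
  · intro h
    exact absurd (Finset.mem_range.2 hm) h

end TaylorPolynomials

noncomputable section

namespace WeilAlgebra

variable (W : WeilAlgebra) {n m : ℕ}

theorem taylor_of_isFlat {h : (Fin n → ℝ) → ℝ} (hh : IsFlat W.order h) (a : Fin n → W) :
    W.taylor h a = 0 := by
  refine Finset.sum_eq_zero fun k hk => ?_
  unfold taylorTerm
  rw [hh k (Finset.mem_range.1 hk)]
  simp

theorem taylor_add {h g : (Fin n → ℝ) → ℝ} (hh : ContDiff ℝ ∞ h) (hg : ContDiff ℝ ∞ g)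
    (a : Fin n → W) : W.taylor (fun x => h x + g x) a = W.taylor h a + W.taylor g a := by
  unfold taylor
  rw [← Finset.sum_add_distrib]
  refine Finset.sum_congr rfl fun k _ => ?_
  unfold taylorTerm
  rw [← smul_add, ← Finset.sum_add_distrib]
  congr 1
  refine Finset.sum_congr rfl fun i _ => ?_
  have hk : (k : WithTop ℕ∞) ≤ ∞ := by exact_mod_cast le_top
  have : iteratedFDeriv ℝ k (fun x => h x + g x) 0 =
      iteratedFDeriv ℝ k h 0 + iteratedFDeriv ℝ k g 0 :=
    iteratedFDeriv_add_apply (hh.of_le hk).contDiffAt (hg.of_le hk).contDiffAt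
  rw [this, add_apply, add_smul]

theorem taylor_mul_const {h : (Fin n → ℝ) → ℝ} (hh : ContDiff ℝ ∞ h) (c : ℝ)
    (a : Fin n → W) : W.taylor (fun x => h x * c) a = c • W.taylor h a := by
  unfold taylor
  rw [Finset.smul_sum]
  refine Finset.sum_congr rfl fun k _ => ?_
  unfold taylorTerm
  rw [smul_comm c]
  congr 1
  rw [Finset.smul_sum]
  refine Finset.sum_congr rfl fun i _ => ?_
  have hk : (k : WithTop ℕ∞) ≤ ∞ := by exact_mod_cast le_top
  have e : (fun x => h x * c) = c • h := by
    funext x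
    simp [mul_comm]
  have : iteratedFDeriv ℝ k (fun x => h x * c) 0 = c • iteratedFDeriv ℝ k h 0 := by
    rw [e]
    exact iteratedFDeriv_const_smul_apply (hh.of_le hk).contDiffAt
  rw [this, smul_apply, smul_eq_mul, mul_smul]

theorem taylor_monomial (c : ℝ) (k : ℕ) (I : Fin k → Fin n) (a : Fin n → W)
    (ha : ∀ i, W.aug (a i) = 0) :
    W.taylor (fun x => c * ∏ j, x (I j)) a = c • ∏ j, a (I j) := by
  rw [W.taylor_eq _ a ha (le_max_left W.order (k + 1)), Finset.sum_eq_single k]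
  · unfold taylorTerm
    simp only [iteratedFDeriv_monomial, dif_pos, Fin.cast_eq_self]
    simp only [Finset.mul_sum, Finset.sum_smul]
    rw [Finset.sum_comm]
    have hσ : ∀ σ : Equiv.Perm (Fin k), (∑ i : Fin k → Fin n,
        (c * ∏ j, (Pi.single (i (σ j)) (1 : ℝ) : Fin n → ℝ) (I j)) • ∏ j, a (i j)) =
        c • ∏ j, a (I j) := by
      intro σ
      rw [Finset.sum_eq_single (fun j => I (σ.symm j))]
      · rw [Equiv.prod_comp σ.symm fun j => a (I j)]
        simp
      · intro i _ hi
        obtain ⟨j, hj⟩ := Function.ne_iff.1 hi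
        rw [Finset.prod_eq_zero (Finset.mem_univ (σ.symm j)), mul_zero, zero_smul]
        rw [Equiv.apply_symm_apply]
        exact Pi.single_eq_of_ne (Ne.symm hj) 1
      · simp
    rw [Finset.sum_congr rfl fun σ _ => hσ σ, Finset.sum_const, Finset.card_univ,
      Fintype.card_perm, Fintype.card_fin, ← Nat.cast_smul_eq_nsmul ℝ, smul_smul, inv_mul_cancel₀,
      one_smul]
    exact_mod_cast k.factorial_ne_zero
  · intro l _ hl
    unfold taylorTerm
    simp [iteratedFDeriv_monomial, dif_neg hl]
  · intro h
    exact absurd (Finset.mem_range.2 (lt_max_of_lt_right (Nat.lt_succ_self k))) h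

theorem taylor_polynomial (p : MvPolynomial (Fin n) ℝ) (a : Fin n → W)
    (ha : ∀ i, W.aug (a i) = 0) :
    W.taylor (fun x => MvPolynomial.eval x p) a = MvPolynomial.aeval a p := by
  induction p using mvPolynomial_induction with
  | hadd p q hp hq =>
    simp only [map_add]
    rw [W.taylor_add (contDiff_mvPolynomial_eval p) (contDiff_mvPolynomial_eval q), hp, hq]
  | hmon c k I =>
    have := W.taylor_monomial c k I a ha
    simpa [map_prod, Algebra.smul_def] using this

theorem taylor_eq_aeval {h : (Fin n → ℝ) → ℝ} (hh : ContDiff ℝ ∞ h) {T : MvPolynomial (Fin n) ℝ}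
    (hT : IsFlat W.order fun x => h x - MvPolynomial.eval x T) (a : Fin n → W)
    (ha : ∀ i, W.aug (a i) = 0) : W.taylor h a = MvPolynomial.aeval a T := by
  have e : h = fun x => MvPolynomial.eval x T + (h x - MvPolynomial.eval x T) := by
    funext x; ring
  rw [e, W.taylor_add (contDiff_mvPolynomial_eval T) (hh.sub (contDiff_mvPolynomial_eval T)),
    W.taylor_of_isFlat hT, add_zero, W.taylor_polynomial T a ha]

theorem aug_aeval (a : Fin n → W) (ha : ∀ i, W.aug (a i) = 0) (p : MvPolynomial (Fin n) ℝ) :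
    W.aug (MvPolynomial.aeval a p) = MvPolynomial.eval 0 p := by
  have h1 := AlgHom.congr_fun (MvPolynomial.comp_aeval a W.aug) p
  have h2 : (fun i => W.aug (a i)) = 0 := funext ha
  rw [h2] at h1
  exact h1

/-- Substitution of polynomials without constant term. -/
theorem taylor_comp {h : (Fin n → ℝ) → ℝ} (hh : ContDiff ℝ ∞ h)
    (P : Fin n → MvPolynomial (Fin m) ℝ) (hP : ∀ i, MvPolynomial.eval 0 (P i) = 0)
    (a : Fin m → W) (ha : ∀ i, W.aug (a i) = 0) :
    W.taylor (fun x => h fun i => MvPolynomial.eval x (P i)) a =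
      W.taylor h fun i => MvPolynomial.aeval a (P i) := by
  obtain ⟨T, hT⟩ := exists_polynomial_isFlat hh W.order
  have hPc : ContDiff ℝ ∞ fun (x : Fin m → ℝ) i => MvPolynomial.eval x (P i) :=
    contDiff_pi.2 fun i => contDiff_mvPolynomial_eval (P i)
  rw [W.taylor_eq_aeval hh hT _ fun i => by rw [aug_aeval W a ha, hP],
    W.taylor_eq_aeval (h := fun x => h fun i => MvPolynomial.eval x (P i))
      (T := MvPolynomial.bind₁ P T) (hh.comp hPc) _ a ha,
    MvPolynomial.aeval_bind₁]
  have h1 : IsFlat W.order ((fun x => h x - MvPolynomial.eval x T) ∘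
      fun (x : Fin m → ℝ) i => MvPolynomial.eval x (P i)) :=
    hT.comp (hh.sub (contDiff_mvPolynomial_eval T)) hPc (funext hP)
  convert h1 using 2 with x
  simp only [Function.comp_apply]
  congr 1
  have := MvPolynomial.aeval_bind₁ x P T
  simpa [MvPolynomial.coe_aeval_eq_eval] using this

theorem aug_taylor {h : (Fin n → ℝ) → ℝ} (hh : ContDiff ℝ ∞ h) (a : Fin n → W)
    (ha : ∀ i, W.aug (a i) = 0) : W.aug (W.taylor h a) = h 0 := by
  obtain ⟨T, hT⟩ := exists_polynomial_isFlat hh (W.order + 1)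
  have hT' : IsFlat W.order fun x => h x - MvPolynomial.eval x T := fun k hk => hT k (by omega)
  rw [W.taylor_eq_aeval hh hT' a ha, aug_aeval W a ha]
  have := congrArg (fun A => A ![]) (hT 0 (by omega))
  simp only [iteratedFDeriv_zero_apply, zero_apply] at this
  linarith

theorem iteratedFDeriv_comp_prodMk {E F : Type*} [NormedAddCommGroup E] [NormedSpace ℝ E]
    [NormedAddCommGroup F] [NormedSpace ℝ F] {G : E × F → ℝ} (hG : ContDiff ℝ ∞ G) (u : E) (w : F)
    {k : ℕ} (v : Fin k → F) :
    iteratedFDeriv ℝ k (fun w => G (u, w)) w v =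
      iteratedFDeriv ℝ k G (u, w) fun j => (0, v j) := by
  have h1 : (fun w => G (u, w)) = (fun z => G (z + (u, (0 : F)))) ∘ ContinuousLinearMap.inr ℝ E F := by
    funext w; simp
  have h2 : ContDiff ℝ ∞ fun z => G (z + (u, (0 : F))) := hG.comp (contDiff_id.add contDiff_const)
  rw [h1, ContinuousLinearMap.iteratedFDeriv_comp_right _ h2 w
    (by exact_mod_cast le_top : (k : WithTop ℕ∞) ≤ ∞), iteratedFDeriv_comp_add_right]
  simp [ContinuousMultilinearMap.compContinuousLinearMap_apply]

theorem contDiff_iteratedFDeriv_apply {E F : Type*} [NormedAddCommGroup E] [NormedSpace ℝ E]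
    [NormedAddCommGroup F] [NormedSpace ℝ F] {G : E → F} (hG : ContDiff ℝ ∞ G) {k : ℕ}
    (v : Fin k → E) : ContDiff ℝ ∞ fun x => iteratedFDeriv ℝ k G x v :=
  (ContinuousMultilinearMap.apply ℝ (fun _ : Fin k => E) F v).contDiff.comp
    (hG.iteratedFDeriv_right (m := ∞) (by exact_mod_cast le_top))

theorem contDiff_iteratedFDeriv_snd {E F : Type*} [NormedAddCommGroup E] [NormedSpace ℝ E]
    [NormedAddCommGroup F] [NormedSpace ℝ F] {G : E × F → ℝ} (hG : ContDiff ℝ ∞ G)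
    {k : ℕ} (v : Fin k → F) :
    ContDiff ℝ ∞ fun u => iteratedFDeriv ℝ k (fun w => G (u, w)) 0 v := by
  simp only [iteratedFDeriv_comp_prodMk hG]
  exact (contDiff_iteratedFDeriv_apply hG _).comp (contDiff_id.prodMk contDiff_const)

/-- Taylor expansion in the second group of variables, followed by Taylor expansion of the
coefficients in the first group. -/
def taylor₂ (G : (Fin n → ℝ) × (Fin m → ℝ) → ℝ) (a : Fin n → W) (b : Fin m → W) : W :=
  ∑ k ∈ Finset.range W.order, (k.factorial : ℝ)⁻¹ • ∑ i : Fin k → Fin m,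
    W.taylor (fun u => iteratedFDeriv ℝ k (fun w => G (u, w)) 0
      fun j => Pi.single (i j) (1 : ℝ)) a * ∏ j, b (i j)

theorem taylor₂_add {G H : (Fin n → ℝ) × (Fin m → ℝ) → ℝ} (hG : ContDiff ℝ ∞ G)
    (hH : ContDiff ℝ ∞ H) (a : Fin n → W) (b : Fin m → W) :
    W.taylor₂ (fun z => G z + H z) a b = W.taylor₂ G a b + W.taylor₂ H a b := by
  unfold taylor₂
  rw [← Finset.sum_add_distrib]
  refine Finset.sum_congr rfl fun k _ => ?_
  rw [← smul_add, ← Finset.sum_add_distrib]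
  congr 1
  refine Finset.sum_congr rfl fun i _ => ?_
  rw [← add_mul, ← W.taylor_add (contDiff_iteratedFDeriv_snd hG _)
    (contDiff_iteratedFDeriv_snd hH _)]
  congr 2
  funext u
  have hk : (k : WithTop ℕ∞) ≤ ∞ := by exact_mod_cast le_top
  have hs : ∀ {G : (Fin n → ℝ) × (Fin m → ℝ) → ℝ}, ContDiff ℝ ∞ G →
      ContDiff ℝ ∞ fun w => G (u, w) := fun hG => hG.comp (contDiff_const.prodMk contDiff_id)
  have := iteratedFDeriv_add_apply (x := (0 : Fin m → ℝ)) ((hs hG).of_le hk).contDiffAt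
    ((hs hH).of_le hk).contDiffAt
  exact congrArg (fun A => A fun j => Pi.single (i j) (1 : ℝ)) this

theorem taylor₂_of_isFlat {G : (Fin n → ℝ) × (Fin m → ℝ) → ℝ} (hG : ContDiff ℝ ∞ G)
    (hflat : IsFlat (W.order + W.order) G) (a : Fin n → W) (b : Fin m → W) :
    W.taylor₂ G a b = 0 := by
  refine Finset.sum_eq_zero fun k hk => ?_
  rw [Finset.sum_eq_zero, smul_zero]
  intro i _
  rw [W.taylor_of_isFlat, zero_mul]
  simp only [iteratedFDeriv_comp_prodMk hG]
  have h1 : IsFlat (W.order + k) G := fun j hj => hflat j (by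
    have := Finset.mem_range.1 hk
    omega)
  exact (h1.iteratedFDeriv hG _).comp (contDiff_iteratedFDeriv_apply hG _)
    (contDiff_id.prodMk contDiff_const) rfl

theorem taylor₂_mul {g : (Fin n → ℝ) → ℝ} (hg : ContDiff ℝ ∞ g) {h : (Fin m → ℝ) → ℝ}
    (hh : ContDiff ℝ ∞ h) (a : Fin n → W) (b : Fin m → W) :
    W.taylor₂ (fun z => g z.1 * h z.2) a b = W.taylor g a * W.taylor h b := by
  conv_rhs => rw [taylor.eq_1 W h]
  unfold taylor₂
  rw [Finset.mul_sum]
  refine Finset.sum_congr rfl fun k _ => ?_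
  unfold taylorTerm
  rw [mul_smul_comm, Finset.mul_sum]
  congr 1
  refine Finset.sum_congr rfl fun i _ => ?_
  have hk : (k : WithTop ℕ∞) ≤ ∞ := by exact_mod_cast le_top
  have : ∀ u, iteratedFDeriv ℝ k (fun w => g u * h w) 0 (fun j => Pi.single (i j) (1 : ℝ)) =
      g u * iteratedFDeriv ℝ k h 0 fun j => Pi.single (i j) (1 : ℝ) := by
    intro u
    have := iteratedFDeriv_const_smul_apply (a := g u) (hh.of_le hk).contDiffAt
      (x := (0 : Fin m → ℝ))
    exact congrArg (fun A => A fun j => Pi.single (i j) (1 : ℝ)) this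
  simp only [this]
  rw [W.taylor_mul_const hg, smul_mul_assoc, mul_smul_comm]

theorem aug_append {a : Fin n → W} {b : Fin m → W} (ha : ∀ i, W.aug (a i) = 0)
    (hb : ∀ i, W.aug (b i) = 0) (i : Fin (n + m)) : W.aug (Fin.append a b i) = 0 := by
  refine Fin.addCases (fun i => ?_) (fun i => ?_) i
  · rw [Fin.append_left, ha]
  · rw [Fin.append_right, hb]

theorem contDiff_append : ContDiff ℝ ∞ fun z : (Fin n → ℝ) × (Fin m → ℝ) => Fin.append z.1 z.2 := by
  rw [contDiff_pi]
  intro i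
  refine Fin.addCases (fun i => ?_) (fun i => ?_) i
  · simp only [Fin.append_left]; fun_prop
  · simp only [Fin.append_right]; fun_prop

theorem contDiff_eval_append (p : MvPolynomial (Fin (n + m)) ℝ) :
    ContDiff ℝ ∞ fun z : (Fin n → ℝ) × (Fin m → ℝ) => MvPolynomial.eval (Fin.append z.1 z.2) p :=
  (contDiff_mvPolynomial_eval p).comp contDiff_append

theorem taylor₂_polynomial (p : MvPolynomial (Fin (n + m)) ℝ) (a : Fin n → W) (b : Fin m → W)
    (ha : ∀ i, W.aug (a i) = 0) (hb : ∀ i, W.aug (b i) = 0) :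
    W.taylor₂ (fun z => MvPolynomial.eval (Fin.append z.1 z.2) p) a b =
      MvPolynomial.aeval (Fin.append a b) p := by
  induction p using mvPolynomial_induction with
  | hadd p q hp hq =>
    simp only [map_add]
    rw [W.taylor₂_add (contDiff_eval_append p) (contDiff_eval_append q), hp, hq]
  | hmon c k I =>
    -- each variable belongs to one of the two groups
    let l : Fin (n + m) → MvPolynomial (Fin n) ℝ := Fin.addCases MvPolynomial.X fun _ => 1
    let r : Fin (n + m) → MvPolynomial (Fin m) ℝ := Fin.addCases (fun _ => 1) MvPolynomial.X
    have h1 : ∀ (u : Fin n → ℝ) (w : Fin m → ℝ) i, Fin.append u w i =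
        MvPolynomial.eval u (l i) * MvPolynomial.eval w (r i) := by
      intro u w i
      refine Fin.addCases (fun i => ?_) (fun i => ?_) i <;> simp [l, r]
    have h2 : ∀ i, Fin.append a b i = MvPolynomial.aeval a (l i) * MvPolynomial.aeval b (r i) := by
      intro i
      refine Fin.addCases (fun i => ?_) (fun i => ?_) i <;> simp [l, r]
    have e : (fun z : (Fin n → ℝ) × (Fin m → ℝ) => MvPolynomial.eval (Fin.append z.1 z.2)
        (MvPolynomial.C c * ∏ j, MvPolynomial.X (I j))) = fun z =>
        MvPolynomial.eval z.1 (MvPolynomial.C c * ∏ j, l (I j)) *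
          MvPolynomial.eval z.2 (∏ j, r (I j)) := by
      funext z
      simp only [map_mul, map_prod, MvPolynomial.eval_C, MvPolynomial.eval_X, h1,
        Finset.prod_mul_distrib, mul_assoc]
    rw [e, W.taylor₂_mul (contDiff_mvPolynomial_eval _) (contDiff_mvPolynomial_eval _),
      W.taylor_polynomial _ a ha, W.taylor_polynomial _ b hb]
    simp only [map_mul, map_prod, MvPolynomial.aeval_X, h2, Finset.prod_mul_distrib, mul_assoc,
      MvPolynomial.aeval_C]

/-- The Taylor expansion of a function of two groups of variables is an iterated Taylor expansion. -/
theorem taylor_append {H : (Fin (n + m) → ℝ) → ℝ} (hH : ContDiff ℝ ∞ H) (a : Fin n → W)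
    (b : Fin m → W) (ha : ∀ i, W.aug (a i) = 0) (hb : ∀ i, W.aug (b i) = 0) :
    W.taylor H (Fin.append a b) = W.taylor₂ (fun z => H (Fin.append z.1 z.2)) a b := by
  -- each of the two expansions takes derivatives of order less than `W.order`
  obtain ⟨T, hT⟩ := exists_polynomial_isFlat hH (W.order + W.order)
  have hT' : IsFlat W.order fun x => H x - MvPolynomial.eval x T := fun k hk => hT k (by omega)
  rw [W.taylor_eq_aeval hH hT' _ (W.aug_append ha hb)]
  have happ : ContDiff ℝ ∞ fun z : (Fin n → ℝ) × (Fin m → ℝ) => Fin.append z.1 z.2 :=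
    contDiff_append
  have e : (fun z : (Fin n → ℝ) × (Fin m → ℝ) => H (Fin.append z.1 z.2)) = fun z =>
      MvPolynomial.eval (Fin.append z.1 z.2) T +
        (H (Fin.append z.1 z.2) - MvPolynomial.eval (Fin.append z.1 z.2) T) := by
    funext z; ring
  have hc0 : (fun z : (Fin n → ℝ) × (Fin m → ℝ) => Fin.append z.1 z.2) 0 = 0 := by
    funext i
    refine Fin.addCases (fun i => ?_) (fun i => ?_) i <;> simp
  have hR : ContDiff ℝ ∞ fun z : (Fin n → ℝ) × (Fin m → ℝ) =>
      H (Fin.append z.1 z.2) - MvPolynomial.eval (Fin.append z.1 z.2) T :=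
    (hH.comp happ).sub (contDiff_eval_append T)
  rw [e, W.taylor₂_add (contDiff_eval_append T) hR, W.taylor₂_of_isFlat hR
      (hT.comp (hH.sub (contDiff_mvPolynomial_eval T)) happ hc0), add_zero]
  rw [W.taylor₂_polynomial T a b ha hb]

end WeilAlgebra

namespace WeilAlgebra

/-- A tuple of elements of the maximal ideal which generates the Weil algebra. -/
def IsGenerating {W : WeilAlgebra} {n : ℕ} (a : Fin n → W) : Prop :=
  (∀ i, W.aug (a i) = 0) ∧ ∀ w, ∃ p : MvPolynomial (Fin n) ℝ, MvPolynomial.aeval a p = w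

theorem isGenerating_iff_range {W : WeilAlgebra} {n : ℕ} {a : Fin n → W} :
    IsGenerating a ↔ (∀ i, W.aug (a i) = 0) ∧ Algebra.adjoin ℝ (Set.range a) = ⊤ := by
  rw [Algebra.adjoin_range_eq_range_aeval, AlgHom.range_eq_top]
  rfl

theorem exists_isGenerating (W : WeilAlgebra) : ∃ (n : ℕ) (a : Fin n → W), IsGenerating a := by
  obtain ⟨s, hs⟩ := (Module.finite_def.1 W.finite : (⊤ : Submodule ℝ W).FG)
  let e : Fin s.card → W := fun i => (s.equivFin.symm i : W)
  refine ⟨s.card, fun i => e i - algebraMap ℝ W (W.aug (e i)), isGenerating_iff_range.2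
    ⟨fun i => by simp, ?_⟩⟩
  rw [← Algebra.toSubmodule_eq_top, eq_top_iff, ← hs, Submodule.span_le]
  intro x hx
  have hi : e (s.equivFin ⟨x, hx⟩) = x := by simp [e]
  have : x = (e (s.equivFin ⟨x, hx⟩) - algebraMap ℝ W (W.aug (e (s.equivFin ⟨x, hx⟩)))) +
      algebraMap ℝ W (W.aug x) := by rw [hi]; ring
  rw [this]
  exact add_mem (Algebra.subset_adjoin ⟨_, rfl⟩) (Subalgebra.algebraMap_mem _ _)

theorem aug_inl {W V : WeilAlgebra} (x : W) : (tensor W V).aug (inl x) = W.aug x :=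
  (Algebra.TensorProduct.lift_tmul W.aug V.aug (fun _ _ => mul_comm _ _) x 1).trans (by simp)

theorem aug_inr {W V : WeilAlgebra} (y : V) : (tensor W V).aug (inr y) = V.aug y :=
  (Algebra.TensorProduct.lift_tmul W.aug V.aug (fun _ _ => mul_comm _ _) 1 y).trans (by simp)

theorem isGenerating_append {W V : WeilAlgebra} {n m : ℕ} {a : Fin n → W} {b : Fin m → V}
    (ha : IsGenerating a) (hb : IsGenerating b) :
    IsGenerating (Fin.append (fun i => (inl (a i) : tensor W V)) fun j => inr (b j)) := by
  refine ⟨aug_append _ (fun i => ?_) (fun j => ?_), fun w => ?_⟩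
  · rw [aug_inl, ha.1]
  · rw [aug_inr, hb.1]
  · change W ⊗[ℝ] V at w
    induction w using TensorProduct.induction_on with
    | zero => exact ⟨0, map_zero _⟩
    | add x y hx hy =>
      obtain ⟨p, hp⟩ := hx
      obtain ⟨q, hq⟩ := hy
      exact ⟨p + q, by rw [map_add, hp, hq]; rfl⟩
    | tmul x y =>
      obtain ⟨p, rfl⟩ := ha.2 x
      obtain ⟨q, rfl⟩ := hb.2 y
      refine ⟨MvPolynomial.rename (Fin.castAdd m) p * MvPolynomial.rename (Fin.natAdd n) q, ?_⟩
      rw [map_mul, MvPolynomial.aeval_rename, MvPolynomial.aeval_rename]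
      have h1 : (Fin.append (fun i => (inl (a i) : tensor W V)) fun j => inr (b j)) ∘
          Fin.castAdd m = fun i => (inl (a i) : tensor W V) := by
        funext i; simp
      have h2 : (Fin.append (fun i => (inl (a i) : tensor W V)) fun j => inr (b j)) ∘
          Fin.natAdd n = fun j => (inr (b j) : tensor W V) := by
        funext i; simp
      rw [h1, h2]
      have h3 := AlgHom.congr_fun (MvPolynomial.comp_aeval a
        (Algebra.TensorProduct.includeLeft : W →ₐ[ℝ] W ⊗[ℝ] V)) p
      have h4 := AlgHom.congr_fun (MvPolynomial.comp_aeval b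
        (Algebra.TensorProduct.includeRight : V →ₐ[ℝ] W ⊗[ℝ] V)) q
      refine (congrArg₂ (· * ·) h3.symm h4.symm).trans ?_
      exact (Algebra.TensorProduct.tmul_mul_tmul _ _ _ _).trans
        (by rw [mul_one, one_mul]; rfl)

end WeilAlgebra

namespace FrolicherSpace

open WeilAlgebra

variable {X Y Z : FrolicherSpace.{u}} {W V : WeilAlgebra}

/-! ### Elements of Weil prolongations -/

/-- The value `(χ ∘ f)(a) ∈ W` of a structure function `χ` on `f(a)`. -/
def weilValue {χ : X → ℝ} (hχ : χ ∈ X.functions) (z : prolong X W) : W :=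
  Quotient.lift (fun x : WeilPoint X W => W.taylor (χ ∘ x.toFun) x.arg)
    (fun x y (h : (weilSetoid X W).r x y) => h.2 χ hχ) z

theorem prolong_ext {z z' : prolong X W} (h : (proj X W).1 z = (proj X W).1 z')
    (h' : ∀ (χ : X → ℝ) (hχ : χ ∈ X.functions), weilValue hχ z = weilValue hχ z') : z = z' := by
  obtain ⟨x, rfl⟩ := Quotient.mk_surjective z
  obtain ⟨y, rfl⟩ := Quotient.mk_surjective z'
  exact Quotient.sound ⟨h, h'⟩

theorem weilValue_prolongHom {χ : X → ℝ} (hχ : χ ∈ X.functions) (φ : W ⟶ V) (z : prolong X W) :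
    weilValue hχ ((prolongHom X φ).1 z) = toAlgHom φ (weilValue hχ z) := by
  obtain ⟨x, rfl⟩ := Quotient.mk_surjective z
  exact taylor_hom φ _ _ x.aug_arg

theorem aug_weilValue {χ : X → ℝ} (hχ : χ ∈ X.functions) (z : prolong X W) :
    W.aug (weilValue hχ z) = χ ((proj X W).1 z) := by
  obtain ⟨x, rfl⟩ := Quotient.mk_surjective z
  exact aug_taylor W (x.isPlot χ hχ) _ x.aug_arg

theorem proj_prolongHom (φ : W ⟶ V) (z : prolong X W) :
    (proj X V).1 ((prolongHom X φ).1 z) = (proj X W).1 z := by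
  obtain ⟨x, rfl⟩ := Quotient.mk_surjective z
  rfl

theorem proj_prolongMap (f : X ⟶ Y) (z : prolong X W) :
    (proj Y W).1 ((prolongMap f W).1 z) = f.1 ((proj X W).1 z) := by
  obtain ⟨x, rfl⟩ := Quotient.mk_surjective z
  rfl

theorem prolongHom_prolongHom {U : WeilAlgebra} (φ : W ⟶ V) (ψ : V ⟶ U) (z : prolong X W) :
    (prolongHom X ψ).1 ((prolongHom X φ).1 z) = (prolongHom X (φ ≫ ψ)).1 z := by
  obtain ⟨x, rfl⟩ := Quotient.mk_surjective z
  rfl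

theorem prolongHom_id (z : prolong X W) : (prolongHom X (𝟙 W)).1 z = z := by
  obtain ⟨x, rfl⟩ := Quotient.mk_surjective z
  rfl

theorem prolongMap_prolongMap (f : X ⟶ Y) (g : Y ⟶ Z) (z : prolong X W) :
    (prolongMap g W).1 ((prolongMap f W).1 z) = (prolongMap (f ≫ g) W).1 z := by
  obtain ⟨x, rfl⟩ := Quotient.mk_surjective z
  rfl

theorem prolongMap_prolongHom (f : X ⟶ Y) (φ : W ⟶ V) (z : prolong X W) :
    (prolongMap f V).1 ((prolongHom X φ).1 z) = (prolongHom Y φ).1 ((prolongMap f W).1 z) := by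
  obtain ⟨x, rfl⟩ := Quotient.mk_surjective z
  rfl

theorem prolongHom_weilConst (φ : W ⟶ V) (x : X) :
    (prolongHom X φ).1 (weilConst x W) = weilConst x V := by
  refine Quotient.sound ⟨rfl, fun χ hχ => ?_⟩
  congr 1
  funext i
  exact i.elim0

theorem weilClass_comp {n m : ℕ} {f : (Fin n → ℝ) → X} (hf : IsPlot X f)
    (P : Fin n → MvPolynomial (Fin m) ℝ) (hP : ∀ i, MvPolynomial.eval 0 (P i) = 0)
    (a : Fin m → W) (ha : ∀ i, W.aug (a i) = 0)
    (hf' : IsPlot X fun x : Fin m → ℝ => f fun i => MvPolynomial.eval x (P i))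
    (ha' : ∀ i, W.aug (MvPolynomial.aeval a (P i)) = 0) :
    weilClass _ hf' a ha = weilClass f hf (fun i => MvPolynomial.aeval a (P i)) ha' := by
  refine Quotient.sound ⟨congrArg f (funext hP), fun χ hχ => ?_⟩
  exact taylor_comp W (hf χ hχ) P hP a ha

theorem exists_eq_weilClass {n : ℕ} {a : Fin n → W} (ha : IsGenerating a) (z : prolong X W) :
    ∃ (f : (Fin n → ℝ) → X) (hf : IsPlot X f), z = weilClass f hf a ha.1 := by
  obtain ⟨⟨m, g, hg, b, hb⟩, rfl⟩ := Quotient.mk_surjective z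
  choose P hP using fun i => ha.2 (b i)
  have h0 : ∀ i, MvPolynomial.eval 0 (P i) = 0 := fun i => by
    rw [← aug_aeval W a ha.1, hP, hb]
  have hc : IsPlot X fun x : Fin n → ℝ => g fun i => MvPolynomial.eval x (P i) :=
    hg.comp (contDiff_pi.2 fun i => contDiff_mvPolynomial_eval (P i))
  refine ⟨_, hc, ?_⟩
  rw [weilClass_comp hg P h0 a ha.1 hc fun i => by rw [hP, hb]]
  simp only [hP]
  rfl

/-! ### Smooth maps of several variables -/

theorem IsPlot.comp_curve {E : Type*} [NormedAddCommGroup E] [NormedSpace ℝ E] {f : E → X}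
    (hf : IsPlot X f) {c : ℝ → E} (hc : ContDiff ℝ ∞ c) : (fun t => f (c t)) ∈ X.curves :=
  (X.mem_curves_iff _).2 fun χ hχ => (hf χ hχ).comp hc

theorem isPlot_of_curves {E : Type*} [NormedAddCommGroup E] [NormedSpace ℝ E]
    [FiniteDimensional ℝ E] {f : E → X}
    (hf : ∀ c : ℝ → E, ContDiff ℝ ∞ c → (fun t => f (c t)) ∈ X.curves) : IsPlot X f :=
  fun χ hχ => contDiff_of_comp_curve fun c hc => (X.mem_curves_iff _).1 (hf c hc) χ hχ

theorem curves_comp {c : ℝ → X} (hc : c ∈ X.curves) {s : ℝ → ℝ} (hs : ContDiff ℝ ∞ s) :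
    (fun t => c (s t)) ∈ X.curves :=
  (X.mem_curves_iff _).2 fun χ hχ => ((X.mem_curves_iff _).1 hc χ hχ).comp hs

theorem map_mem_curves (f : X ⟶ Y) {c : ℝ → X} (hc : c ∈ X.curves) :
    (fun t => f.1 (c t)) ∈ Y.curves :=
  (isSmooth_iff_curves _).1 f.2 c hc

theorem weilClass_mem_curves {n : ℕ} {F : ℝ × (Fin n → ℝ) → X} (hF : IsPlot X F) (a : Fin n → W)
    (ha : ∀ i, W.aug (a i) = 0) :
    (fun t => (weilClass (fun x => F (t, x)) (hF.comp (by fun_prop)) a ha : prolong X W)) ∈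
      (prolong X W).curves :=
  mem_curves_generate ⟨n, F, hF, a, ha, fun _ => rfl⟩

theorem isPlot_weilClass {E : Type*} [NormedAddCommGroup E] [NormedSpace ℝ E]
    [FiniteDimensional ℝ E] {n : ℕ} {F : E × (Fin n → ℝ) → X} (hF : IsPlot X F) (a : Fin n → W)
    (ha : ∀ i, W.aug (a i) = 0) :
    IsPlot (prolong X W) fun t => weilClass (fun x => F (t, x)) (hF.comp (by fun_prop)) a ha := by
  refine isPlot_of_curves fun c hc => ?_
  have h1 : IsPlot X fun z : ℝ × (Fin n → ℝ) => F (c z.1, z.2) :=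
    hF.comp ((hc.comp contDiff_fst).prodMk contDiff_snd)
  exact weilClass_mem_curves h1 a ha

theorem IsPlot.prodMk {E : Type*} [NormedAddCommGroup E] [NormedSpace ℝ E]
    [FiniteDimensional ℝ E] {f : E → X} {g : E → Y} (hf : IsPlot X f) (hg : IsPlot Y g) :
    IsPlot (prod X Y) fun x => (f x, g x) :=
  isPlot_of_curves fun _ hc => ⟨hf.comp_curve hc, hg.comp_curve hc⟩

/-- Smooth functions of two variables on Frölicher spaces, evaluated on plots. -/
theorem contDiff_comp_plots {χ : prod X Y → ℝ} (hχ : χ ∈ (prod X Y).functions) {E F : Type*}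
    [NormedAddCommGroup E] [NormedSpace ℝ E] [FiniteDimensional ℝ E] [NormedAddCommGroup F]
    [NormedSpace ℝ F] [FiniteDimensional ℝ F] {f : E → X} {g : F → Y}
    (hf : ∀ c : ℝ → E, ContDiff ℝ ∞ c → (fun t => f (c t)) ∈ X.curves) (hg : IsPlot Y g) :
    ContDiff ℝ ∞ fun z : E × F => χ (f z.1, g z.2) :=
  contDiff_of_comp_curve fun _ hc => ((prod X Y).mem_functions_iff _).1 hχ _
    ⟨hf _ hc.fst, hg.comp_curve hc.snd⟩

/-- The coefficients of the Taylor expansion of `χ (x, g w)` in `w` are structure functions of `x`. -/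
theorem mem_functions_iteratedFDeriv {χ : prod X Y → ℝ} (hχ : χ ∈ (prod X Y).functions) {m : ℕ}
    {g : (Fin m → ℝ) → Y} (hg : IsPlot Y g) {k : ℕ} (v : Fin k → Fin m → ℝ) :
    (fun x => iteratedFDeriv ℝ k (fun w => χ (x, g w)) 0 v) ∈ X.functions := by
  rw [X.mem_functions_iff]
  intro c hc
  exact contDiff_iteratedFDeriv_snd
    (contDiff_comp_plots hχ (f := c) (fun s hs => curves_comp hc hs) hg) v

/-- The value of `χ` on `(f(a), g(b))` depends on `f` and `a` only through the class of `f(a)`. -/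
theorem weilValue_pair {χ : prod X Y → ℝ} (hχ : χ ∈ (prod X Y).functions) {n m : ℕ}
    {f : (Fin n → ℝ) → X} (hf : IsPlot X f) {g : (Fin m → ℝ) → Y} (hg : IsPlot Y g)
    {a : Fin n → W} (ha : ∀ i, W.aug (a i) = 0) {b : Fin m → W} (hb : ∀ i, W.aug (b i) = 0) :
    W.taylor (fun x : Fin (n + m) → ℝ =>
      χ (f fun i => x (Fin.castAdd m i), g fun j => x (Fin.natAdd n j))) (Fin.append a b) =
    ∑ k ∈ Finset.range W.order, (k.factorial : ℝ)⁻¹ • ∑ i : Fin k → Fin m,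
      weilValue (mem_functions_iteratedFDeriv hχ hg fun j => Pi.single (i j) (1 : ℝ))
        (weilClass f hf a ha : prolong X W) * ∏ j, b (i j) := by
  have h1 : ContDiff ℝ ∞ fun z : (Fin n → ℝ) × (Fin m → ℝ) => χ (f z.1, g z.2) :=
    contDiff_comp_plots hχ (fun c hc => hf.comp_curve hc) hg
  have h2 : ContDiff ℝ ∞ fun x : Fin (n + m) → ℝ =>
      χ (f fun i => x (Fin.castAdd m i), g fun j => x (Fin.natAdd n j)) :=
    h1.comp (f := fun x : Fin (n + m) → ℝ =>
      ((fun i => x (Fin.castAdd m i)), fun j => x (Fin.natAdd n j))) (by fun_prop)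
  rw [taylor_append W h2 a b ha hb]
  simp only [Fin.append_left, Fin.append_right]
  rfl

/-- In `(f(a), g(b))` the expression `f(a)` can be replaced by an equivalent one. -/
theorem taylor_pair_congr {χ : prod X Y → ℝ} (hχ : χ ∈ (prod X Y).functions) {n n' m : ℕ}
    {f : (Fin n → ℝ) → X} (hf : IsPlot X f) {f' : (Fin n' → ℝ) → X} (hf' : IsPlot X f')
    {g : (Fin m → ℝ) → Y} (hg : IsPlot Y g)
    {a : Fin n → W} (ha : ∀ i, W.aug (a i) = 0) {a' : Fin n' → W} (ha' : ∀ i, W.aug (a' i) = 0)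
    {b : Fin m → W} (hb : ∀ i, W.aug (b i) = 0)
    (h : (weilClass f hf a ha : prolong X W) = weilClass f' hf' a' ha') :
    W.taylor (fun x : Fin (n + m) → ℝ =>
      χ (f fun i => x (Fin.castAdd m i), g fun j => x (Fin.natAdd n j))) (Fin.append a b) =
    W.taylor (fun x : Fin (n' + m) → ℝ =>
      χ (f' fun i => x (Fin.castAdd m i), g fun j => x (Fin.natAdd n' j))) (Fin.append a' b) := by
  rw [weilValue_pair hχ hf hg ha hb, weilValue_pair hχ hf' hg ha' hb, h]

theorem taylor_comp_index {n l : ℕ} {h : (Fin l → ℝ) → ℝ} (hh : ContDiff ℝ ∞ h)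
    (I : Fin l → Fin n) (a : Fin n → W) (ha : ∀ i, W.aug (a i) = 0) :
    W.taylor (fun x => h fun i => x (I i)) a = W.taylor h fun i => a (I i) := by
  have := taylor_comp W hh (fun i => MvPolynomial.X (I i)) (fun i => by simp) a ha
  simpa using this

theorem swap_mem_functions {χ : prod X Y → ℝ} (hχ : χ ∈ (prod X Y).functions) :
    (fun z : prod Y X => χ (z.2, z.1)) ∈ (prod Y X).functions :=
  fun c hc => hχ (fun t => ((c t).2, (c t).1)) ⟨hc.2, hc.1⟩

/-- A point of `(X × Y) ⊗ W` is determined by its two components. -/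
theorem prolong_prod_ext {z z' : prolong (prod X Y) W}
    (h1 : (prolongMap (fst X Y) W).1 z = (prolongMap (fst X Y) W).1 z')
    (h2 : (prolongMap (snd X Y) W).1 z = (prolongMap (snd X Y) W).1 z') : z = z' := by
  obtain ⟨⟨n, F, hF, a, ha⟩, rfl⟩ := Quotient.mk_surjective z
  obtain ⟨⟨n', F', hF', a', ha'⟩, rfl⟩ := Quotient.mk_surjective z'
  have hF1 : IsPlot X fun x => (F x).1 := hF.map (fst X Y)
  have hF2 : IsPlot Y fun x => (F x).2 := hF.map (snd X Y)
  have hF1' : IsPlot X fun x => (F' x).1 := hF'.map (fst X Y)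
  have hF2' : IsPlot Y fun x => (F' x).2 := hF'.map (snd X Y)
  have e1 : (weilClass (fun x => (F x).1) hF1 a ha : prolong X W) =
      weilClass (fun x => (F' x).1) hF1' a' ha' := h1
  have e2 : (weilClass (fun x => (F x).2) hF2 a ha : prolong Y W) =
      weilClass (fun x => (F' x).2) hF2' a' ha' := h2
  refine Quotient.sound ⟨?_, fun χ hχ => ?_⟩
  · exact Prod.ext (congrArg (proj X W).1 e1) (congrArg (proj Y W).1 e2)
  · -- both arguments are replaced one after the other
    have hχ' := swap_mem_functions hχ
    have diag : ∀ {n : ℕ} {F : (Fin n → ℝ) → prod X Y} (hF : IsPlot (prod X Y) F)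
        {a : Fin n → W} (_ : ∀ i, W.aug (a i) = 0), W.taylor (χ ∘ F) a =
        W.taylor (fun x : Fin (n + n) → ℝ => χ ((F fun i => x (Fin.castAdd n i)).1,
          (F fun j => x (Fin.natAdd n j)).2)) (Fin.append a a) := by
      intro n F hF a ha
      have h1 : IsPlot X fun x => (F x).1 := hF.map (fst X Y)
      have h2 : IsPlot Y fun x => (F x).2 := hF.map (snd X Y)
      have h3 : ContDiff ℝ ∞ fun x : Fin (n + n) → ℝ =>
          χ ((F fun i => x (Fin.castAdd n i)).1, (F fun j => x (Fin.natAdd n j)).2) :=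
        (contDiff_comp_plots hχ (f := fun x => (F x).1) (fun c hc => h1.comp_curve hc) h2).comp
          (f := fun x : Fin (n + n) → ℝ =>
            ((fun i => x (Fin.castAdd n i)), fun j => x (Fin.natAdd n j))) (by fun_prop)
      have h4 := taylor_comp_index (W := W) h3 (Fin.addCases (fun i => i) fun i => i) a ha
      simp only [Fin.addCases_left, Fin.addCases_right] at h4
      refine h4.trans (congrArg _ (funext fun k => ?_))
      refine Fin.addCases (fun i => ?_) (fun i => ?_) k
      · simp
      · rw [Fin.addCases_right, Fin.append_right]
    have swap : ∀ {n m : ℕ} {f : (Fin n → ℝ) → X} (_ : IsPlot X f) {g : (Fin m → ℝ) → Y}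
        (_ : IsPlot Y g) {a : Fin n → W} (_ : ∀ i, W.aug (a i) = 0) {b : Fin m → W}
        (_ : ∀ i, W.aug (b i) = 0),
        W.taylor (fun x : Fin (n + m) → ℝ =>
          χ (f fun i => x (Fin.castAdd m i), g fun j => x (Fin.natAdd n j))) (Fin.append a b) =
        W.taylor (fun x : Fin (m + n) → ℝ =>
          χ (f fun i => x (Fin.natAdd m i), g fun j => x (Fin.castAdd n j)))
          (Fin.append b a) := by
      intro n m f hf g hg a ha b hb
      have h3 : ContDiff ℝ ∞ fun x : Fin (n + m) → ℝ =>
          χ (f fun i => x (Fin.castAdd m i), g fun j => x (Fin.natAdd n j)) :=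
        (contDiff_comp_plots hχ (fun c hc => hf.comp_curve hc) hg).comp
          (f := fun x : Fin (n + m) → ℝ =>
            ((fun i => x (Fin.castAdd m i)), fun j => x (Fin.natAdd n j))) (by fun_prop)
      have h4 := taylor_comp_index (W := W) h3
        (Fin.addCases (Fin.natAdd m) (Fin.castAdd n)) (Fin.append b a) (aug_append W hb ha)
      simp only [Fin.addCases_left, Fin.addCases_right] at h4
      refine Eq.trans (congrArg _ (funext fun k => ?_)) h4.symm
      refine Fin.addCases (fun i => ?_) (fun i => ?_) k <;> simp
    exact (diag hF ha).trans <| (taylor_pair_congr hχ hF1 hF1' hF2 ha ha' ha e1).trans <|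
      (swap hF1' hF2 ha' ha).trans <|
      (taylor_pair_congr hχ' hF2 hF2' hF1' ha ha' ha' e2).trans <|
      (swap hF1' hF2' ha' ha').symm.trans (diag hF' ha').symm

end FrolicherSpace

namespace FrolicherSpace

open WeilAlgebra

variable {X Y Z : FrolicherSpace.{u}} {W V : WeilAlgebra}

/-! ### Prolongations of products -/

theorem weilClass_congr {n : ℕ} {f f' : (Fin n → ℝ) → X} {hf : IsPlot X f} {hf' : IsPlot X f'}
    {a a' : Fin n → W} {ha : ∀ i, W.aug (a i) = 0} {ha' : ∀ i, W.aug (a' i) = 0}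
    (h : ∀ x, f x = f' x) (h' : ∀ i, a i = a' i) : weilClass f hf a ha = weilClass f' hf' a' ha' := by
  obtain rfl := funext h
  obtain rfl := funext h'
  rfl

theorem prolongPair_weilClass {n : ℕ} {f : (Fin n → ℝ) → X} (hf : IsPlot X f)
    {g : (Fin n → ℝ) → Y} (hg : IsPlot Y g) (a : Fin n → W) (ha : ∀ i, W.aug (a i) = 0) :
    prolongPair (weilClass f hf a ha : prolong X W) (weilClass g hg a ha : prolong Y W) =
      weilClass (X := prod X Y) (fun x => (f x, g x)) (hf.prodMk hg) a ha := by
  have h : ∃ z : prolong (prod X Y) W,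
      (prolongMap (fst X Y) W).1 z = weilClass f hf a ha ∧
        (prolongMap (snd X Y) W).1 z = weilClass g hg a ha :=
    ⟨weilClass (X := prod X Y) (fun x => (f x, g x)) (hf.prodMk hg) a ha, rfl, rfl⟩
  unfold prolongPair
  rw [dif_pos h]
  exact prolong_prod_ext h.choose_spec.1 h.choose_spec.2

/-- The value in `Z ⊗ W` of a smooth map `f : X × Y → Z` on two elements of `X ⊗ W` and `Y ⊗ W`. -/
def prolongMap₂ (f : prod X Y ⟶ Z) (x : prolong X W) (y : prolong Y W) : prolong Z W :=
  (prolongMap f W).1 (prolongPair x y)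

theorem prolongMap₂_weilClass (k : prod X Y ⟶ Z) {n : ℕ} {f : (Fin n → ℝ) → X} (hf : IsPlot X f)
    {g : (Fin n → ℝ) → Y} (hg : IsPlot Y g) (a : Fin n → W) (ha : ∀ i, W.aug (a i) = 0) :
    prolongMap₂ k (weilClass f hf a ha : prolong X W) (weilClass g hg a ha : prolong Y W) =
      weilClass (fun x => k.1 (f x, g x)) ((hf.prodMk hg).map k) a ha := by
  unfold prolongMap₂
  rw [prolongPair_weilClass]
  rfl

theorem exists_eq_weilClass₂ (x : prolong X W) (y : prolong Y W) :
    ∃ (n : ℕ) (a : Fin n → W) (ha : ∀ i, W.aug (a i) = 0) (f : (Fin n → ℝ) → X) (hf : IsPlot X f)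
      (g : (Fin n → ℝ) → Y) (hg : IsPlot Y g), x = weilClass f hf a ha ∧ y = weilClass g hg a ha := by
  obtain ⟨n, a, ha⟩ := W.exists_isGenerating
  obtain ⟨f, hf, rfl⟩ := exists_eq_weilClass ha x
  obtain ⟨g, hg, rfl⟩ := exists_eq_weilClass ha y
  exact ⟨n, a, ha.1, f, hf, g, hg, rfl, rfl⟩

theorem prolongHom_prolongMap₂ (k : prod X Y ⟶ Z) (φ : W ⟶ V) (x : prolong X W) (y : prolong Y W) :
    (prolongHom Z φ).1 (prolongMap₂ k x y) =
      prolongMap₂ k ((prolongHom X φ).1 x) ((prolongHom Y φ).1 y) := by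
  obtain ⟨n, a, ha, f, hf, g, hg, rfl, rfl⟩ := exists_eq_weilClass₂ x y
  rw [prolongMap₂_weilClass]
  exact (prolongMap₂_weilClass k hf hg (fun i => toAlgHom φ (a i))
    fun i => by rw [aug_hom, ha]).symm

theorem proj_prolongMap₂ (k : prod X Y ⟶ Z) (x : prolong X W) (y : prolong Y W) :
    (proj Z W).1 (prolongMap₂ k x y) = k.1 ((proj X W).1 x, (proj Y W).1 y) := by
  obtain ⟨n, a, ha, f, hf, g, hg, rfl, rfl⟩ := exists_eq_weilClass₂ x y
  rw [prolongMap₂_weilClass]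
  rfl

theorem weilClass_const {n : ℕ} (x : X) (a : Fin n → W) (ha : ∀ i, W.aug (a i) = 0) :
    (weilClass (fun _ => x) (IsPlot.const X x) a ha : prolong X W) = weilConst x W :=
  (weilClass_comp (IsPlot.const X x) (n := 0) (fun i => i.elim0) (fun i => i.elim0) a ha
    (IsPlot.const X x) (fun i => i.elim0)).trans
    (weilClass_congr (fun _ => rfl) fun i => i.elim0)

theorem prolongMap₂_const_left {k : prod X Y ⟶ Z} {x : X} {l : Y ⟶ Z}
    (h : ∀ y, k.1 (x, y) = l.1 y) (y : prolong Y W) :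
    prolongMap₂ k (weilConst x W) y = (prolongMap l W).1 y := by
  obtain ⟨⟨n, g, hg, a, ha⟩, rfl⟩ := Quotient.mk_surjective y
  rw [← weilClass_const x a ha]
  exact (prolongMap₂_weilClass k _ hg a ha).trans (weilClass_congr (fun t => h (g t)) fun _ => rfl)

theorem prolongMap₂_const_right {k : prod X Y ⟶ Z} {y : Y} {l : X ⟶ Z}
    (h : ∀ x, k.1 (x, y) = l.1 x) (x : prolong X W) :
    prolongMap₂ k x (weilConst y W) = (prolongMap l W).1 x := by
  obtain ⟨⟨n, g, hg, a, ha⟩, rfl⟩ := Quotient.mk_surjective x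
  rw [← weilClass_const y a ha]
  exact (prolongMap₂_weilClass k hg _ a ha).trans (weilClass_congr (fun t => h (g t)) fun _ => rfl)

theorem prolongMap_prolongMap₂ {X' Y' Z' : FrolicherSpace.{u}} {k : prod X Y ⟶ Z}
    {k' : prod X' Y' ⟶ Z'} {f : X ⟶ X'} {g : Y ⟶ Y'} {h : Z ⟶ Z'}
    (hk : ∀ x y, h.1 (k.1 (x, y)) = k'.1 (f.1 x, g.1 y)) (x : prolong X W) (y : prolong Y W) :
    (prolongMap h W).1 (prolongMap₂ k x y) =
      prolongMap₂ k' ((prolongMap f W).1 x) ((prolongMap g W).1 y) := by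
  obtain ⟨n, a, ha, u, hu, v, hv, rfl, rfl⟩ := exists_eq_weilClass₂ x y
  rw [prolongMap₂_weilClass]
  exact (weilClass_congr (fun t => hk (u t) (v t)) fun _ => rfl).trans
    (prolongMap₂_weilClass k' (hu.map f) (hv.map g) a ha).symm

/-! ### Curves in spaces of smooth maps -/

/-- The curves of `[Y → X]` are the maps `c` for which `(s, y) ↦ c s y` is smooth. -/
theorem contDiff_uncurry_exp {c : ℝ → exp Y X} (hc : c ∈ (exp Y X).curves) {y : ℝ → Y}
    (hy : y ∈ Y.curves) {χ : X → ℝ} (hχ : χ ∈ X.functions) :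
    ContDiff ℝ ∞ fun p : ℝ × ℝ => χ ((c p.1).1 (y p.2)) := by
  refine contDiff_uncurry_of_functionals (c := fun s t => χ ((c s).1 (y t))) (fun s => ?_)
    fun Ψ hΨ => ?_
  · exact (Y.mem_curves_iff _).1 hy _ ((c s).2 χ hχ)
  · refine hc (fun η => Ψ fun t => χ (η.1 (y t))) fun d hd => ?_
    refine hΨ (fun s t => χ ((d s).1 (y t))) (contDiff_of_comp_curve fun σ hσ => ?_)
    exact (X.mem_curves_iff _).1 (hd _ hσ.fst _ (curves_comp hy hσ.snd)) χ hχ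

theorem apply_mem_curves {c : ℝ → exp Y X} (hc : c ∈ (exp Y X).curves) {y : ℝ → Y}
    (hy : y ∈ Y.curves) : (fun t => (c t).1 (y t)) ∈ X.curves :=
  (X.mem_curves_iff _).2 fun _ hχ =>
    (contDiff_uncurry_exp hc hy hχ).comp (f := fun t : ℝ => (t, t)) (by fun_prop)

/-- If `c` is a curve of `[Y → X]` and `z` is a curve of `Y ⊗ W`, then `(c(t) ⊗ W)(z(t))` is a curve of
`X ⊗ W`. The parameters of `c` and `z` are first separated, because testing with functionals reduces
the claim to the generating curves of `Y ⊗ W` only for a fixed function. -/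
theorem prolongMap_apply_mem_curves {c : ℝ → exp Y X} (hc : c ∈ (exp Y X).curves)
    {z : ℝ → prolong Y W} (hz : z ∈ (prolong Y W).curves) :
    (fun t => (prolongMap (show Y ⟶ X from c t) W).1 (z t)) ∈ (prolong X W).curves := by
  -- for the generating curves `z` of `Y ⊗ W`
  have gen : ∀ {n : ℕ} {F : ℝ × (Fin n → ℝ) → Y} (hF : IsPlot Y F) (a : Fin n → W)
      (ha : ∀ i, W.aug (a i) = 0) {σ τ : ℝ → ℝ}, ContDiff ℝ ∞ σ → ContDiff ℝ ∞ τ →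
      (fun t => (prolongMap (show Y ⟶ X from c (σ t)) W).1
        (weilClass (fun x => F (τ t, x)) (hF.comp (by fun_prop)) a ha)) ∈
        (prolong X W).curves := by
    intro n F hF a ha σ τ hσ hτ
    have h : IsPlot X fun z : ℝ × (Fin n → ℝ) => (c (σ z.1)).1 (F (τ z.1, z.2)) :=
      isPlot_of_curves fun d hd => apply_mem_curves (curves_comp hc (hσ.comp hd.fst))
        (hF.comp_curve ((hτ.comp hd.fst).prodMk hd.snd))
    exact weilClass_mem_curves h a ha
  refine ((prolong X W).mem_curves_iff _).2 fun χ hχ => ?_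
  have key : ContDiff ℝ ∞ (Function.uncurry fun s t =>
      χ ((prolongMap (show Y ⟶ X from c t) W).1 (z s))) := by
    refine contDiff_uncurry_of_functionals (fun s => ?_) fun Ψ hΨ => ?_
    · obtain ⟨⟨n, f, hf, a, ha⟩, hx⟩ := Quotient.mk_surjective (z s)
      rw [← hx]
      exact ((prolong X W).mem_curves_iff _).1 (gen (F := fun z => f z.2)
        (hf.comp contDiff_snd) a ha contDiff_id contDiff_id) χ hχ
    · refine hz (fun z' => Ψ fun t => χ ((prolongMap (show Y ⟶ X from c t) W).1 z')) ?_
      rintro d ⟨n, F, hF, a, ha, hd⟩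
      refine hΨ (fun s t => χ ((prolongMap (show Y ⟶ X from c t) W).1 (d s)))
        (contDiff_of_comp_curve fun σ hσ => ?_)
      have := ((prolong X W).mem_curves_iff _).1 (gen hF a ha hσ.snd hσ.fst) χ hχ
      simpa only [Function.comp_def, Function.uncurry, hd] using this
  exact key.comp (f := fun t : ℝ => (t, t)) (by fun_prop)

/-! ### Smoothness of the convolutions -/

variable {M : FrolicherSpace.{u}}

theorem isSmooth_conv (hE : M.WeilExponentiable) (p q : ℕ) :
    IsSmooth (X := prod (distr M p) (distr M q)) (Y := distr M (p + q))
      fun η => conv hE η.1 η.2 := by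
  refine (isSmooth_iff_curves _).2 fun c hc => mem_curves_generate fun s hs y hy => ?_
  exact apply_mem_curves (curves_comp hc.1 hs) (prolongMap_apply_mem_curves (curves_comp hc.2 hs)
    (map_mem_curves (hE.assoc (cube q) (cube p)) (map_mem_curves _ hy)))

theorem isSmooth_conv' (hE : M.WeilExponentiable) (p q : ℕ) :
    IsSmooth (X := prod (distr M p) (distr M q)) (Y := distr M (p + q))
      fun η => conv' hE η.1 η.2 := by
  refine (isSmooth_iff_curves _).2 fun c hc => mem_curves_generate fun s hs y hy => ?_
  exact apply_mem_curves (curves_comp hc.2 hs) (prolongMap_apply_mem_curves (curves_comp hc.1 hs)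
    (map_mem_curves (hE.assoc (cube p) (cube q)) (map_mem_curves _ hy)))

/-- The first convolution as a smooth map. -/
def convHom (hE : M.WeilExponentiable) (p q : ℕ) :
    prod (distr M p) (distr M q) ⟶ distr M (p + q) := ⟨_, isSmooth_conv hE p q⟩

/-- The second convolution as a smooth map. -/
def convHom' (hE : M.WeilExponentiable) (p q : ℕ) :
    prod (distr M p) (distr M q) ⟶ distr M (p + q) := ⟨_, isSmooth_conv' hE p q⟩

theorem circ_eq (hE : M.WeilExponentiable) {p q m n : ℕ} (ξ₁ : prolong (distr M p) (cube m))
    (ξ₂ : prolong (distr M q) (cube n)) :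
    circ hE ξ₁ ξ₂ = prolongMap₂ (convHom hE p q) ((prolongHom _ (cubeLeft m n)).1 ξ₁)
      ((prolongHom _ (cubeRight m n)).1 ξ₂) :=
  dif_pos (isSmooth_conv hE p q)

theorem circ'_eq (hE : M.WeilExponentiable) {p q m n : ℕ} (ξ₁ : prolong (distr M p) (cube m))
    (ξ₂ : prolong (distr M q) (cube n)) :
    circ' hE ξ₁ ξ₂ = prolongMap₂ (convHom' hE p q) ((prolongHom _ (cubeLeft m n)).1 ξ₁)
      ((prolongHom _ (cubeRight m n)).1 ξ₂) :=
  dif_pos (isSmooth_conv' hE p q)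

end FrolicherSpace

/-! ### The identification of M ⊗ (W ⊗ V) with (M ⊗ W) ⊗ V -/

namespace WeilAlgebra

variable {W V W' V' U : WeilAlgebra}

/-- The homomorphism `φ ⊗ ψ`. -/
def tensorMap (φ : W ⟶ W') (ψ : V ⟶ V') : tensor W V ⟶ tensor W' V' :=
  Algebra.TensorProduct.map (toAlgHom φ) (toAlgHom ψ)

/-- The associativity `(W ⊗ V) ⊗ U → W ⊗ (V ⊗ U)`. -/
def tensorAssoc (W V U : WeilAlgebra) : tensor (tensor W V) U ⟶ tensor W (tensor V U) :=
  (Algebra.TensorProduct.assoc ℝ ℝ ℝ W V U).toAlgHom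

theorem tensorMap_inl (φ : W ⟶ W') (ψ : V ⟶ V') (x : W) :
    toAlgHom (tensorMap φ ψ) (inl x) = inl (toAlgHom φ x) :=
  (Algebra.TensorProduct.map_tmul _ _ _ _).trans
    (congrArg (fun y => (toAlgHom φ x ⊗ₜ[ℝ] y : W' ⊗[ℝ] V')) (map_one (toAlgHom ψ)))

theorem tensorMap_inr (φ : W ⟶ W') (ψ : V ⟶ V') (y : V) :
    toAlgHom (tensorMap φ ψ) (inr y) = inr (toAlgHom ψ y) :=
  (Algebra.TensorProduct.map_tmul _ _ _ _).trans
    (congrArg (fun x => (x ⊗ₜ[ℝ] toAlgHom ψ y : W' ⊗[ℝ] V')) (map_one (toAlgHom φ)))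

theorem tensorAssoc_inl_inl (x : W) :
    toAlgHom (tensorAssoc W V U) (inl (inl x)) = inl x := rfl

theorem tensorAssoc_inl_inr (x : V) :
    toAlgHom (tensorAssoc W V U) (inl (inr x)) = inr (inl x) := rfl

theorem tensorAssoc_inr (x : U) :
    toAlgHom (tensorAssoc W V U) (inr x) = inr (inr x) := rfl

end WeilAlgebra

namespace FrolicherSpace

open WeilAlgebra

variable {M : FrolicherSpace.{u}} (hE : M.WeilExponentiable) {W V W' V' : WeilAlgebra}

theorem aug_append_inl_inr {n m : ℕ} {a : Fin n → W} (ha : ∀ i, W.aug (a i) = 0) {b : Fin m → V}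
    (hb : ∀ i, V.aug (b i) = 0) (i : Fin (n + m)) :
    (tensor W V).aug (Fin.append (fun i => inl (a i)) (fun j => inr (b j)) i) = 0 :=
  aug_append _ (fun i => by rw [aug_inl, ha]) (fun i => by rw [aug_inr, hb]) i

theorem IsPlot.append_left {X : FrolicherSpace.{u}} {n m : ℕ} {F : (Fin (n + m) → ℝ) → X}
    (hF : IsPlot X F) (t : Fin m → ℝ) : IsPlot X fun x : Fin n → ℝ => F (Fin.append x t) :=
  hF.comp (contDiff_append.comp (contDiff_id.prodMk contDiff_const))

theorem isPlot_weilClass_append {X : FrolicherSpace.{u}} {n m : ℕ} {F : (Fin (n + m) → ℝ) → X}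
    (hF : IsPlot X F) (a : Fin n → W) (ha : ∀ i, W.aug (a i) = 0) :
    IsPlot (prolong X W) fun t : Fin m → ℝ =>
      weilClass (fun x => F (Fin.append x t)) (hF.append_left t) a ha :=
  isPlot_weilClass (F := fun z : (Fin m → ℝ) × (Fin n → ℝ) => F (Fin.append z.2 z.1))
    (hF.comp (contDiff_append.comp (contDiff_snd.prodMk contDiff_fst))) a ha

/-- The identification `M ⊗ (W ⊗ V) = (M ⊗ W) ⊗ V` on the class of a smooth map of two groups of
variables. -/
theorem assoc_weilClass {n m : ℕ} {F : (Fin (n + m) → ℝ) → M} (hF : IsPlot M F)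
    {a : Fin n → W} (ha : ∀ i, W.aug (a i) = 0) {b : Fin m → V} (hb : ∀ i, V.aug (b i) = 0) :
    (hE.assoc W V).1 (weilClass F hF _ (aug_append_inl_inr ha hb)) =
      weilClass (X := prolong M W) _ (isPlot_weilClass_append hF a ha) b hb := by
  set Φ := (hE point W V).choose with hΦ
  set g : prolong (prolong M W) V :=
    weilClass (X := prolong M W) _ (isPlot_weilClass_append hF a ha) b hb with hg
  set z₀ := (prolongMap (toExpPoint (prolong M W)) V).1 g with hz₀
  have hev : (prolongMap (evalAt (prolong M W) (PUnit.unit : PUnit.{u + 1})) V).1 z₀ = g := by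
    rw [hz₀, prolongMap_prolongMap]
    rfl
  have h1 : (Φ.hom.1 z₀).1 (PUnit.unit : PUnit.{u + 1}) =
      weilClass F hF _ (aug_append_inl_inr ha hb) :=
    (hE point W V).choose_spec z₀ PUnit.unit n m F hF a ha b hb _ _ _ hev
  have h2 : Φ.hom.1 z₀ = (toExpPoint (prolong M (W.tensor V))).1
      (weilClass F hF _ (aug_append_inl_inr ha hb)) := by
    apply Subtype.ext
    funext y
    exact h1
  have h3 : Φ.inv.1 (Φ.hom.1 z₀) = z₀ := congrArg (fun f => f.1 z₀) Φ.hom_inv_id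
  rw [h2] at h3
  refine Eq.trans ?_ hev
  exact congrArg (prolongMap (evalAt (prolong M W) (PUnit.unit : PUnit.{u + 1})) V).1 h3

theorem exists_eq_weilClass_append {X : FrolicherSpace.{u}} (z : prolong X (tensor W V)) :
    ∃ (n m : ℕ) (a : Fin n → W) (ha : ∀ i, W.aug (a i) = 0) (b : Fin m → V)
      (hb : ∀ i, V.aug (b i) = 0) (F : (Fin (n + m) → ℝ) → X) (hF : IsPlot X F),
      z = weilClass F hF _ (aug_append_inl_inr ha hb) := by
  obtain ⟨n, a, ha⟩ := W.exists_isGenerating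
  obtain ⟨m, b, hb⟩ := V.exists_isGenerating
  obtain ⟨F, hF, rfl⟩ := exists_eq_weilClass (isGenerating_append ha hb) z
  exact ⟨n, m, a, ha.1, b, hb.1, F, hF, rfl⟩

theorem tensorMap_append {n m : ℕ} (φ : W ⟶ W') (ψ : V ⟶ V') (a : Fin n → W) (b : Fin m → V)
    (i : Fin (n + m)) :
    toAlgHom (tensorMap φ ψ) (Fin.append (fun i => inl (a i)) (fun j => inr (b j)) i) =
      Fin.append (fun i => inl (toAlgHom φ (a i))) (fun j => inr (toAlgHom ψ (b j))) i := by
  refine Fin.addCases (fun i => ?_) (fun j => ?_) i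
  · rw [Fin.append_left, Fin.append_left, tensorMap_inl]
  · rw [Fin.append_right, Fin.append_right, tensorMap_inr]

theorem assoc_tensorMap (φ : W ⟶ W') (ψ : V ⟶ V') (z : prolong M (tensor W V)) :
    (hE.assoc W' V').1 ((prolongHom M (tensorMap φ ψ)).1 z) =
      (prolongMap (prolongHom M φ) V').1
        ((prolongHom (prolong M W) ψ).1 ((hE.assoc W V).1 z)) := by
  obtain ⟨n, m, a, ha, b, hb, F, hF, rfl⟩ := exists_eq_weilClass_append z
  rw [assoc_weilClass hE hF ha hb]
  have ha' : ∀ i, W'.aug (toAlgHom φ (a i)) = 0 := fun i => by rw [aug_hom, ha]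
  have hb' : ∀ i, V'.aug (toAlgHom ψ (b i)) = 0 := fun i => by rw [aug_hom, hb]
  have h : (prolongHom M (tensorMap φ ψ)).1 (weilClass F hF _ (aug_append_inl_inr ha hb)) =
      weilClass F hF _ (aug_append_inl_inr ha' hb') :=
    weilClass_congr (fun _ => rfl) (tensorMap_append φ ψ a b)
  rw [h, assoc_weilClass hE hF ha' hb']
  rfl

/-- The map `M ⊗ (W ⊗ V) = (M ⊗ W) ⊗ V → M ⊗ V` induced by `η : M ⊗ W → M`. -/
def applyLeft (η : prolong M W ⟶ M) (V : WeilAlgebra) : prolong M (tensor W V) ⟶ prolong M V :=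
  hE.assoc W V ≫ prolongMap η V

theorem applyLeft_tensorMap (η : prolong M W ⟶ M) (φ : W' ⟶ W) (ψ : V ⟶ V')
    (z : prolong M (tensor W' V)) :
    (applyLeft hE η V').1 ((prolongHom M (tensorMap φ ψ)).1 z) =
      (prolongHom M ψ).1 ((applyLeft hE (prolongHom M φ ≫ η) V).1 z) := by
  change (prolongMap η V').1 ((hE.assoc W V').1 _) =
    (prolongHom M ψ).1 ((prolongMap (prolongHom M φ ≫ η) V).1 ((hE.assoc W' V).1 z))
  rw [assoc_tensorMap, prolongMap_prolongMap, prolongMap_prolongHom]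

theorem applyLeft_tensorMap_id (η : prolong M W ⟶ M) (ψ : V ⟶ V') (z : prolong M (tensor W V)) :
    (applyLeft hE η V').1 ((prolongHom M (tensorMap (𝟙 W) ψ)).1 z) =
      (prolongHom M ψ).1 ((applyLeft hE η V).1 z) := by
  have h : prolongHom M (𝟙 W) = 𝟙 _ := (weilFunctor M).map_id W
  rw [applyLeft_tensorMap, h, Category.id_comp]

theorem applyLeft_proj (V : WeilAlgebra) (z : prolong M (tensor W V)) (ε : tensor W V ⟶ V)
    (h1 : ∀ x : W, toAlgHom ε (inl x) = algebraMap ℝ V (W.aug x))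
    (h2 : ∀ x : V, toAlgHom ε (inr x) = x) :
    (applyLeft hE (proj M W) V).1 z = (prolongHom M ε).1 z := by
  obtain ⟨n, m, a, ha, b, hb, F, hF, rfl⟩ := exists_eq_weilClass_append z
  change (prolongMap (proj M W) V).1 ((hE.assoc W V).1 _) = _
  rw [assoc_weilClass hE hF ha hb]
  have h3 := weilClass_comp (W := V) hF
    (Fin.append (fun _ : Fin n => (0 : MvPolynomial (Fin m) ℝ)) MvPolynomial.X)
    (fun i => by refine Fin.addCases (fun i => ?_) (fun j => ?_) i <;> simp) b hb
    (hF.comp (contDiff_pi.2 fun i => contDiff_mvPolynomial_eval _))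
    (fun i => by refine Fin.addCases (fun i => ?_) (fun j => ?_) i <;> simp [hb])
  refine Eq.trans (weilClass_congr (fun t => ?_) fun _ => rfl) (h3.trans
    (weilClass_congr (fun _ => rfl) fun i => ?_))
  · refine congrArg F (funext fun i => ?_)
    refine Fin.addCases (fun i => ?_) (fun j => ?_) i <;> simp
  · refine Fin.addCases (fun i => ?_) (fun j => ?_) i
    · refine Eq.trans ?_ (congrArg (toAlgHom ε)
        (Fin.append_left (fun i => inl (a i)) (fun j => inr (b j)) i).symm)
      rw [Fin.append_left, map_zero, h1, ha, map_zero]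
    · refine Eq.trans ?_ (congrArg (toAlgHom ε)
        (Fin.append_right (fun i => inl (a i)) (fun j => inr (b j)) j).symm)
      rw [Fin.append_right, MvPolynomial.aeval_X, h2]

theorem tensorAssoc_append {U : WeilAlgebra} {n m l : ℕ} (a : Fin n → W) (b : Fin m → V)
    (c : Fin l → U) (i : Fin (n + m + l)) :
    toAlgHom (tensorAssoc W V U) (Fin.append (fun i => inl (Fin.append (fun i => inl (a i))
      (fun j => inr (b j)) i)) (fun j => inr (c j)) i) =
      Fin.append (fun i => inl (a i)) (fun j => inr (Fin.append (fun i => inl (b i))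
        (fun j => inr (c j)) j)) (Fin.cast (Nat.add_assoc n m l) i) := by
  refine Fin.addCases (fun i => ?_) (fun k => ?_) i
  · refine Fin.addCases (fun i => ?_) (fun j => ?_) i
    · have : Fin.cast (Nat.add_assoc n m l) (Fin.castAdd l (Fin.castAdd m i)) =
          Fin.castAdd (m + l) i := rfl
      rw [Fin.append_left, Fin.append_left, tensorAssoc_inl_inl, this, Fin.append_left]
    · have : Fin.cast (Nat.add_assoc n m l) (Fin.castAdd l (Fin.natAdd n j)) =
          Fin.natAdd n (Fin.castAdd l j) := rfl
      rw [Fin.append_left, Fin.append_right, tensorAssoc_inl_inr, this, Fin.append_right,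
        Fin.append_left]
  · have : Fin.cast (Nat.add_assoc n m l) (Fin.natAdd (n + m) k) =
        Fin.natAdd n (Fin.natAdd m k) := by ext; simp [Nat.add_assoc]
    rw [Fin.append_right, tensorAssoc_inr, this, Fin.append_right, Fin.append_right]

theorem aug_append_assoc {U : WeilAlgebra} {n m l : ℕ} {a : Fin n → W} (ha : ∀ i, W.aug (a i) = 0)
    {b : Fin m → V} (hb : ∀ i, V.aug (b i) = 0) {c : Fin l → U} (hc : ∀ i, U.aug (c i) = 0)
    (i : Fin (n + m + l)) : (tensor W (tensor V U)).aug (Fin.append (fun i => inl (a i))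
      (fun j => inr (Fin.append (fun i => inl (b i)) (fun j => inr (c j)) j))
        (Fin.cast (Nat.add_assoc n m l) i)) = 0 :=
  aug_append_inl_inr ha (aug_append_inl_inr hb hc) _

/-- Iterated application: `((M ⊗ W) ⊗ V) ⊗ U → (M ⊗ V) ⊗ U` as a map
`(M ⊗ W) ⊗ (V ⊗ U) → M ⊗ (V ⊗ U)`. -/
theorem prolongMap_applyLeft {U : WeilAlgebra} (η : prolong M W ⟶ M)
    (z : prolong M (tensor (tensor W V) U)) :
    (prolongMap (applyLeft hE η V) U).1 ((hE.assoc (tensor W V) U).1 z) =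
      (hE.assoc V U).1 ((applyLeft hE η (tensor V U)).1
        ((prolongHom M (tensorAssoc W V U)).1 z)) := by
  obtain ⟨n, a, ha⟩ := W.exists_isGenerating
  obtain ⟨m, b, hb⟩ := V.exists_isGenerating
  obtain ⟨l, c, hc⟩ := U.exists_isGenerating
  obtain ⟨F, hF, rfl⟩ := exists_eq_weilClass
    (isGenerating_append (isGenerating_append ha hb) hc) z
  have hF' : IsPlot M fun x : Fin (n + (m + l)) → ℝ =>
      F fun i => x (Fin.cast (Nat.add_assoc n m l) i) := hF.comp (by fun_prop)
  have h1 : (prolongHom M (tensorAssoc W V U)).1 (weilClass F hF _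
      (isGenerating_append (isGenerating_append ha hb) hc).1) =
      weilClass _ hF' _ (aug_append_inl_inr ha.1 (aug_append_inl_inr hb.1 hc.1)) := by
    have h2 := weilClass_comp hF (fun i => MvPolynomial.X (Fin.cast (Nat.add_assoc n m l) i))
      (fun i => by simp) _ (aug_append_inl_inr ha.1 (aug_append_inl_inr hb.1 hc.1))
      (by simpa using hF') (by simpa using aug_append_assoc ha.1 hb.1 hc.1)
    refine Eq.trans (weilClass_congr (fun _ => rfl) fun i => ?_) (h2.symm.trans
      (weilClass_congr (fun x => ?_) fun _ => rfl))
    · rw [MvPolynomial.aeval_X]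
      exact tensorAssoc_append a b c i
    · simp only [MvPolynomial.eval_X]
  have h3 := assoc_weilClass hE hF (isGenerating_append ha hb).1 hc.1
  have h4 := assoc_weilClass hE hF' ha.1 (aug_append_inl_inr hb.1 hc.1)
  rw [h1]
  refine (congrArg (prolongMap (applyLeft hE η V) U).1 h3).trans ?_
  have h5 := congrArg (fun z => (hE.assoc V U).1 ((prolongMap η (tensor V U)).1 z)) h4
  refine Eq.trans ?_ h5.symm
  have h6 := assoc_weilClass hE ((isPlot_weilClass_append hF' a ha.1).map η) hb.1 hc.1
  refine Eq.trans ?_ h6.symm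
  refine weilClass_congr (fun t => ?_) fun _ => rfl
  have h7 := congrArg (prolongMap η V).1 (assoc_weilClass hE (hF.append_left t) ha.1 hb.1)
  refine h7.trans (weilClass_congr (fun s => congrArg η.1 (weilClass_congr (fun x => ?_)
    fun _ => rfl)) fun _ => rfl)
  rw [Fin.append_assoc]
  rfl

end FrolicherSpace

/-! ### Homomorphisms between the algebras of cubes -/

namespace WeilAlgebra

variable {W V U : WeilAlgebra}

theorem toAlgHom_comp (φ : W ⟶ V) (ψ : V ⟶ U) (x : W) :
    toAlgHom (φ ≫ ψ) x = toAlgHom ψ (toAlgHom φ x) := rfl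

theorem toAlgHom_id (x : W) : toAlgHom (𝟙 W) x = x := rfl

theorem toAlgHom_lift {n : ℕ} {S : Fin n → Fin n → Prop} (w : Fin n → W)
    (hw : ∀ i j, (i = j ∨ S i j) → w i * w j = 0) (i : Fin n) :
    toAlgHom (lift (S := S) w hw) (coord i) = w i :=
  (Ideal.Quotient.lift_mk _ _ _).trans (MvPolynomial.aeval_X w i)

theorem toAlgHom_cubeLift {n : ℕ} (w : Fin n → W) (hw : ∀ i, w i * w i = 0) (i : Fin n) :
    toAlgHom (cubeLift w hw) (coord i) = w i :=
  toAlgHom_lift w _ i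

/-- Homomorphisms out of the algebra of an infinitesimal object are determined by the images of the
coordinates. -/
theorem infinitesimal_hom_ext {n : ℕ} {S : Fin n → Fin n → Prop} {φ ψ : infinitesimal n S ⟶ W}
    (h : ∀ i, toAlgHom φ (coord i) = toAlgHom ψ (coord i)) : φ = ψ :=
  Ideal.Quotient.algHom_ext ℝ (MvPolynomial.algHom_ext h)

/-- The inclusion `W → W ⊗ V`. -/
def inlHom (W V : WeilAlgebra) : W ⟶ tensor W V := Algebra.TensorProduct.includeLeft

/-- The inclusion `V → W ⊗ V`. -/
def inrHom (W V : WeilAlgebra) : V ⟶ tensor W V := Algebra.TensorProduct.includeRight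

theorem toAlgHom_inlHom (x : W) : toAlgHom (inlHom W V) x = inl x := rfl

theorem toAlgHom_inrHom (x : V) : toAlgHom (inrHom W V) x = inr x := rfl

/-- The homomorphism `W ⊗ V → W` induced by the augmentation of `V`. -/
def tensorLeft (W V : WeilAlgebra) : tensor W V ⟶ W :=
  Algebra.TensorProduct.lift (AlgHom.id ℝ W) ((Algebra.ofId ℝ W).comp V.aug)
    fun _ _ => mul_comm _ _

/-- The homomorphism `W ⊗ V → V` induced by the augmentation of `W`. -/
def tensorRight (W V : WeilAlgebra) : tensor W V ⟶ V :=
  Algebra.TensorProduct.lift ((Algebra.ofId ℝ V).comp W.aug) (AlgHom.id ℝ V)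
    fun _ _ => mul_comm _ _

theorem tensorLeft_inl (x : W) : toAlgHom (tensorLeft W V) (inl x) = x :=
  (Algebra.TensorProduct.lift_tmul _ _ (fun _ _ => Commute.all _ _) _ _).trans (by rw [map_one, mul_one]; rfl)

theorem tensorLeft_inr (x : V) :
    toAlgHom (tensorLeft W V) (inr x) = algebraMap ℝ W (V.aug x) :=
  (Algebra.TensorProduct.lift_tmul _ _ (fun _ _ => Commute.all _ _) _ _).trans (by rw [map_one, one_mul]; rfl)

theorem tensorRight_inl (x : W) :
    toAlgHom (tensorRight W V) (inl x) = algebraMap ℝ V (W.aug x) :=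
  (Algebra.TensorProduct.lift_tmul _ _ (fun _ _ => Commute.all _ _) _ _).trans (by rw [map_one, mul_one]; rfl)

theorem tensorRight_inr (x : V) : toAlgHom (tensorRight W V) (inr x) = x :=
  (Algebra.TensorProduct.lift_tmul _ _ (fun _ _ => Commute.all _ _) _ _).trans (by rw [map_one, one_mul]; rfl)

theorem aug_coord {n : ℕ} {S : Fin n → Fin n → Prop} (i : Fin n) :
    (infinitesimal n S).aug (coord i) = 0 :=
  (Ideal.Quotient.lift_mk _ _ _).trans (MvPolynomial.aeval_X _ i)

/-- Induced by the map `(d₁, …, dₘ) ↦ (d_{e(1)}, …, d_{e(n)})`. -/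
def cubeMap {n m : ℕ} (e : Fin n → Fin m) : cube n ⟶ cube m :=
  cubeLift (fun i => coord (e i)) fun _ => cube_coord_sq _

theorem cubeMap_coord {n m : ℕ} (e : Fin n → Fin m) (i : Fin n) :
    toAlgHom (cubeMap e) (coord i) = coord (e i) := toAlgHom_cubeLift _ _ _

theorem cubeMap_comp {n m l : ℕ} (e : Fin n → Fin m) (f : Fin m → Fin l) :
    cubeMap e ≫ cubeMap f = cubeMap (f ∘ e) :=
  infinitesimal_hom_ext fun i => by
    rw [toAlgHom_comp, cubeMap_coord, cubeMap_coord, cubeMap_coord, Function.comp_apply]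

/-- The sum of homomorphisms `cube p → cube p'` and `cube q → cube q'`. -/
def cubeSum {p q p' q' : ℕ} (φ : cube p ⟶ cube p') (ψ : cube q ⟶ cube q') :
    cube (p + q) ⟶ cube (p' + q') :=
  cubeLift (Fin.append (fun i => toAlgHom (φ ≫ cubeLeft p' q') (coord i))
      fun j => toAlgHom (ψ ≫ cubeRight p' q') (coord j)) fun k => by
    refine Fin.addCases (fun i => ?_) (fun j => ?_) k
    · rw [Fin.append_left, ← map_mul, cube_coord_sq, map_zero]
    · rw [Fin.append_right, ← map_mul, cube_coord_sq, map_zero]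

theorem cubeSum_castAdd {p q p' q' : ℕ} (φ : cube p ⟶ cube p') (ψ : cube q ⟶ cube q')
    (i : Fin p) : toAlgHom (cubeSum φ ψ) (coord (Fin.castAdd q i)) =
      toAlgHom (cubeLeft p' q') (toAlgHom φ (coord i)) := by
  unfold cubeSum
  rw [toAlgHom_cubeLift, Fin.append_left, toAlgHom_comp]

theorem cubeSum_natAdd {p q p' q' : ℕ} (φ : cube p ⟶ cube p') (ψ : cube q ⟶ cube q')
    (j : Fin q) : toAlgHom (cubeSum φ ψ) (coord (Fin.natAdd p j)) =
      toAlgHom (cubeRight p' q') (toAlgHom ψ (coord j)) := by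
  unfold cubeSum
  rw [toAlgHom_cubeLift, Fin.append_right, toAlgHom_comp]

theorem cubeSplit_castAdd {p : ℕ} (q : ℕ) (i : Fin p) :
    toAlgHom (cubeSplit p q) (coord (Fin.castAdd q i)) = inl (coord i) := by
  unfold cubeSplit
  rw [toAlgHom_cubeLift, Fin.append_left]

theorem cubeSplit_natAdd (p : ℕ) {q : ℕ} (j : Fin q) :
    toAlgHom (cubeSplit p q) (coord (Fin.natAdd p j)) = inr (coord j) := by
  unfold cubeSplit
  rw [toAlgHom_cubeLift, Fin.append_right]

theorem cubeSplitSwap_castAdd {p : ℕ} (q : ℕ) (i : Fin p) :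
    toAlgHom (cubeSplitSwap p q) (coord (Fin.castAdd q i)) = inr (coord i) := by
  unfold cubeSplitSwap
  rw [toAlgHom_cubeLift, Fin.append_left]

theorem cubeSplitSwap_natAdd (p : ℕ) {q : ℕ} (j : Fin q) :
    toAlgHom (cubeSplitSwap p q) (coord (Fin.natAdd p j)) = inl (coord j) := by
  unfold cubeSplitSwap
  rw [toAlgHom_cubeLift, Fin.append_right]

theorem cubeLeft_coord (p q : ℕ) (i : Fin p) :
    toAlgHom (cubeLeft p q) (coord i) = coord (Fin.castAdd q i) := toAlgHom_cubeLift _ _ _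

theorem cubeRight_coord (p q : ℕ) (i : Fin q) :
    toAlgHom (cubeRight p q) (coord i) = coord (Fin.natAdd p i) := toAlgHom_cubeLift _ _ _

theorem cubeLeft_cubeSplit (p q : ℕ) : cubeLeft p q ≫ cubeSplit p q = inlHom _ _ :=
  infinitesimal_hom_ext fun i => by
    rw [toAlgHom_comp, cubeLeft_coord, cubeSplit_castAdd, toAlgHom_inlHom]

theorem cubeRight_cubeSplit (p q : ℕ) : cubeRight p q ≫ cubeSplit p q = inrHom _ _ :=
  infinitesimal_hom_ext fun i => by
    rw [toAlgHom_comp, cubeRight_coord, cubeSplit_natAdd, toAlgHom_inrHom]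

theorem cubeLeft_cubeSplitSwap (p q : ℕ) : cubeLeft p q ≫ cubeSplitSwap p q = inrHom _ _ :=
  infinitesimal_hom_ext fun i => by
    rw [toAlgHom_comp, cubeLeft_coord, cubeSplitSwap_castAdd, toAlgHom_inrHom]

theorem cubeRight_cubeSplitSwap (p q : ℕ) : cubeRight p q ≫ cubeSplitSwap p q = inlHom _ _ :=
  infinitesimal_hom_ext fun i => by
    rw [toAlgHom_comp, cubeRight_coord, cubeSplitSwap_natAdd, toAlgHom_inlHom]

theorem cubeSum_cubeSplit {p q p' q' : ℕ} (φ : cube p ⟶ cube p') (ψ : cube q ⟶ cube q') :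
    cubeSum φ ψ ≫ cubeSplit p' q' = cubeSplit p q ≫ tensorMap φ ψ :=
  infinitesimal_hom_ext fun k => by
    refine Fin.addCases (fun i => ?_) (fun j => ?_) k
    · rw [toAlgHom_comp, toAlgHom_comp, cubeSum_castAdd, cubeSplit_castAdd, tensorMap_inl,
        ← toAlgHom_comp (cubeLeft p' q'), cubeLeft_cubeSplit, toAlgHom_inlHom]
    · rw [toAlgHom_comp, toAlgHom_comp, cubeSum_natAdd, cubeSplit_natAdd, tensorMap_inr,
        ← toAlgHom_comp (cubeRight p' q'), cubeRight_cubeSplit, toAlgHom_inrHom]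

theorem cubeSum_cubeSplitSwap {p q p' q' : ℕ} (φ : cube p ⟶ cube p') (ψ : cube q ⟶ cube q') :
    cubeSum φ ψ ≫ cubeSplitSwap p' q' = cubeSplitSwap p q ≫ tensorMap ψ φ :=
  infinitesimal_hom_ext fun k => by
    refine Fin.addCases (fun i => ?_) (fun j => ?_) k
    · rw [toAlgHom_comp, toAlgHom_comp, cubeSum_castAdd, cubeSplitSwap_castAdd, tensorMap_inr,
        ← toAlgHom_comp (cubeLeft p' q'), cubeLeft_cubeSplitSwap, toAlgHom_inrHom]
    · rw [toAlgHom_comp, toAlgHom_comp, cubeSum_natAdd, cubeSplitSwap_natAdd, tensorMap_inl,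
        ← toAlgHom_comp (cubeRight p' q'), cubeRight_cubeSplitSwap, toAlgHom_inlHom]

theorem cubeSplit_tensorLeft (p q : ℕ) :
    cubeSplit p q ≫ tensorLeft _ _ = cubeSplitSwap p q ≫ tensorRight _ _ :=
  infinitesimal_hom_ext fun k => by
    refine Fin.addCases (fun i => ?_) (fun j => ?_) k
    · rw [toAlgHom_comp, toAlgHom_comp, cubeSplit_castAdd, cubeSplitSwap_castAdd, tensorLeft_inl,
        tensorRight_inr]
    · rw [toAlgHom_comp, toAlgHom_comp, cubeSplit_natAdd, cubeSplitSwap_natAdd, tensorLeft_inr,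
        tensorRight_inl]

theorem cubeSplit_tensorRight (p q : ℕ) :
    cubeSplit p q ≫ tensorRight _ _ = cubeSplitSwap p q ≫ tensorLeft _ _ :=
  infinitesimal_hom_ext fun k => by
    refine Fin.addCases (fun i => ?_) (fun j => ?_) k
    · rw [toAlgHom_comp, toAlgHom_comp, cubeSplit_castAdd, cubeSplitSwap_castAdd, tensorLeft_inr,
        tensorRight_inl]
    · rw [toAlgHom_comp, toAlgHom_comp, cubeSplit_natAdd, cubeSplitSwap_natAdd, tensorLeft_inl,
        tensorRight_inr]

/-- The block rotation `(d, d', d'') ↦ (d', d'', d)` of the coordinates. -/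
def blockRotate (p q r : ℕ) : Fin (p + (q + r)) ≃ Fin (q + (r + p)) :=
  finAddFlip.trans (finCongr (Nat.add_assoc q r p))

theorem blockRotate_fst (p q r : ℕ) (i : Fin p) :
    blockRotate p q r (Fin.castAdd (q + r) i) = Fin.natAdd q (Fin.natAdd r i) := by
  ext; simp [blockRotate, Nat.add_assoc]

theorem blockRotate_snd (p q r : ℕ) (i : Fin q) :
    blockRotate p q r (Fin.natAdd p (Fin.castAdd r i)) = Fin.castAdd (r + p) i := by
  ext; simp [blockRotate]

theorem blockRotate_thd (p q r : ℕ) (i : Fin r) :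
    blockRotate p q r (Fin.natAdd p (Fin.natAdd q i)) = Fin.natAdd q (Fin.castAdd p i) := by
  ext; simp [blockRotate]

end WeilAlgebra

/-! ### Identities for the convolutions -/

namespace FrolicherSpace

open WeilAlgebra

variable {M : FrolicherSpace.{u}} (hE : M.WeilExponentiable) {W V U W' V' : WeilAlgebra}

theorem applyLeft_proj' (z : prolong M (tensor W V)) :
    (applyLeft hE (proj M W) V).1 z = (prolongHom M (tensorRight W V)).1 z :=
  applyLeft_proj hE V z _ tensorRight_inl tensorRight_inr

theorem proj_assoc (z : prolong M (tensor W V)) :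
    (proj (prolong M W) V).1 ((hE.assoc W V).1 z) = (prolongHom M (tensorLeft W V)).1 z := by
  obtain ⟨n, m, a, ha, b, hb, F, hF, rfl⟩ := exists_eq_weilClass_append z
  rw [assoc_weilClass hE hF ha hb]
  have h3 := weilClass_comp (W := W) hF
    (Fin.append MvPolynomial.X (fun _ : Fin m => (0 : MvPolynomial (Fin n) ℝ)))
    (fun i => by refine Fin.addCases (fun i => ?_) (fun j => ?_) i <;> simp) a ha
    (hF.comp (contDiff_pi.2 fun i => contDiff_mvPolynomial_eval _))
    (fun i => by refine Fin.addCases (fun i => ?_) (fun j => ?_) i <;> simp [ha])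
  refine Eq.trans (weilClass_congr (fun t => ?_) fun _ => rfl) (h3.trans
    (weilClass_congr (fun _ => rfl) fun i => ?_))
  · refine congrArg F (funext fun i => ?_)
    refine Fin.addCases (fun i => ?_) (fun j => ?_) i <;> simp
  · refine Fin.addCases (fun i => ?_) (fun j => ?_) i
    · refine Eq.trans ?_ (congrArg (toAlgHom (tensorLeft W V))
        (Fin.append_left (fun i => inl (a i)) (fun j => inr (b j)) i).symm)
      rw [Fin.append_left, MvPolynomial.aeval_X, tensorLeft_inl]
    · refine Eq.trans ?_ (congrArg (toAlgHom (tensorLeft W V))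
        (Fin.append_right (fun i => inl (a i)) (fun j => inr (b j)) j).symm)
      rw [Fin.append_right, map_zero, tensorLeft_inr, hb, map_zero]

theorem proj_applyLeft (η : prolong M W ⟶ M) (z : prolong M (tensor W V)) :
    (proj M V).1 ((applyLeft hE η V).1 z) = η.1 ((prolongHom M (tensorLeft W V)).1 z) := by
  rw [← proj_assoc hE]
  exact proj_prolongMap η _

theorem applyLeft_prolongHom_comp (φ : W' ⟶ W) (η : prolong M W ⟶ M)
    (z : prolong M (tensor W' V)) :
    (applyLeft hE (prolongHom M φ ≫ η) V).1 z =
      (applyLeft hE η V).1 ((prolongHom M (tensorMap φ (𝟙 V))).1 z) := by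
  rw [applyLeft_tensorMap, prolongHom_id]

theorem applyLeft_comp (η : prolong M W ⟶ M) (θ : prolong M V ⟶ M)
    (z : prolong M (tensor (tensor W V) U)) :
    (applyLeft hE (applyLeft hE η V ≫ θ) U).1 z =
      (applyLeft hE θ U).1 ((applyLeft hE η (tensor V U)).1
        ((prolongHom M (tensorAssoc W V U)).1 z)) := by
  refine Eq.trans ?_ (congrArg (prolongMap θ U).1 (prolongMap_applyLeft hE η z))
  exact (prolongMap_prolongMap _ _ _).symm

variable {p q r : ℕ}

/-- The convolutions are natural in the algebras of the cubes. -/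
theorem conv_precomp {p' q' : ℕ} (φ : cube p' ⟶ cube p) (ψ : cube q' ⟶ cube q)
    (η₁ : distr M p) (η₂ : distr M q) :
    conv hE ((precomp (prolongHom M φ) M).1 η₁) ((precomp (prolongHom M ψ) M).1 η₂) =
      (precomp (prolongHom M (cubeSum φ ψ)) M).1 (conv hE η₁ η₂) := by
  revert η₁ η₂
  intro (η₁ : prolong M (cube p) ⟶ M) (η₂ : prolong M (cube q) ⟶ M)
  refine Subtype.ext (funext fun z => ?_)
  change η₁.1 ((prolongHom M φ).1 ((applyLeft hE (prolongHom M ψ ≫ _) (cube p')).1 _)) =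
    η₁.1 ((applyLeft hE η₂ (cube p)).1 _)
  rw [← applyLeft_tensorMap, prolongHom_prolongHom, prolongHom_prolongHom, cubeSum_cubeSplitSwap]

theorem conv'_precomp {p' q' : ℕ} (φ : cube p' ⟶ cube p) (ψ : cube q' ⟶ cube q)
    (η₁ : distr M p) (η₂ : distr M q) :
    conv' hE ((precomp (prolongHom M φ) M).1 η₁) ((precomp (prolongHom M ψ) M).1 η₂) =
      (precomp (prolongHom M (cubeSum φ ψ)) M).1 (conv' hE η₁ η₂) := by
  revert η₁ η₂
  intro (η₁ : prolong M (cube p) ⟶ M) (η₂ : prolong M (cube q) ⟶ M)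
  refine Subtype.ext (funext fun z => ?_)
  change η₂.1 ((prolongHom M ψ).1 ((applyLeft hE (prolongHom M φ ≫ _) (cube q')).1 _)) =
    η₂.1 ((applyLeft hE η₁ (cube q)).1 _)
  rw [← applyLeft_tensorMap, prolongHom_prolongHom, prolongHom_prolongHom, cubeSum_cubeSplit]

/-- The homomorphism induced by `Dᵖ → Dᵖ⁺ᑫ`, `d ↦ (d, 0)`. -/
abbrev cubeFst (p q : ℕ) : cube (p + q) ⟶ cube p := cubeSplit p q ≫ tensorLeft _ _

/-- The homomorphism induced by `Dᑫ → Dᵖ⁺ᑫ`, `d ↦ (0, d)`. -/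
abbrev cubeSnd (p q : ℕ) : cube (p + q) ⟶ cube q := cubeSplit p q ≫ tensorRight _ _

theorem conv_dirac (η : distr M p) :
    conv hE η (dirac M q) = (precomp (prolongHom M (cubeFst p q)) M).1 η := by
  revert η
  intro (η : prolong M (cube p) ⟶ M)
  refine Subtype.ext (funext fun z => ?_)
  change η.1 ((applyLeft hE (proj M (cube q)) (cube p)).1 _) = η.1 _
  rw [applyLeft_proj', prolongHom_prolongHom, ← cubeSplit_tensorLeft]

theorem conv'_dirac (η : distr M p) :
    conv' hE η (dirac M q) = (precomp (prolongHom M (cubeFst p q)) M).1 η := by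
  revert η
  intro (η : prolong M (cube p) ⟶ M)
  refine Subtype.ext (funext fun z => ?_)
  change (proj M (cube q)).1 ((applyLeft hE η (cube q)).1 _) = η.1 _
  rw [proj_applyLeft, prolongHom_prolongHom]

theorem dirac_conv (η : distr M q) :
    conv hE (dirac M p) η = (precomp (prolongHom M (cubeSnd p q)) M).1 η := by
  revert η
  intro (η : prolong M (cube q) ⟶ M)
  refine Subtype.ext (funext fun z => ?_)
  change (proj M (cube p)).1 ((applyLeft hE η (cube p)).1 _) = η.1 _
  rw [proj_applyLeft, prolongHom_prolongHom, ← cubeSplit_tensorRight]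

theorem dirac_conv' (η : distr M q) :
    conv' hE (dirac M p) η = (precomp (prolongHom M (cubeSnd p q)) M).1 η := by
  revert η
  intro (η : prolong M (cube q) ⟶ M)
  refine Subtype.ext (funext fun z => ?_)
  change η.1 ((applyLeft hE (proj M (cube p)) (cube q)).1 _) = η.1 _
  rw [applyLeft_proj', prolongHom_prolongHom]

theorem precomp_dirac {p q : ℕ} (φ : cube p ⟶ cube q) :
    (precomp (prolongHom M φ) M).1 (dirac M q) = dirac M p :=
  Subtype.ext (funext fun z => proj_prolongHom φ z)

theorem conv'_dirac_dirac : conv' hE (dirac M p) (dirac M q) = dirac M (p + q) := by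
  rw [conv'_dirac, precomp_dirac]

/-- The convolutions `η₁ * (η₂ *~ η₃)` and `η₂ *~ (η₃ *~ η₁)` agree up to a rotation of the
coordinates. -/
theorem conv_conv' (η₁ : distr M p) (η₂ : distr M q) (η₃ : distr M r) :
    conv hE η₁ (conv' hE η₂ η₃) =
      (precomp (prolongHom M (cubeMap (blockRotate p q r))) M).1
        (conv' hE η₂ (conv' hE η₃ η₁)) := by
  revert η₁ η₂ η₃
  intro (η₁ : prolong M (cube p) ⟶ M) (η₂ : prolong M (cube q) ⟶ M) (η₃ : prolong M (cube r) ⟶ M)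
  refine Subtype.ext (funext fun z => ?_)
  -- both sides apply `η₂`, then `η₃`, then `η₁`
  change η₁.1 ((applyLeft hE (prolongHom M (cubeSplit q r) ≫ applyLeft hE η₂ (cube r) ≫ η₃)
    (cube p)).1 _) = η₁.1 ((applyLeft hE η₃ (cube p)).1 ((prolongHom M (cubeSplit r p)).1
      ((applyLeft hE η₂ (cube (r + p))).1 _)))
  rw [applyLeft_prolongHom_comp, applyLeft_comp, ← applyLeft_tensorMap_id]
  simp only [prolongHom_prolongHom]
  refine congrArg (fun φ => η₁.1 ((applyLeft hE η₃ (cube p)).1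
    ((applyLeft hE η₂ (tensor (cube r) (cube p))).1 ((prolongHom M φ).1 z))))
    (infinitesimal_hom_ext fun k => ?_)
  refine Fin.addCases (fun i => ?_) (fun j => Fin.addCases (fun j => ?_) (fun l => ?_) j) k <;>
  simp only [toAlgHom_comp, cubeMap_coord, blockRotate_fst, blockRotate_snd, blockRotate_thd,
    cubeSplit_castAdd, cubeSplit_natAdd, cubeSplitSwap_castAdd, cubeSplitSwap_natAdd,
    tensorMap_inl, tensorMap_inr, tensorAssoc_inl_inl, tensorAssoc_inl_inr, tensorAssoc_inr,
    toAlgHom_id]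

/-- The convolutions `η₁ *~ (η₂ * η₃)` and `η₂ * (η₃ * η₁)` agree up to a rotation of the
coordinates. -/
theorem conv'_conv (η₁ : distr M p) (η₂ : distr M q) (η₃ : distr M r) :
    conv' hE η₁ (conv hE η₂ η₃) =
      (precomp (prolongHom M (cubeMap (blockRotate p q r))) M).1
        (conv hE η₂ (conv hE η₃ η₁)) := by
  revert η₁ η₂ η₃
  intro (η₁ : prolong M (cube p) ⟶ M) (η₂ : prolong M (cube q) ⟶ M) (η₃ : prolong M (cube r) ⟶ M)
  refine Subtype.ext (funext fun z => ?_)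
  -- both sides apply `η₁`, then `η₃`, then `η₂`
  change η₂.1 ((applyLeft hE η₃ (cube q)).1 ((prolongHom M (cubeSplitSwap q r)).1
      ((applyLeft hE η₁ (cube (q + r))).1 _))) =
    η₂.1 ((applyLeft hE (prolongHom M (cubeSplitSwap r p) ≫ applyLeft hE η₁ (cube r) ≫ η₃)
    (cube q)).1 _)
  rw [applyLeft_prolongHom_comp, applyLeft_comp, ← applyLeft_tensorMap_id]
  simp only [prolongHom_prolongHom]
  refine congrArg (fun φ => η₂.1 ((applyLeft hE η₃ (cube q)).1
    ((applyLeft hE η₁ (tensor (cube r) (cube q))).1 ((prolongHom M φ).1 z))))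
    (infinitesimal_hom_ext fun k => ?_)
  refine Fin.addCases (fun i => ?_) (fun j => Fin.addCases (fun j => ?_) (fun l => ?_) j) k <;>
  simp only [toAlgHom_comp, cubeMap_coord, blockRotate_fst, blockRotate_snd, blockRotate_thd,
    cubeSplit_castAdd, cubeSplit_natAdd, cubeSplitSwap_castAdd, cubeSplitSwap_natAdd,
    tensorMap_inl, tensorMap_inr, tensorAssoc_inl_inl, tensorAssoc_inl_inr, tensorAssoc_inr,
    toAlgHom_id]

end FrolicherSpace

namespace FrolicherSpace

open WeilAlgebra

/-! ### Families of elements of Weil prolongations -/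

section Families

variable {X X' Y M : FrolicherSpace.{u}} {W V : WeilAlgebra}

/-- The constant elements, as a smooth map `X → X ⊗ W`. -/
def constHom (X : FrolicherSpace.{u}) (W : WeilAlgebra) : X ⟶ prolong X W :=
  ⟨fun x => weilConst x W, (isSmooth_iff_curves _).2 fun c hc => mem_curves_generate
    ⟨0, fun z => c z.1, fun χ hχ => ((X.mem_curves_iff c).1 hc χ hχ).comp contDiff_fst, Fin.elim0,
      fun i => i.elim0, fun _ => rfl⟩⟩

/-- Composition `[Y → X] → [Y → X']` with `h : X → X'`. -/
def postcomp (Y : FrolicherSpace.{u}) (h : X ⟶ X') : exp Y X ⟶ exp Y X' :=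
  ⟨fun η => (show Y ⟶ X from η) ≫ h, isSmooth_generate _ fun _ hc =>
    mem_curves_generate fun s hs y hy => map_mem_curves h (hc s hs y hy)⟩

theorem isSmooth_evaluate (z : prolong (exp Y X) W) :
    IsSmooth fun y : Y => (prolongMap (evalAt X y) W).1 z := by
  refine (isSmooth_iff_curves _).2 fun y hy => ?_
  obtain ⟨⟨n, f, hf, a, ha⟩, rfl⟩ := Quotient.mk_surjective z
  have h : IsPlot X fun z : ℝ × (Fin n → ℝ) => (f z.2).1 (y z.1) :=
    isPlot_of_curves fun d hd => apply_mem_curves (hf.comp_curve hd.snd) (curves_comp hy hd.fst)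
  exact weilClass_mem_curves h a ha

/-- The smooth map `Y → X ⊗ W` given by an element of `[Y → X] ⊗ W`. -/
def evaluate (z : prolong (exp Y X) W) : Y ⟶ prolong X W := ⟨_, isSmooth_evaluate z⟩

theorem evaluate_prolongHom (φ : W ⟶ V) (z : prolong (exp Y X) W) :
    evaluate ((prolongHom _ φ).1 z) = evaluate z ≫ prolongHom X φ :=
  Subtype.ext (funext fun _ => prolongMap_prolongHom _ φ z)

theorem evaluate_postcomp (h : X ⟶ X') (z : prolong (exp Y X) W) (y : Y) :
    (evaluate ((prolongMap (postcomp Y h) W).1 z)).1 y =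
      (prolongMap h W).1 ((evaluate z).1 y) := by
  refine (prolongMap_prolongMap _ _ z).trans ?_
  exact (prolongMap_prolongMap (evalAt X y) h z).symm

theorem prolongMap_id (z : prolong X W) : (prolongMap (𝟙 X) W).1 z = z := by
  obtain ⟨x, rfl⟩ := Quotient.mk_surjective z
  rfl

theorem toExpPoint_evalAt (z : prolong (exp point X) W) :
    (prolongMap (toExpPoint X) W).1
      ((prolongMap (evalAt X (PUnit.unit : PUnit.{u + 1})) W).1 z) = z := by
  have h : evalAt X (PUnit.unit : PUnit.{u + 1}) ≫ toExpPoint X = 𝟙 (exp point X) := rfl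
  rw [prolongMap_prolongMap, h, prolongMap_id]

theorem evalAt_toExpPoint (z : prolong X W) :
    (prolongMap (evalAt X (PUnit.unit : PUnit.{u + 1})) W).1
      ((prolongMap (toExpPoint X) W).1 z) = z := by
  have h : toExpPoint X ≫ evalAt X (PUnit.unit : PUnit.{u + 1}) = 𝟙 X := rfl
  rw [prolongMap_prolongMap, h, prolongMap_id]

variable (hE : M.WeilExponentiable)

theorem assoc_injective : Function.Injective (hE.assoc W V).1 := by
  intro z z' h
  have h1 := congrArg (prolongMap (toExpPoint _) V).1 h
  have h2 : (hE point W V).choose.inv.1 ((toExpPoint _).1 z) =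
      (hE point W V).choose.inv.1 ((toExpPoint _).1 z') :=
    (toExpPoint_evalAt _).symm.trans (h1.trans (toExpPoint_evalAt _))
  have h3 := congrArg (hE point W V).choose.hom.1 h2
  have h4 : ∀ w, (hE point W V).choose.hom.1 ((hE point W V).choose.inv.1 w) = w :=
    fun w => congrArg (fun f => f.1 w) (hE point W V).choose.inv_hom_id
  rw [h4, h4] at h3
  exact congrArg (fun w => (w : exp point _).1 (PUnit.unit : PUnit.{u + 1})) h3

theorem assoc_surjective : Function.Surjective (hE.assoc W V).1 := by
  intro e
  let w := (hE point W V).choose.hom.1 ((prolongMap (toExpPoint _) V).1 e)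
  refine ⟨w.1 (PUnit.unit : PUnit.{u + 1}), ?_⟩
  have h4 : (hE point W V).choose.inv.1 w = (prolongMap (toExpPoint _) V).1 e :=
    congrArg (fun f => f.1 ((prolongMap (toExpPoint _) V).1 e)) (hE point W V).choose.hom_inv_id
  exact (congrArg (prolongMap (evalAt _ (PUnit.unit : PUnit.{u + 1})) V).1 h4).trans
    (evalAt_toExpPoint e)

/-- The isomorphism of Weil exponentiability for `Y`, evaluated at a point, is inverse to the
identification for the one-point space. -/
theorem assoc_weilExponentiable (Y : FrolicherSpace.{u}) (W V : WeilAlgebra)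
    (z : prolong (exp Y (prolong M W)) V) (y : Y) :
    (hE.assoc W V).1 (((hE Y W V).choose.hom.1 z).1 y) = (evaluate z).1 y := by
  obtain ⟨x, hx⟩ := assoc_surjective hE ((evaluate z).1 y)
  obtain ⟨n, m, a, ha, b, hb, F, hF, rfl⟩ := exists_eq_weilClass_append x
  rw [assoc_weilClass hE hF ha hb] at hx
  have h := (hE Y W V).choose_spec z y n m F hF a ha b hb (aug_append_inl_inr ha hb) _
    (isPlot_weilClass_append hF a ha) hx.symm
  rw [h, assoc_weilClass hE hF ha hb, hx]

/-- An element of `[Y → M] ⊗ W` is determined by its values. Weil exponentiability is used for the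
algebra `ℝ = cube 0` in place of the first factor, with `M` embedded as a retract of `M ⊗ ℝ`. -/
theorem evaluate_injective (hE : M.WeilExponentiable) :
    Function.Injective (evaluate : prolong (exp Y M) W → (Y ⟶ prolong M W)) := by
  intro z z' h
  let i := prolongMap (postcomp Y (constHom M (cube 0))) W
  have h1 : (hE Y (cube 0) W).choose.hom.1 (i.1 z) = (hE Y (cube 0) W).choose.hom.1 (i.1 z') := by
    refine Subtype.ext (funext fun y => assoc_injective hE ?_)
    rw [assoc_weilExponentiable, assoc_weilExponentiable, evaluate_postcomp, evaluate_postcomp, h]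
  have h2 := congrArg (hE Y (cube 0) W).choose.inv.1 h1
  have h3 : ∀ w, (hE Y (cube 0) W).choose.inv.1 ((hE Y (cube 0) W).choose.hom.1 w) = w :=
    fun w => congrArg (fun f => f.1 w) (hE Y (cube 0) W).choose.hom_inv_id
  rw [h3, h3] at h2
  have h4 : ∀ w, (prolongMap (postcomp Y (proj M (cube 0))) W).1 (i.1 w) = w := fun w =>
    (prolongMap_prolongMap _ _ w).trans (prolongMap_id w)
  rw [← h4 z, h2, h4]

/-- Every smooth map `Y → M ⊗ W` is given by an element of `[Y → M] ⊗ W`. -/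
theorem evaluate_surjective (hE : M.WeilExponentiable) :
    Function.Surjective (evaluate : prolong (exp Y M) W → (Y ⟶ prolong M W)) := by
  intro g
  let g' : exp Y (prolong M (tensor (cube 0) W)) := g ≫ prolongHom M (inrHom (cube 0) W)
  let w := (hE Y (cube 0) W).choose.inv.1 g'
  have hw : (hE Y (cube 0) W).choose.hom.1 w = g' :=
    congrArg (fun f => f.1 g') (hE Y (cube 0) W).choose.inv_hom_id
  refine ⟨(prolongMap (postcomp Y (proj M (cube 0))) W).1 w, Subtype.ext (funext fun y => ?_)⟩
  rw [evaluate_postcomp, ← assoc_weilExponentiable hE, hw]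
  refine (applyLeft_proj' hE _).trans ?_
  refine (prolongHom_prolongHom _ _ (g.1 y)).trans ?_
  have h : inrHom (cube 0) W ≫ tensorRight (cube 0) W = 𝟙 W :=
    AlgHom.ext fun x => tensorRight_inr x
  rw [h, prolongHom_id]

/-- The spaces `[Y → M]` inherit the preservation of pullbacks of Weil algebras from `M`. -/
theorem exists_of_isPullback (hE : M.WeilExponentiable) (hM : M.Microlinear)
    {P A B C : WeilAlgebra} {f : P ⟶ A} {g : P ⟶ B}
    {h : A ⟶ C} {k : B ⟶ C} (sq : IsPullback f g h k) (x : prolong (exp Y M) A)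
    (y : prolong (exp Y M) B) (hxy : (prolongHom _ h).1 x = (prolongHom _ k).1 y) :
    ∃ z : prolong (exp Y M) P, (prolongHom _ f).1 z = x ∧ (prolongHom _ g).1 z = y := by
  have := hM Limits.WalkingCospan
  have sq' := sq.map (weilFunctor M)
  have hw : evaluate x ≫ (weilFunctor M).map h = evaluate y ≫ (weilFunctor M).map k := by
    have := congrArg evaluate hxy
    rwa [evaluate_prolongHom, evaluate_prolongHom] at this
  obtain ⟨z, hz⟩ := evaluate_surjective hE (sq'.lift _ _ hw)
  refine ⟨z, evaluate_injective hE ?_, evaluate_injective hE ?_⟩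
  · rw [evaluate_prolongHom, hz]
    exact sq'.lift_fst _ _ hw
  · rw [evaluate_prolongHom, hz]
    exact sq'.lift_snd _ _ hw

end Families

theorem prolongHom_of_aug {X : FrolicherSpace.{u}} {W V : WeilAlgebra} (φ : W ⟶ V)
    (h : ∀ x : W, toAlgHom φ x = algebraMap ℝ V (W.aug x)) (z : prolong X W) :
    (prolongHom X φ).1 z = weilConst ((proj X W).1 z) V := by
  obtain ⟨⟨n, f, hf, a, ha⟩, rfl⟩ := Quotient.mk_surjective z
  have h0 : ∀ i : Fin n, V.aug ((fun _ => 0 : Fin n → V) i) = 0 := fun _ => map_zero _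
  have h1 := weilClass_comp (W := V) hf (fun _ => (0 : MvPolynomial (Fin n) ℝ))
    (fun i => map_zero _) (fun _ => (0 : V)) h0
    (hf.comp (contDiff_pi.2 fun i => contDiff_mvPolynomial_eval _))
    (fun i => by rw [map_zero, map_zero])
  refine Eq.trans (weilClass_congr (fun _ => rfl) fun i => ?_) (h1.symm.trans
    (Eq.trans (weilClass_congr (fun _ => ?_) fun _ => rfl) (weilClass_const _ _ h0)))
  · rw [map_zero, h]
    exact (congrArg _ (ha i)).trans (map_zero _)
  · exact congrArg f (funext fun i => map_zero _)

end FrolicherSpace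

/-! ### Algebras of infinitesimal objects -/

namespace WeilAlgebra

variable {W V U : WeilAlgebra}

theorem infinitesimal_induction {n : ℕ} {S : Fin n → Fin n → Prop} {P : infinitesimal n S → Prop}
    (h0 : ∀ α : ℝ, P (algebraMap ℝ _ α)) (hadd : ∀ x y, P x → P y → P (x + y))
    (hmul : ∀ x i, P x → P (x * coord i)) (x : infinitesimal n S) : P x := by
  obtain ⟨f, rfl⟩ := Ideal.Quotient.mk_surjective x
  induction f using MvPolynomial.induction_on with
  | C a => exact h0 a
  | add f g hf hg => rw [map_add]; exact hadd _ _ hf hg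
  | mul_X f i hf => rw [map_mul]; exact hmul _ i hf

/-- The homomorphism to the dual numbers given by the `i`-th coordinate axis. -/
def toDual {n : ℕ} (S : Fin n → Fin n → Prop) (i : Fin n) :
    infinitesimal n S →ₐ[ℝ] DualNumber ℝ :=
  Ideal.Quotient.liftₐ (relIdeal n S)
    (MvPolynomial.aeval fun j => if j = i then DualNumber.eps else 0) (by
    intro f hf
    have : relIdeal n S ≤ RingHom.ker (MvPolynomial.aeval (R := ℝ)
        fun j => if j = i then (DualNumber.eps : DualNumber ℝ) else 0) := by
      refine Ideal.span_le.2 ?_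
      rintro _ ⟨j, k, _, rfl⟩
      simp only [SetLike.mem_coe, RingHom.mem_ker, map_mul, MvPolynomial.aeval_X]
      split_ifs <;> simp
    exact this hf)

theorem toDual_coord {n : ℕ} (S : Fin n → Fin n → Prop) (i j : Fin n) :
    toDual S i (coord j) = if j = i then DualNumber.eps else 0 :=
  (Ideal.Quotient.lift_mk _ _ _).trans (MvPolynomial.aeval_X _ j)

/-- The coefficient of `dᵢ`. -/
def coeff {n : ℕ} {S : Fin n → Fin n → Prop} (i : Fin n) : infinitesimal n S →ₗ[ℝ] ℝ :=
  (TrivSqZeroExt.sndHom ℝ ℝ).comp (toDual S i).toLinearMap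

theorem coeff_coord {n : ℕ} {S : Fin n → Fin n → Prop} (i j : Fin n) :
    coeff i (coord j : infinitesimal n S) = if j = i then 1 else 0 := by
  change TrivSqZeroExt.snd (toDual S i (coord j)) = _
  rw [toDual_coord]
  split_ifs
  · exact DualNumber.snd_eps
  · rfl

theorem coeff_one {n : ℕ} {S : Fin n → Fin n → Prop} (i : Fin n) :
    coeff i (1 : infinitesimal n S) = 0 := by
  change TrivSqZeroExt.snd (toDual S i 1) = _
  rw [map_one]
  rfl

/-- The map `W_D ⊗ V → V` which takes the coefficient of `d`. -/
def coeffLeft (V : WeilAlgebra) : tensor (cube 1) V →ₗ[ℝ] V :=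
  (TensorProduct.lid ℝ V).toLinearMap ∘ₗ
    TensorProduct.map (coeff (S := fun _ _ => False) (0 : Fin 1)) LinearMap.id

theorem coeffLeft_tmul (x : cube 1) (y : V) :
    coeffLeft V (x ⊗ₜ[ℝ] y : cube 1 ⊗[ℝ] V) = coeff 0 x • y := rfl

theorem inl_mul_inr (x : W) (y : V) : (inl x * inr y : tensor W V) = (x ⊗ₜ[ℝ] y : W ⊗[ℝ] V) :=
  (Algebra.TensorProduct.tmul_mul_tmul _ _ _ _).trans (by rw [mul_one, one_mul])

theorem tensor_induction {P : tensor W V → Prop} (h0 : P 0)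
    (ht : ∀ (x : W) (y : V), P (inl x * inr y)) (ha : ∀ x y, P x → P y → P (x + y))
    (z : tensor W V) : P z :=
  TensorProduct.induction_on (motive := fun z : W ⊗[ℝ] V => P z) z h0
    (fun x y => inl_mul_inr x y ▸ ht x y) ha

theorem coeffLeft_inl_mul_inr (x : cube 1) (y : V) :
    coeffLeft V (inl x * inr y) = coeff 0 x • y := by
  rw [inl_mul_inr]
  exact coeffLeft_tmul x y

theorem toAlgHom_coeffLeft (φ : V ⟶ U) (z : tensor (cube 1) V) :
    toAlgHom φ (coeffLeft V z) = coeffLeft U (toAlgHom (tensorMap (𝟙 (cube 1)) φ) z) := by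
  induction z using tensor_induction with
  | h0 => simp only [map_zero]
  | ht x y => rw [coeffLeft_inl_mul_inr, map_mul, tensorMap_inl, tensorMap_inr,
      coeffLeft_inl_mul_inr, map_smul, toAlgHom_id]
  | ha x y hx hy => simp only [map_add, hx, hy]

theorem exists_cube_one (x : cube 1) :
    ∃ α β : ℝ, x = α • (1 : cube 1) + β • coord 0 := by
  induction x using infinitesimal_induction with
  | h0 α => exact ⟨α, 0, by rw [zero_smul, add_zero, Algebra.algebraMap_eq_smul_one]⟩
  | hadd x y hx hy =>
    obtain ⟨α, β, rfl⟩ := hx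
    obtain ⟨α', β', rfl⟩ := hy
    exact ⟨α + α', β + β', by simp only [add_smul]; abel⟩
  | hmul x i hx =>
    obtain ⟨α, β, rfl⟩ := hx
    refine ⟨0, α, ?_⟩
    rw [Subsingleton.elim i 0, add_mul, smul_mul_assoc, smul_mul_assoc, cube_coord_sq, one_mul,
      smul_zero, zero_smul, zero_add, add_zero]

theorem axes_coord_mul (i j : Fin 2) : (coord i * coord j : axes) = 0 :=
  coord_mul_coord (Or.inr trivial)

theorem exists_axes (x : axes) :
    ∃ α β γ : ℝ, x = α • (1 : axes) + β • coord 0 + γ • coord 1 := by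
  induction x using infinitesimal_induction with
  | h0 α => exact ⟨α, 0, 0, by simp [Algebra.algebraMap_eq_smul_one]⟩
  | hadd x y hx hy =>
    obtain ⟨α, β, γ, rfl⟩ := hx
    obtain ⟨α', β', γ', rfl⟩ := hy
    exact ⟨α + α', β + β', γ + γ', by simp only [add_smul]; abel⟩
  | hmul x i hx =>
    obtain ⟨α, β, γ, rfl⟩ := hx
    have h : (α • (1 : axes) + β • coord 0 + γ • coord 1) * coord i = α • coord i := by
      simp only [add_mul, smul_mul_assoc, one_mul, axes_coord_mul, smul_zero, add_zero]
    rw [h]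
    fin_cases i
    · exact ⟨0, α, 0, by simp⟩
    · exact ⟨0, 0, α, by simp⟩

theorem exists_cube_two (x : cube 2) : ∃ α β γ δ : ℝ,
    x = α • (1 : cube 2) + β • coord 0 + γ • coord 1 + δ • (coord 0 * coord 1) := by
  have h00 := cube_coord_sq (0 : Fin 2)
  have h11 := cube_coord_sq (1 : Fin 2)
  induction x using infinitesimal_induction with
  | h0 α => exact ⟨α, 0, 0, 0, by simp [Algebra.algebraMap_eq_smul_one]⟩
  | hadd x y hx hy =>
    obtain ⟨α, β, γ, δ, rfl⟩ := hx
    obtain ⟨α', β', γ', δ', rfl⟩ := hy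
    exact ⟨α + α', β + β', γ + γ', δ + δ', by simp only [add_smul]; abel⟩
  | hmul x i hx =>
    obtain ⟨α, β, γ, δ, rfl⟩ := hx
    have h0 : (coord 0 * coord 1 * coord 0 : cube 2) = 0 := by rw [mul_right_comm, h00, zero_mul]
    have h1 : (coord 0 * coord 1 * coord 1 : cube 2) = 0 := by rw [mul_assoc, h11, mul_zero]
    fin_cases i
    · refine ⟨0, α, 0, γ, ?_⟩
      change _ * (coord 0 : cube 2) = _
      simp only [add_mul, smul_mul_assoc, one_mul, h00, h0, mul_comm (coord 1 : cube 2), smul_zero,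
        zero_smul, add_zero, zero_add]
    · refine ⟨0, 0, α, β, ?_⟩
      change _ * (coord 1 : cube 2) = _
      simp only [add_mul, smul_mul_assoc, one_mul, h11, h1, smul_zero, zero_smul, add_zero,
        zero_add]

theorem exists_squarePlus (x : squarePlus) : ∃ α β γ δ ε : ℝ,
    x = α • (1 : squarePlus) + β • coord 0 + γ • coord 1 + δ • (coord 0 * coord 1) +
      ε • coord 2 := by
  have h00 : (coord 0 * coord 0 : squarePlus) = 0 := coord_mul_coord (Or.inl rfl)
  have h11 : (coord 1 * coord 1 : squarePlus) = 0 := coord_mul_coord (Or.inl rfl)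
  have h22 : (coord 2 * coord 2 : squarePlus) = 0 := coord_mul_coord (Or.inl rfl)
  have h02 : (coord 0 * coord 2 : squarePlus) = 0 := coord_mul_coord (Or.inr (by decide))
  have h12 : (coord 1 * coord 2 : squarePlus) = 0 := coord_mul_coord (Or.inr (by decide))
  have h20 : (coord 2 * coord 0 : squarePlus) = 0 := (mul_comm _ _).trans h02
  have h21 : (coord 2 * coord 1 : squarePlus) = 0 := (mul_comm _ _).trans h12
  induction x using infinitesimal_induction with
  | h0 α => exact ⟨α, 0, 0, 0, 0, by simp [Algebra.algebraMap_eq_smul_one]⟩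
  | hadd x y hx hy =>
    obtain ⟨α, β, γ, δ, ε, rfl⟩ := hx
    obtain ⟨α', β', γ', δ', ε', rfl⟩ := hy
    exact ⟨α + α', β + β', γ + γ', δ + δ', ε + ε', by simp only [add_smul]; abel⟩
  | hmul x i hx =>
    obtain ⟨α, β, γ, δ, ε, rfl⟩ := hx
    have h0 : (coord 0 * coord 1 * coord 0 : squarePlus) = 0 := by
      rw [mul_right_comm, h00, zero_mul]
    have h1 : (coord 0 * coord 1 * coord 1 : squarePlus) = 0 := by rw [mul_assoc, h11, mul_zero]
    have h2 : (coord 0 * coord 1 * coord 2 : squarePlus) = 0 := by rw [mul_assoc, h12, mul_zero]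
    fin_cases i
    · refine ⟨0, α, 0, γ, 0, ?_⟩
      change _ * (coord 0 : squarePlus) = _
      simp only [add_mul, smul_mul_assoc, one_mul, h00, h0, h20, mul_comm (coord 1 : squarePlus),
        smul_zero, zero_smul, add_zero, zero_add]
    · refine ⟨0, 0, α, β, 0, ?_⟩
      change _ * (coord 1 : squarePlus) = _
      simp only [add_mul, smul_mul_assoc, one_mul, h11, h1, h21, smul_zero, zero_smul, add_zero,
        zero_add]
    · refine ⟨0, 0, 0, 0, α, ?_⟩
      change _ * (coord 2 : squarePlus) = _
      simp only [add_mul, smul_mul_assoc, one_mul, h22, h02, h12, h2, smul_zero, zero_smul,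
        add_zero, zero_add]

/-- The coefficient of `d₁ d₂` in the algebra of `D²`. -/
def coeffTop : cube 2 →ₗ[ℝ] ℝ :=
  coeff (0 : Fin 1) ∘ₗ coeffLeft (cube 1) ∘ₗ
    (toAlgHom (cubeSplit 1 1 : cube 2 ⟶ tensor (cube 1) (cube 1))).toLinearMap

theorem coeffTop_apply (x : cube 2) :
    coeffTop x = coeff (0 : Fin 1) (coeffLeft (cube 1) (toAlgHom (cubeSplit 1 1) x)) := rfl

theorem cubeSplit_coord_zero :
    toAlgHom (cubeSplit 1 1 : cube 2 ⟶ _) (coord 0) = inl (coord 0) := cubeSplit_castAdd 1 0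

theorem cubeSplit_coord_one :
    toAlgHom (cubeSplit 1 1 : cube 2 ⟶ _) (coord 1) = inr (coord 0) := cubeSplit_natAdd 1 0

theorem coeffTop_one : coeffTop 1 = 0 := by
  rw [coeffTop_apply, map_one]
  have : (1 : tensor (cube 1) (cube 1)) = inl 1 * inr 1 := by rw [inl_mul_inr]; rfl
  rw [this, coeffLeft_inl_mul_inr, coeff_one, zero_smul, map_zero]

theorem coeffTop_coord_zero : coeffTop (coord 0) = 0 := by
  rw [coeffTop_apply, cubeSplit_coord_zero]
  have : (inl (coord 0) : tensor (cube 1) (cube 1)) = inl (coord 0) * inr 1 := by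
    rw [inl_mul_inr]; rfl
  rw [this, coeffLeft_inl_mul_inr, map_smul, coeff_one, smul_zero]

theorem coeffTop_coord_one : coeffTop (coord 1) = 0 := by
  rw [coeffTop_apply, cubeSplit_coord_one]
  have : (inr (coord 0) : tensor (cube 1) (cube 1)) = inl 1 * inr (coord 0) := by
    rw [inl_mul_inr]; rfl
  rw [this, coeffLeft_inl_mul_inr, coeff_one, zero_smul, map_zero]

theorem coeffTop_coord_mul_coord : coeffTop (coord 0 * coord 1) = 1 := by
  rw [coeffTop_apply, map_mul, cubeSplit_coord_zero, cubeSplit_coord_one, coeffLeft_inl_mul_inr,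
    map_smul, coeff_coord]
  simp

/-! ### Pullback squares of Weil algebras -/

theorem isPullback_of_forall {P A B C : WeilAlgebra} {f : P ⟶ A} {g : P ⟶ B} {h : A ⟶ C}
    {k : B ⟶ C} (w : f ≫ h = g ≫ k)
    (hinj : ∀ x y, toAlgHom f x = toAlgHom f y → toAlgHom g x = toAlgHom g y → x = y)
    (hsurj : ∀ a b, toAlgHom h a = toAlgHom k b → ∃ x, toAlgHom f x = a ∧ toAlgHom g x = b) :
    IsPullback f g h k := by
  let E : Subalgebra ℝ (A × B) := AlgHom.equalizer
    ((toAlgHom h).comp (AlgHom.fst ℝ A B)) ((toAlgHom k).comp (AlgHom.snd ℝ A B))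
  let e₀ : P →ₐ[ℝ] E := ((toAlgHom f).prod (toAlgHom g)).codRestrict E
    fun x => AlgHom.congr_fun w x
  have he : Function.Bijective e₀ := by
    constructor
    · intro x y hxy
      have h1 : (toAlgHom f x, toAlgHom g x) = (toAlgHom f y, toAlgHom g y) :=
        congrArg Subtype.val hxy
      exact hinj x y (congrArg Prod.fst h1) (congrArg Prod.snd h1)
    · rintro ⟨⟨a, b⟩, hab⟩
      obtain ⟨x, rfl, rfl⟩ := hsurj a b hab
      exact ⟨x, rfl⟩
  let e : P ≃ₐ[ℝ] E := AlgEquiv.ofBijective e₀ he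
  refine ⟨⟨w⟩, ⟨Limits.PullbackCone.IsLimit.mk w (fun s => ?_) (fun s => ?_) (fun s => ?_)
    (fun s m h1 h2 => ?_)⟩⟩
  · exact e.symm.toAlgHom.comp
      (((toAlgHom s.fst).prod (toAlgHom s.snd)).codRestrict E
        fun x => AlgHom.congr_fun s.condition x)
  · refine AlgHom.ext fun x => ?_
    have := congrArg Subtype.val (e.apply_symm_apply
      ⟨(toAlgHom s.fst x, toAlgHom s.snd x), AlgHom.congr_fun s.condition x⟩)
    exact congrArg Prod.fst this
  · refine AlgHom.ext fun x => ?_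
    have := congrArg Subtype.val (e.apply_symm_apply
      ⟨(toAlgHom s.fst x, toAlgHom s.snd x), AlgHom.congr_fun s.condition x⟩)
    exact congrArg Prod.snd this
  · refine AlgHom.ext fun x => ?_
    have := congrArg Subtype.val (e.apply_symm_apply
      ⟨(toAlgHom s.fst x, toAlgHom s.snd x), AlgHom.congr_fun s.condition x⟩)
    exact hinj _ _ ((AlgHom.congr_fun h1 x).trans (congrArg Prod.fst this).symm)
      ((AlgHom.congr_fun h2 x).trans (congrArg Prod.snd this).symm)

/-- Induced by the inclusion of the origin. -/
def cubeZero : cube 1 ⟶ cube 0 := cubeLift (fun _ => 0) fun _ => zero_mul 0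

theorem cubeZero_apply (x : cube 1) : toAlgHom cubeZero x = algebraMap ℝ _ ((cube 1).aug x) := by
  have h : cubeZero = ((Algebra.ofId ℝ (cube 0)).comp (cube 1).aug : cube 1 ⟶ cube 0) :=
    infinitesimal_hom_ext fun i => by
      refine (toAlgHom_cubeLift _ _ i).trans ?_
      exact ((congrArg (algebraMap ℝ (cube 0)) (aug_coord i)).trans (map_zero _)).symm
  rw [h]
  rfl

theorem algebraMap_injective (W : WeilAlgebra) : Function.Injective (algebraMap ℝ W) := by
  intro x y h
  have := congrArg W.aug h
  simpa using this

/-- Induced by the inclusion `D(2) → D²`. -/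
def cubeRestrict : cube 2 ⟶ axes := cubeLift coord fun i => axes_coord_mul i i

theorem axesIncl_apply (i : Fin 2) (α β γ : ℝ) :
    toAlgHom (axesIncl i) (α • (1 : axes) + β • coord 0 + γ • coord 1) =
      α • 1 + (if i = 0 then β else γ) • coord 0 := by
  unfold axesIncl
  simp only [map_add, map_smul, map_one, toAlgHom_lift]
  fin_cases i <;> simp

theorem axesDiag_apply (α β γ : ℝ) :
    toAlgHom axesDiag (α • (1 : axes) + β • coord 0 + γ • coord 1) =
      α • 1 + (β + γ) • coord 0 := by
  unfold axesDiag
  simp only [map_add, map_smul, map_one, toAlgHom_lift, add_smul, add_assoc]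

theorem cubeRestrict_apply (α β γ δ : ℝ) :
    toAlgHom cubeRestrict (α • (1 : cube 2) + β • coord 0 + γ • coord 1 +
      δ • (coord 0 * coord 1)) = α • 1 + β • coord 0 + γ • coord 1 := by
  unfold cubeRestrict
  simp only [map_add, map_smul, map_one, map_mul, toAlgHom_cubeLift, axes_coord_mul, smul_zero,
    add_zero]

theorem squarePlusPhi_apply (α β γ δ ε : ℝ) :
    toAlgHom squarePlusPhi (α • (1 : squarePlus) + β • coord 0 + γ • coord 1 +
      δ • (coord 0 * coord 1) + ε • coord 2) =
      α • 1 + β • coord 0 + γ • coord 1 + δ • (coord 0 * coord 1) := by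
  unfold squarePlusPhi
  simp only [map_add, map_smul, map_one, map_mul, toAlgHom_lift]
  simp

theorem squarePlusPsi_apply (α β γ δ ε : ℝ) :
    toAlgHom squarePlusPsi (α • (1 : squarePlus) + β • coord 0 + γ • coord 1 +
      δ • (coord 0 * coord 1) + ε • coord 2) =
      α • 1 + β • coord 0 + γ • coord 1 + (δ + ε) • (coord 0 * coord 1) := by
  unfold squarePlusPsi
  simp only [map_add, map_smul, map_one, map_mul, toAlgHom_lift]
  simp [add_smul, add_assoc]

theorem squarePlusLast_apply (α β γ δ ε : ℝ) :
    toAlgHom squarePlusLast (α • (1 : squarePlus) + β • coord 0 + γ • coord 1 +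
      δ • (coord 0 * coord 1) + ε • coord 2) = α • 1 + ε • coord 0 := by
  unfold squarePlusLast
  simp only [map_add, map_smul, map_one, map_mul, toAlgHom_lift]
  simp

theorem aug_cube_one (α β : ℝ) : (cube 1).aug (α • (1 : cube 1) + β • coord 0) = α := by
  rw [map_add, map_smul, map_smul, map_one, aug_coord]
  simp

theorem coeff_cube_one (α β : ℝ) : coeff (0 : Fin 1) (α • (1 : cube 1) + β • coord 0) = β := by
  rw [map_add, map_smul, map_smul, coeff_one, coeff_coord]
  simp

theorem cube_one_inj {α β α' β' : ℝ}
    (h : α • (1 : cube 1) + β • coord 0 = α' • (1 : cube 1) + β' • coord 0) : α = α' ∧ β = β' := by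
  have h1 := congrArg (cube 1).aug h
  have h2 := congrArg (coeff (0 : Fin 1)) h
  rw [aug_cube_one, aug_cube_one] at h1
  rw [coeff_cube_one, coeff_cube_one] at h2
  exact ⟨h1, h2⟩

theorem axes_inj {α β γ α' β' γ' : ℝ}
    (h : α • (1 : axes) + β • coord 0 + γ • coord 1 =
      α' • (1 : axes) + β' • coord 0 + γ' • coord 1) : α = α' ∧ β = β' ∧ γ = γ' := by
  have h1 := congrArg (toAlgHom (axesIncl 0)) h
  have h2 := congrArg (toAlgHom (axesIncl 1)) h
  rw [axesIncl_apply, axesIncl_apply] at h1 h2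
  exact ⟨(cube_one_inj h1).1, by simpa using (cube_one_inj h1).2, by
    simpa using (cube_one_inj h2).2⟩

theorem coeffTop_cube_two (α β γ δ : ℝ) : coeffTop (α • (1 : cube 2) + β • coord 0 +
    γ • coord 1 + δ • (coord 0 * coord 1)) = δ := by
  simp only [map_add, map_smul, coeffTop_one, coeffTop_coord_zero, coeffTop_coord_one,
    coeffTop_coord_mul_coord]
  simp

theorem cube_two_inj {α β γ δ α' β' γ' δ' : ℝ}
    (h : α • (1 : cube 2) + β • coord 0 + γ • coord 1 + δ • (coord 0 * coord 1) =
      α' • (1 : cube 2) + β' • coord 0 + γ' • coord 1 + δ' • (coord 0 * coord 1)) :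
    α = α' ∧ β = β' ∧ γ = γ' ∧ δ = δ' := by
  have h1 := congrArg (toAlgHom cubeRestrict) h
  have h2 := congrArg coeffTop h
  rw [cubeRestrict_apply, cubeRestrict_apply] at h1
  rw [coeffTop_cube_two, coeffTop_cube_two] at h2
  exact ⟨(axes_inj h1).1, (axes_inj h1).2.1, (axes_inj h1).2.2, h2⟩

theorem isPullback_axes : IsPullback (axesIncl 0) (axesIncl 1) cubeZero cubeZero := by
  have haug : ∀ α β : ℝ, toAlgHom cubeZero (α • (1 : cube 1) + β • coord 0) =
      algebraMap ℝ _ α := fun α β => by rw [cubeZero_apply, aug_cube_one]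
  refine isPullback_of_forall (AlgHom.ext fun x => ?_) (fun x y h1 h2 => ?_) fun a b h => ?_
  · obtain ⟨α, β, γ, rfl⟩ := exists_axes x
    change toAlgHom cubeZero (toAlgHom (axesIncl 0) _) =
      toAlgHom cubeZero (toAlgHom (axesIncl 1) _)
    rw [axesIncl_apply, axesIncl_apply, haug, haug]
  · obtain ⟨α, β, γ, rfl⟩ := exists_axes x
    obtain ⟨α', β', γ', rfl⟩ := exists_axes y
    rw [axesIncl_apply, axesIncl_apply] at h1 h2
    obtain ⟨rfl, e1⟩ := cube_one_inj h1
    have e2 := (cube_one_inj h2).2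
    simp only [if_true, one_ne_zero, if_false] at e1 e2
    rw [e1, e2]
  · obtain ⟨α, β, rfl⟩ := exists_cube_one a
    obtain ⟨α', γ, rfl⟩ := exists_cube_one b
    rw [haug, haug] at h
    obtain rfl := algebraMap_injective _ h
    refine ⟨α • 1 + β • coord 0 + γ • coord 1, ?_, ?_⟩
    · rw [axesIncl_apply, if_pos rfl]
    · rw [axesIncl_apply, if_neg one_ne_zero]

theorem isPullback_squarePlus :
    IsPullback squarePlusPhi squarePlusPsi cubeRestrict cubeRestrict := by
  refine isPullback_of_forall (AlgHom.ext fun x => ?_) (fun x y h1 h2 => ?_) fun a b h => ?_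
  · obtain ⟨α, β, γ, δ, ε, rfl⟩ := exists_squarePlus x
    change toAlgHom cubeRestrict (toAlgHom squarePlusPhi _) =
      toAlgHom cubeRestrict (toAlgHom squarePlusPsi _)
    rw [squarePlusPhi_apply, squarePlusPsi_apply, cubeRestrict_apply, cubeRestrict_apply]
  · obtain ⟨α, β, γ, δ, ε, rfl⟩ := exists_squarePlus x
    obtain ⟨α', β', γ', δ', ε', rfl⟩ := exists_squarePlus y
    rw [squarePlusPhi_apply, squarePlusPhi_apply] at h1
    rw [squarePlusPsi_apply, squarePlusPsi_apply] at h2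
    obtain ⟨rfl, rfl, rfl, rfl⟩ := cube_two_inj h1
    obtain rfl := add_left_cancel (cube_two_inj h2).2.2.2
    rfl
  · obtain ⟨α, β, γ, δ, rfl⟩ := exists_cube_two a
    obtain ⟨α', β', γ', δ', rfl⟩ := exists_cube_two b
    rw [cubeRestrict_apply, cubeRestrict_apply] at h
    obtain ⟨rfl, rfl, rfl⟩ := axes_inj h
    refine ⟨α • 1 + β • coord 0 + γ • coord 1 + δ • (coord 0 * coord 1) + (δ' - δ) • coord 2,
      ?_, ?_⟩
    · rw [squarePlusPhi_apply]
    · rw [squarePlusPsi_apply, add_sub_cancel]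

theorem cubeScale_cube_one (c α β : ℝ) :
    toAlgHom (cubeScale c (0 : Fin 1)) (α • (1 : cube 1) + β • coord 0) =
      α • 1 + (c * β) • coord 0 := by
  unfold cubeScale
  simp only [map_add, map_smul, map_one, toAlgHom_cubeLift, if_true, smul_smul, mul_comm]

theorem coeff_cubeScale (c : ℝ) (x : cube 1) :
    coeff 0 (toAlgHom (cubeScale c (0 : Fin 1)) x) = c * coeff 0 x := by
  obtain ⟨α, β, rfl⟩ := exists_cube_one x
  rw [cubeScale_cube_one, coeff_cube_one, coeff_cube_one]

theorem coeffLeft_cubeScale (c : ℝ) (z : tensor (cube 1) V) :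
    coeffLeft V (toAlgHom (tensorMap (cubeScale c 0) (𝟙 V)) z) = c • coeffLeft V z := by
  induction z using tensor_induction with
  | h0 => simp only [map_zero, smul_zero]
  | ht x y => rw [map_mul, tensorMap_inl, tensorMap_inr, coeffLeft_inl_mul_inr,
      coeffLeft_inl_mul_inr, coeff_cubeScale, toAlgHom_id, smul_smul]
  | ha x y hx hy => simp only [map_add, hx, hy, smul_add]

end WeilAlgebra

namespace FrolicherSpace

open WeilAlgebra

variable {X Y Z M : FrolicherSpace.{u}} {W V : WeilAlgebra}

/-! ### Coefficients of tangent vectors -/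

/-- A family of functions `X ⊗ W → W`, natural in the Weil algebra `W`. Each structure function of
`X` gives rise to such a family. -/
structure NatFamily (X : FrolicherSpace.{u}) where
  app (W : WeilAlgebra) : prolong X W → W
  naturality {W V : WeilAlgebra} (φ : W ⟶ V) (z : prolong X W) :
    toAlgHom φ (app W z) = app V ((prolongHom X φ).1 z)

namespace NatFamily

/-- The family given by a structure function. -/
def ofFunction {χ : X → ℝ} (hχ : χ ∈ X.functions) : NatFamily X where
  app _ z := weilValue hχ z
  naturality φ z := (weilValue_prolongHom hχ φ z).symm

/-- The pullback of a family along a smooth map. -/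
def pull (N : NatFamily Y) (f : X ⟶ Y) : NatFamily X where
  app W z := N.app W ((prolongMap f W).1 z)
  naturality φ z := by rw [N.naturality, prolongMap_prolongHom]

/-- The family on `Y` obtained by differentiating a family along `f : X × Y → Z` in the direction of
a tangent vector of `X`: the coefficient of `d` in the value on `f(ξ(d), z)`. -/
def right (N : NatFamily Z) (f : prod X Y ⟶ Z) (ξ : tangent X) : NatFamily Y where
  app V z := coeffLeft V (N.app (tensor (cube 1) V)
    (prolongMap₂ f ((prolongHom X (inlHom _ V)).1 ξ) ((prolongHom Y (inrHom _ V)).1 z)))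
  naturality {W V} φ z := by
    have h1 : inlHom (cube 1) W ≫ tensorMap (𝟙 (cube 1)) φ = inlHom (cube 1) V :=
      AlgHom.ext fun x => tensorMap_inl _ _ x
    have h2 : inrHom (cube 1) W ≫ tensorMap (𝟙 (cube 1)) φ = φ ≫ inrHom (cube 1) V :=
      AlgHom.ext fun x => tensorMap_inr _ _ x
    rw [toAlgHom_coeffLeft, N.naturality, prolongHom_prolongMap₂, prolongHom_prolongHom,
      prolongHom_prolongHom, prolongHom_prolongHom, h1, h2]

/-- The difference of two families. -/
def sub (N N' : NatFamily X) : NatFamily X where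
  app W z := N.app W z - N'.app W z
  naturality φ z := by rw [map_sub, N.naturality, N'.naturality]

/-- The coefficient of `d` in the value of a family on a tangent vector. -/
def coef (N : NatFamily X) (t : tangent X) : ℝ := coeff (0 : Fin 1) (N.app (cube 1) t)

/-- The coefficient of `d₁ d₂` in the value of a family on an element of `X ⊗ W_{D²}`. -/
def coefTop (N : NatFamily X) (γ : prolong X (cube 2)) : ℝ := coeffTop (N.app (cube 2) γ)

theorem coef_pull (N : NatFamily Y) (f : X ⟶ Y) (t : tangent X) :
    (N.pull f).coef t = N.coef ((prolongMap f (cube 1)).1 t) := rfl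

theorem coef_sub (N N' : NatFamily X) (t : tangent X) :
    (N.sub N').coef t = N.coef t - N'.coef t := map_sub _ _ _

theorem coef_tsmul (N : NatFamily X) (α : ℝ) (t : tangent X) :
    N.coef (tsmul α t) = α * N.coef t := by
  unfold coef tsmul
  rw [← N.naturality, coeff_cubeScale]

theorem coef_tzero (N : NatFamily X) (x : X) : N.coef (tzero x) = 0 := by
  have h : tsmul 0 (tzero x) = tzero x := prolongHom_weilConst _ x
  rw [← h, coef_tsmul, zero_mul]

theorem coef_axes (N : NatFamily X) (ζ : prolong X axes) :
    N.coef ((prolongHom X axesDiag).1 ζ) = N.coef ((prolongHom X (axesIncl 0)).1 ζ) +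
      N.coef ((prolongHom X (axesIncl 1)).1 ζ) := by
  unfold coef
  rw [← N.naturality, ← N.naturality, ← N.naturality]
  obtain ⟨α, β, γ, h⟩ := exists_axes (N.app axes ζ)
  rw [h, axesDiag_apply, axesIncl_apply, axesIncl_apply, coeff_cube_one, coeff_cube_one,
    coeff_cube_one, if_pos rfl, if_neg one_ne_zero]

theorem coef_squarePlus (N : NatFamily X) (ζ : prolong X squarePlus) :
    N.coef ((prolongHom X squarePlusLast).1 ζ) = N.coefTop ((prolongHom X squarePlusPsi).1 ζ) -
      N.coefTop ((prolongHom X squarePlusPhi).1 ζ) := by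
  unfold coef coefTop
  rw [← N.naturality, ← N.naturality, ← N.naturality]
  obtain ⟨α, β, γ, δ, ε, h⟩ := exists_squarePlus (N.app squarePlus ζ)
  rw [h, squarePlusLast_apply, squarePlusPsi_apply, squarePlusPhi_apply, coeff_cube_one,
    coeffTop_cube_two, coeffTop_cube_two, add_sub_cancel_left]

theorem coef_right_tsmul (N : NatFamily Z) (f : prod X Y ⟶ Z) (α : ℝ) (ξ : tangent X)
    (t : tangent Y) : (N.right f (tsmul α ξ)).coef t = α * (N.right f ξ).coef t := by
  have h1 : cubeScale α (0 : Fin 1) ≫ inlHom (cube 1) (cube 1) =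
      inlHom (cube 1) (cube 1) ≫ tensorMap (cubeScale α 0) (𝟙 (cube 1)) :=
    AlgHom.ext fun x => (tensorMap_inl (cubeScale α 0) (𝟙 (cube 1)) x).symm
  have h2 : inrHom (cube 1) (cube 1) =
      inrHom (cube 1) (cube 1) ≫ tensorMap (cubeScale α 0) (𝟙 (cube 1)) :=
    AlgHom.ext fun x => (tensorMap_inr (cubeScale α 0) (𝟙 (cube 1)) x).symm
  change coeff 0 (coeffLeft _ (N.app _ (prolongMap₂ f ((prolongHom X _).1
    ((prolongHom X (cubeScale α 0)).1 ξ)) _))) = α * coeff 0 (coeffLeft _ (N.app _ _))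
  conv_lhs => rw [prolongHom_prolongHom, h1, h2]
  rw [← prolongHom_prolongHom, ← prolongHom_prolongHom, ← prolongHom_prolongMap₂, ← N.naturality,
    coeffLeft_cubeScale, map_smul, smul_eq_mul]

theorem coefTop_prolongMap₂ (N : NatFamily Z) (f : prod X Y ⟶ Z) (ξ : tangent X)
    (t : tangent Y) :
    N.coefTop (prolongMap₂ f ((prolongHom X (cubeLeft 1 1)).1 ξ)
      ((prolongHom Y (cubeRight 1 1)).1 t) : prolong Z (cube (1 + 1))) = (N.right f ξ).coef t := by
  unfold coefTop
  rw [coeffTop_apply, N.naturality]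
  refine congrArg (fun z => coeff (0 : Fin 1) (coeffLeft _ (N.app _ z))) ?_
  refine (prolongHom_prolongMap₂ f (cubeSplit 1 1) _ _).trans ?_
  rw [prolongHom_prolongHom, prolongHom_prolongHom, cubeLeft_cubeSplit, cubeRight_cubeSplit]

end NatFamily

/-- Tangent vectors are determined by their base point and their coefficients. -/
theorem tangent_ext {t t' : tangent X} (h : (proj X (cube 1)).1 t = (proj X (cube 1)).1 t')
    (h' : ∀ N : NatFamily X, N.coef t = N.coef t') : t = t' := by
  refine prolong_ext h fun χ hχ => ?_
  have h1 := h' (NatFamily.ofFunction hχ)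
  have h2 : (cube 1).aug (weilValue hχ t) = (cube 1).aug (weilValue hχ t') := by
    rw [aug_weilValue, aug_weilValue, h]
  change coeff 0 (weilValue hχ t) = coeff 0 (weilValue hχ t') at h1
  obtain ⟨α, β, e⟩ := exists_cube_one (weilValue hχ t)
  obtain ⟨α', β', e'⟩ := exists_cube_one (weilValue hχ t')
  rw [e, e', aug_cube_one, aug_cube_one] at h2
  rw [e, e', coeff_cube_one, coeff_cube_one] at h1
  rw [e, e', h1, h2]

theorem prolong_axes_ext {z z' : prolong X axes}
    (h0 : (prolongHom X (axesIncl 0)).1 z = (prolongHom X (axesIncl 0)).1 z')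
    (h1 : (prolongHom X (axesIncl 1)).1 z = (prolongHom X (axesIncl 1)).1 z') : z = z' := by
  refine prolong_ext ?_ fun χ hχ => ?_
  · have := congrArg (proj X (cube 1)).1 h0
    rwa [proj_prolongHom, proj_prolongHom] at this
  · have e0 := congrArg (weilValue hχ) h0
    have e1 := congrArg (weilValue hχ) h1
    rw [weilValue_prolongHom, weilValue_prolongHom] at e0 e1
    obtain ⟨α, β, γ, e⟩ := exists_axes (weilValue hχ z)
    obtain ⟨α', β', γ', e'⟩ := exists_axes (weilValue hχ z')
    rw [e, e', axesIncl_apply, axesIncl_apply] at e0 e1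
    obtain ⟨rfl, e2⟩ := cube_one_inj e0
    have e3 := (cube_one_inj e1).2
    simp only [if_true, one_ne_zero, if_false] at e2 e3
    rw [e, e', e2, e3]

theorem proj_tsmul (α : ℝ) (t : tangent X) :
    (proj X (cube 1)).1 (tsmul α t) = (proj X (cube 1)).1 t := proj_prolongHom _ t

section Tangent

variable (hM : M.Microlinear) (hE : M.WeilExponentiable)

include hM hE

theorem exists_axes_of_proj_eq {t t' : tangent (exp Y M)}
    (h : (proj _ (cube 1)).1 t = (proj _ (cube 1)).1 t') :
    ∃ ζ : prolong (exp Y M) axes,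
      (prolongHom _ (axesIncl 0)).1 ζ = t ∧ (prolongHom _ (axesIncl 1)).1 ζ = t' := by
  refine exists_of_isPullback hE hM isPullback_axes t t' ?_
  rw [prolongHom_of_aug _ cubeZero_apply, prolongHom_of_aug _ cubeZero_apply, h]

theorem coef_tadd (N : NatFamily (exp Y M)) {t t' : tangent (exp Y M)}
    (h : (proj _ (cube 1)).1 t = (proj _ (cube 1)).1 t') :
    N.coef (tadd t t') = N.coef t + N.coef t' := by
  have hζ := exists_axes_of_proj_eq hM hE h
  unfold tadd
  rw [dif_pos hζ, N.coef_axes, hζ.choose_spec.1, hζ.choose_spec.2]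

theorem proj_tadd {t t' : tangent (exp Y M)}
    (h : (proj _ (cube 1)).1 t = (proj _ (cube 1)).1 t') :
    (proj _ (cube 1)).1 (tadd t t') = (proj _ (cube 1)).1 t := by
  have hζ := exists_axes_of_proj_eq hM hE h
  unfold tadd
  rw [dif_pos hζ, proj_prolongHom]
  conv_rhs => rw [← hζ.choose_spec.1]
  exact (proj_prolongHom _ _).symm

theorem exists_squarePlus_of_restrict_eq {γ γ' : prolong (exp Y M) (cube 2)}
    (h : (prolongHom _ cubeRestrict).1 γ = (prolongHom _ cubeRestrict).1 γ') :
    ∃ ζ : prolong (exp Y M) squarePlus,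
      (prolongHom _ squarePlusPhi).1 ζ = γ' ∧ (prolongHom _ squarePlusPsi).1 ζ = γ :=
  exists_of_isPullback hE hM isPullback_squarePlus γ' γ h.symm

theorem coef_strongDiff (N : NatFamily (exp Y M)) {γ γ' : prolong (exp Y M) (cube 2)}
    (h : (prolongHom _ cubeRestrict).1 γ = (prolongHom _ cubeRestrict).1 γ') :
    N.coef (strongDiff γ γ') = N.coefTop γ - N.coefTop γ' := by
  have hζ := exists_squarePlus_of_restrict_eq hM hE h
  unfold strongDiff
  rw [dif_pos hζ, N.coef_squarePlus, hζ.choose_spec.1, hζ.choose_spec.2]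

theorem proj_strongDiff {γ γ' : prolong (exp Y M) (cube 2)}
    (h : (prolongHom _ cubeRestrict).1 γ = (prolongHom _ cubeRestrict).1 γ') :
    (proj _ (cube 1)).1 (strongDiff γ γ') = (proj _ (cube 2)).1 γ := by
  have hζ := exists_squarePlus_of_restrict_eq hM hE h
  unfold strongDiff
  rw [dif_pos hζ, proj_prolongHom]
  conv_rhs => rw [← hζ.choose_spec.2]
  exact (proj_prolongHom _ _).symm

end Tangent

/-! ### Coefficients of the Lie bracket -/

section Lie

variable (hM : M.Microlinear) (hE : M.WeilExponentiable) {p q r : ℕ}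

theorem cubeLeft_cubeRestrict_axesIncl (i : Fin 2) :
    cubeLeft 1 1 ≫ (cubeRestrict ≫ axesIncl i : cube (1 + 1) ⟶ cube 1) =
      if i = 0 then 𝟙 (cube 1) else cubeLift (fun _ => 0) fun _ => zero_mul 0 := by
  refine infinitesimal_hom_ext fun j => ?_
  obtain rfl : j = 0 := Subsingleton.elim _ _
  have h1 : toAlgHom (cubeLeft 1 1) (coord 0) = (coord 0 : cube 2) := cubeLeft_coord 1 1 0
  have h2 : toAlgHom cubeRestrict (coord 0) = coord 0 := toAlgHom_cubeLift _ _ _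
  have h3 : toAlgHom (axesIncl i) (coord 0) = if (0 : Fin 2) = i then coord 0 else 0 :=
    toAlgHom_lift _ _ _
  refine (congrArg (fun x => toAlgHom (axesIncl i) (toAlgHom cubeRestrict x)) h1).trans ?_
  rw [h2, h3]
  obtain rfl | rfl : i = 0 ∨ i = 1 := by omega
  · rfl
  · rw [if_neg zero_ne_one, if_neg one_ne_zero, toAlgHom_cubeLift]

theorem cubeRight_cubeRestrict_axesIncl (i : Fin 2) :
    cubeRight 1 1 ≫ (cubeRestrict ≫ axesIncl i : cube (1 + 1) ⟶ cube 1) =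
      if i = 1 then 𝟙 (cube 1) else cubeLift (fun _ => 0) fun _ => zero_mul 0 := by
  refine infinitesimal_hom_ext fun j => ?_
  obtain rfl : j = 0 := Subsingleton.elim _ _
  have h1 : toAlgHom (cubeRight 1 1) (coord 0) = (coord 1 : cube 2) := cubeRight_coord 1 1 0
  have h2 : toAlgHom cubeRestrict (coord 1) = coord 1 := toAlgHom_cubeLift _ _ _
  have h3 : toAlgHom (axesIncl i) (coord 1) = if (1 : Fin 2) = i then coord 0 else 0 :=
    toAlgHom_lift _ _ _
  refine (congrArg (fun x => toAlgHom (axesIncl i) (toAlgHom cubeRestrict x)) h1).trans ?_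
  rw [h2, h3]
  obtain rfl | rfl : i = 0 ∨ i = 1 := by omega
  · rw [if_neg one_ne_zero, if_neg zero_ne_one, toAlgHom_cubeLift]
  · rfl

theorem prolongHom_zero (z : tangent X) :
    (prolongHom X (cubeLift (fun _ => 0) fun _ => zero_mul 0 : cube 1 ⟶ cube 1)).1 z =
      tzero ((proj X (cube 1)).1 z) := by
  refine prolongHom_of_aug _ (fun x => ?_) z
  obtain ⟨α, β, rfl⟩ := exists_cube_one x
  rw [aug_cube_one, map_add, map_smul, map_smul, map_one, toAlgHom_cubeLift, smul_zero, add_zero,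
    Algebra.algebraMap_eq_smul_one]

/-- Both convolutions agree on `D(2)`, because each of them is the composition with one of the
arguments if the other one is the Dirac distribution. -/
theorem restrict_circ' {ξ₁ : tangent (distr M p)} {ξ₂ : tangent (distr M q)}
    (h₁ : (proj _ (cube 1)).1 ξ₁ = dirac M p) (h₂ : (proj _ (cube 1)).1 ξ₂ = dirac M q) :
    (prolongHom _ cubeRestrict).1 (circ' hE ξ₁ ξ₂ : prolong _ (cube (1 + 1))) =
      (prolongHom _ cubeRestrict).1 (circ hE ξ₁ ξ₂ : prolong _ (cube (1 + 1))) := by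
  have key : ∀ (k : prod (distr M p) (distr M q) ⟶ distr M (p + q)) (i : Fin 2),
      (prolongHom _ (axesIncl i)).1 ((prolongHom _ cubeRestrict).1
        (prolongMap₂ k ((prolongHom _ (cubeLeft 1 1)).1 ξ₁)
          ((prolongHom _ (cubeRight 1 1)).1 ξ₂) : prolong _ (cube (1 + 1)))) =
      if i = 0 then prolongMap₂ k ξ₁ (weilConst (dirac M q) (cube 1))
      else prolongMap₂ k (weilConst (dirac M p) (cube 1)) ξ₂ := by
    intro k i
    refine (prolongHom_prolongHom _ _ _).trans ?_
    refine (prolongHom_prolongMap₂ k (cubeRestrict ≫ axesIncl i : cube (1 + 1) ⟶ cube 1) _ _).trans ?_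
    rw [prolongHom_prolongHom, prolongHom_prolongHom, cubeLeft_cubeRestrict_axesIncl,
      cubeRight_cubeRestrict_axesIncl]
    obtain rfl | rfl : i = 0 ∨ i = 1 := by omega
    · rw [if_pos rfl, if_pos rfl, if_neg zero_ne_one, prolongHom_id, prolongHom_zero, h₂]
      rfl
    · rw [if_pos rfl, if_neg one_ne_zero, if_neg one_ne_zero, prolongHom_id, prolongHom_zero, h₁]
      rfl
  rw [circ_eq, circ'_eq]
  refine prolong_axes_ext ?_ ?_
  · rw [key, key, if_pos rfl, if_pos rfl]
    refine (prolongMap₂_const_right (l := precomp (prolongHom M (cubeFst p q)) M)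
      (conv'_dirac hE) ξ₁).trans ?_
    exact (prolongMap₂_const_right (l := precomp (prolongHom M (cubeFst p q)) M)
      (conv_dirac hE) ξ₁).symm
  · rw [key, key, if_neg one_ne_zero, if_neg one_ne_zero]
    refine (prolongMap₂_const_left (l := precomp (prolongHom M (cubeSnd p q)) M)
      (dirac_conv' hE) ξ₂).trans ?_
    exact (prolongMap₂_const_left (l := precomp (prolongHom M (cubeSnd p q)) M)
      (dirac_conv hE) ξ₂).symm

/-- The family `ξ₂ ↦ [ξ₁, ξ₂]_L` composed with a family. -/
def NatFamily.lie (N : NatFamily (distr M (p + q))) (ξ₁ : tangent (distr M p)) :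
    NatFamily (distr M q) :=
  (N.right (convHom' hE p q) ξ₁).sub (N.right (convHom hE p q) ξ₁)

include hM

theorem coef_lieBracket (N : NatFamily (distr M (p + q))) {ξ₁ : tangent (distr M p)}
    {ξ₂ : tangent (distr M q)} (h₁ : (proj _ (cube 1)).1 ξ₁ = dirac M p)
    (h₂ : (proj _ (cube 1)).1 ξ₂ = dirac M q) :
    N.coef (lieBracket hE ξ₁ ξ₂) = (N.lie hE ξ₁).coef ξ₂ := by
  unfold lieBracket NatFamily.lie
  rw [coef_strongDiff hM hE N (restrict_circ' hE h₁ h₂), NatFamily.coef_sub, circ_eq, circ'_eq,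
    N.coefTop_prolongMap₂, N.coefTop_prolongMap₂]

theorem proj_lieBracket {ξ₁ : tangent (distr M p)}
    {ξ₂ : tangent (distr M q)} (h₁ : (proj _ (cube 1)).1 ξ₁ = dirac M p)
    (h₂ : (proj _ (cube 1)).1 ξ₂ = dirac M q) :
    (proj _ (cube 1)).1 (lieBracket hE ξ₁ ξ₂) = dirac M (p + q) := by
  unfold lieBracket
  rw [proj_strongDiff hM hE (restrict_circ' hE h₁ h₂), circ'_eq]
  refine (proj_prolongMap₂ _ _ _).trans ?_
  rw [proj_prolongHom, proj_prolongHom, h₁, h₂]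
  exact conv'_dirac_dirac hE

end Lie

end FrolicherSpace

namespace WeilAlgebra

/-- The algebra of `D³`, as a tensor product. -/
abbrev tensorCube : WeilAlgebra := tensor (cube 1) (tensor (cube 1) (cube 1))

/-- The coefficient of `d₁ d₂ d₃`. -/
def coeffTriple : tensorCube →ₗ[ℝ] ℝ :=
  coeff (0 : Fin 1) ∘ₗ coeffLeft (cube 1) ∘ₗ coeffLeft (tensor (cube 1) (cube 1))

/-- The cyclic permutation `x ⊗ y ⊗ z ↦ z ⊗ x ⊗ y` of the tensor factors. -/
def tensorRotate : tensorCube ⟶ tensorCube :=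
  ((Algebra.TensorProduct.assoc ℝ ℝ ℝ (cube 1) (cube 1) (cube 1)).symm.trans
    (Algebra.TensorProduct.comm ℝ ((cube 1) ⊗[ℝ] (cube 1)) (cube 1))).toAlgHom

theorem tensorRotate_fst (x : cube 1) : toAlgHom tensorRotate (inl x) = inr (inl x) := rfl

theorem tensorRotate_snd (x : cube 1) : toAlgHom tensorRotate (inr (inl x)) = inr (inr x) := rfl

theorem tensorRotate_thd (x : cube 1) : toAlgHom tensorRotate (inr (inr x)) = inl x := rfl

theorem coeffTriple_mul (x y z : cube 1) :
    coeffTriple (inl x * inr (inl y * inr z)) = coeff 0 x * (coeff 0 y * coeff 0 z) := by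
  change coeff 0 (coeffLeft _ (coeffLeft _ _)) = _
  rw [coeffLeft_inl_mul_inr, map_smul, map_smul, coeffLeft_inl_mul_inr, map_smul, smul_eq_mul,
    smul_eq_mul]

theorem coeffTriple_tensorRotate (z : tensorCube) :
    coeffTriple (toAlgHom tensorRotate z) = coeffTriple z := by
  induction z using tensor_induction with
  | h0 => rw [map_zero]
  | ha x y hx hy => rw [map_add, map_add, map_add, hx, hy]
  | ht x w =>
    induction w using tensor_induction with
    | h0 => rw [inr_zero, mul_zero, map_zero]
    | ha y z hy hz =>
      have : (inr (y + z) : tensorCube) = inr y + inr z := TensorProduct.tmul_add _ _ _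
      rw [this, mul_add, map_add, map_add, map_add, hy, hz]
    | ht y z =>
      rw [coeffTriple_mul, ← inr_mul, map_mul (toAlgHom tensorRotate),
        map_mul (toAlgHom tensorRotate), tensorRotate_fst, tensorRotate_snd,
        tensorRotate_thd, mul_comm (inr (inr y)), mul_left_comm, inr_mul, coeffTriple_mul]
      ring

end WeilAlgebra

namespace FrolicherSpace

open WeilAlgebra

variable {X Y Z M : FrolicherSpace.{u}} {W V : WeilAlgebra}

/-! ### Families and reindexing of coordinates -/

namespace NatFamily

attribute [ext] NatFamily

theorem pull_pull (N : NatFamily Z) (f : Y ⟶ Z) (g : X ⟶ Y) : (N.pull f).pull g = N.pull (g ≫ f) :=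
  NatFamily.ext (funext fun W => funext fun z => congrArg (N.app W) (prolongMap_prolongMap g f z))

theorem pull_id (N : NatFamily X) : N.pull (𝟙 X) = N :=
  NatFamily.ext (funext fun W => funext fun z => congrArg (N.app W) (prolongMap_id z))

theorem coef_sub_right (N N' : NatFamily Z) (f : prod X Y ⟶ Z) (ξ : tangent X) (t : tangent Y) :
    ((N.sub N').right f ξ).coef t = (N.right f ξ).coef t - (N'.right f ξ).coef t := by
  change coeff 0 (coeffLeft _ (N.app _ _ - N'.app _ _)) = _
  rw [map_sub, map_sub]
  rfl

/-- The coefficient of `d₁ d₂ d₃` in the value of a family on `f(ξ₁(d₁), g(ξ₂(d₂), ξ₃(d₃)))`. -/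
theorem coef_right_right {X₁ X₂ X₃ : FrolicherSpace.{u}} (N : NatFamily Z) (f : prod X₁ Y ⟶ Z)
    (g : prod X₂ X₃ ⟶ Y) (ξ₁ : tangent X₁) (ξ₂ : tangent X₂) (ξ₃ : tangent X₃) :
    ((N.right f ξ₁).right g ξ₂).coef ξ₃ = coeffTriple (N.app tensorCube
      (prolongMap₂ f ((prolongHom X₁ (inlHom _ _)).1 ξ₁)
        (prolongMap₂ g ((prolongHom X₂ (inlHom _ _ ≫ inrHom _ _)).1 ξ₂)
          ((prolongHom X₃ (inrHom _ _ ≫ inrHom _ _)).1 ξ₃)))) := by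
  rw [← prolongHom_prolongHom, ← prolongHom_prolongHom (inrHom _ _),
    ← prolongHom_prolongMap₂]
  rfl

/-- Iterated coefficients of a composite of two maps which is invariant under a cyclic permutation
of its three arguments. -/
theorem coef_right_right_rotate {X₁ X₂ X₃ Y' Z' : FrolicherSpace.{u}} (N : NatFamily Z)
    (f : prod X₁ Y ⟶ Z) (g : prod X₂ X₃ ⟶ Y) (f' : prod X₂ Y' ⟶ Z') (g' : prod X₃ X₁ ⟶ Y')
    (k : Z' ⟶ Z) (h : ∀ x₁ x₂ x₃, f.1 (x₁, g.1 (x₂, x₃)) = k.1 (f'.1 (x₂, g'.1 (x₃, x₁))))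
    (ξ₁ : tangent X₁) (ξ₂ : tangent X₂) (ξ₃ : tangent X₃) :
    ((N.right f ξ₁).right g ξ₂).coef ξ₃ = (((N.pull k).right f' ξ₂).right g' ξ₃).coef ξ₁ := by
  have key : ∀ {W : WeilAlgebra} (x₁ : prolong X₁ W) (x₂ : prolong X₂ W) (x₃ : prolong X₃ W),
      prolongMap₂ f x₁ (prolongMap₂ g x₂ x₃) =
        (prolongMap k W).1 (prolongMap₂ f' x₂ (prolongMap₂ g' x₃ x₁)) := by
    intro W x₁ x₂ x₃
    obtain ⟨n, a, ha⟩ := W.exists_isGenerating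
    obtain ⟨u₁, hu₁, rfl⟩ := exists_eq_weilClass ha x₁
    obtain ⟨u₂, hu₂, rfl⟩ := exists_eq_weilClass ha x₂
    obtain ⟨u₃, hu₃, rfl⟩ := exists_eq_weilClass ha x₃
    have e1 := prolongMap₂_weilClass g hu₂ hu₃ a ha.1
    have e2 := prolongMap₂_weilClass g' hu₃ hu₁ a ha.1
    rw [e1, e2]
    refine (prolongMap₂_weilClass f hu₁ _ a ha.1).trans ?_
    refine Eq.trans ?_ (congrArg (prolongMap k W).1
      (prolongMap₂_weilClass f' hu₂ ((hu₃.prodMk hu₁).map g') a ha.1)).symm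
    exact weilClass_congr (fun t => h (u₁ t) (u₂ t) (u₃ t)) fun _ => rfl
  have r1 : inlHom (cube 1) (tensor (cube 1) (cube 1)) ≫ tensorRotate =
      inlHom (cube 1) (cube 1) ≫ inrHom (cube 1) _ := AlgHom.ext tensorRotate_fst
  have r2 : (inlHom (cube 1) (cube 1) ≫ inrHom (cube 1) _) ≫ tensorRotate =
      inrHom (cube 1) (cube 1) ≫ inrHom (cube 1) _ := AlgHom.ext tensorRotate_snd
  have r3 : (inrHom (cube 1) (cube 1) ≫ inrHom (cube 1) _) ≫ tensorRotate =
      inlHom (cube 1) (tensor (cube 1) (cube 1)) := AlgHom.ext tensorRotate_thd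
  rw [coef_right_right, coef_right_right, key, ← coeffTriple_tensorRotate ((N.pull k).app _ _),
    (N.pull k).naturality, prolongHom_prolongMap₂, prolongHom_prolongMap₂, prolongHom_prolongHom,
    prolongHom_prolongHom, prolongHom_prolongHom, r1, r2, r3]
  rfl

end NatFamily

/-- The map `[M ⊗ W_{Dᵐ} → M] → [M ⊗ W_{Dⁿ} → M]` induced by
`(d₁, …, dₘ) ↦ (d_{e(1)}, …, d_{e(n)})`. -/
def reindex (M : FrolicherSpace.{u}) {n m : ℕ} (e : Fin n → Fin m) : distr M m ⟶ distr M n :=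
  precomp (prolongHom M (cubeMap e)) M

theorem precomp_comp {W V U : WeilAlgebra} (φ : W ⟶ V) (ψ : V ⟶ U) :
    precomp (prolongHom M ψ) M ≫ precomp (prolongHom M φ) M =
      precomp (prolongHom M (φ ≫ ψ)) M := by
  have h : prolongHom M (φ ≫ ψ) = prolongHom M φ ≫ prolongHom M ψ := (weilFunctor M).map_comp φ ψ
  rw [h]
  rfl

theorem precomp_id (W : WeilAlgebra) : precomp (prolongHom M (𝟙 W)) M = 𝟙 _ := by
  have h : prolongHom M (𝟙 W) = 𝟙 _ := (weilFunctor M).map_id W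
  rw [h]
  rfl

theorem reindex_comp {n m l : ℕ} (e : Fin n → Fin m) (f : Fin m → Fin l) :
    reindex M f ≫ reindex M e = reindex M (f ∘ e) := by
  unfold reindex
  rw [precomp_comp, cubeMap_comp]

theorem reindex_id (n : ℕ) : reindex M (id : Fin n → Fin n) = 𝟙 _ := by
  have h : cubeMap (id : Fin n → Fin n) = 𝟙 _ := infinitesimal_hom_ext fun i => cubeMap_coord _ i
  unfold reindex
  rw [h, precomp_id]

theorem permute_eq {p : ℕ} (σ : Equiv.Perm (Fin p)) (ξ : tangent (distr M p)) :
    permute σ ξ = (prolongMap (reindex M σ) (cube 1)).1 ξ := rfl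

theorem NatFamily.pull_reindex {n m l : ℕ} (N : NatFamily (distr M n)) (e : Fin n → Fin m)
    (f : Fin m → Fin l) :
    (N.pull (reindex M e)).pull (reindex M f) = N.pull (reindex M (f ∘ e)) := by
  rw [NatFamily.pull_pull, reindex_comp]

/-! ### The Jacobi identity for the Lie bracket -/

variable (hM : M.Microlinear) (hE : M.WeilExponentiable) {p q r : ℕ}

theorem coef_lie (N : NatFamily (distr M (p + q))) (ξ₁ : tangent (distr M p))
    (ξ₂ : tangent (distr M q)) : (N.lie hE ξ₁).coef ξ₂ =
      (N.right (convHom' hE p q) ξ₁).coef ξ₂ - (N.right (convHom hE p q) ξ₁).coef ξ₂ :=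
  NatFamily.coef_sub _ _ _

theorem coef_lie_lie (N : NatFamily (distr M (p + (q + r)))) (ξ₁ : tangent (distr M p))
    (ξ₂ : tangent (distr M q)) (ξ₃ : tangent (distr M r)) :
    ((N.lie hE ξ₁).lie hE ξ₂).coef ξ₃ =
      ((N.right (convHom' hE p (q + r)) ξ₁).right (convHom' hE q r) ξ₂).coef ξ₃ -
      ((N.right (convHom hE p (q + r)) ξ₁).right (convHom' hE q r) ξ₂).coef ξ₃ -
      (((N.right (convHom' hE p (q + r)) ξ₁).right (convHom hE q r) ξ₂).coef ξ₃ -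
      ((N.right (convHom hE p (q + r)) ξ₁).right (convHom hE q r) ξ₂).coef ξ₃) := by
  rw [coef_lie]
  unfold NatFamily.lie
  rw [NatFamily.coef_sub_right, NatFamily.coef_sub_right]

theorem coef_conv_conv' (N : NatFamily (distr M (p + (q + r)))) (ξ₁ : tangent (distr M p))
    (ξ₂ : tangent (distr M q)) (ξ₃ : tangent (distr M r)) :
    ((N.right (convHom hE p (q + r)) ξ₁).right (convHom' hE q r) ξ₂).coef ξ₃ =
      (((N.pull (reindex M (blockRotate p q r))).right (convHom' hE q (r + p)) ξ₂).right
        (convHom' hE r p) ξ₃).coef ξ₁ :=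
  N.coef_right_right_rotate _ _ _ _ _ (conv_conv' hE) ξ₁ ξ₂ ξ₃

theorem coef_conv'_conv (N : NatFamily (distr M (p + (q + r)))) (ξ₁ : tangent (distr M p))
    (ξ₂ : tangent (distr M q)) (ξ₃ : tangent (distr M r)) :
    ((N.right (convHom' hE p (q + r)) ξ₁).right (convHom hE q r) ξ₂).coef ξ₃ =
      (((N.pull (reindex M (blockRotate p q r))).right (convHom hE q (r + p)) ξ₂).right
        (convHom hE r p) ξ₃).coef ξ₁ :=
  N.coef_right_right_rotate _ _ _ _ _ (conv'_conv hE) ξ₁ ξ₂ ξ₃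

theorem blockRotate_blockRotate_blockRotate (p q r : ℕ) :
    blockRotate r p q ∘ blockRotate q r p ∘ blockRotate p q r = id := by
  funext k
  refine Fin.addCases (fun i => ?_) (fun j => Fin.addCases (fun j => ?_) (fun l => ?_) j) k <;>
  simp only [Function.comp_apply, blockRotate_fst, blockRotate_snd, blockRotate_thd, id]

/-- The Jacobi identity for the Lie bracket: of the twelve terms, each occurs twice, with opposite
signs. -/
theorem jacobi_lie (N : NatFamily (distr M (p + (q + r)))) (ξ₁ : tangent (distr M p))
    (ξ₂ : tangent (distr M q)) (ξ₃ : tangent (distr M r)) :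
    ((N.lie hE ξ₁).lie hE ξ₂).coef ξ₃ +
      (((N.pull (reindex M (blockRotate p q r))).lie hE ξ₂).lie hE ξ₃).coef ξ₁ +
      (((N.pull (reindex M (blockRotate q r p ∘ blockRotate p q r))).lie hE ξ₃).lie hE ξ₁).coef ξ₂
      = 0 := by
  have h : ((N.pull (reindex M (blockRotate p q r))).pull (reindex M (blockRotate q r p))).pull
      (reindex M (blockRotate r p q)) = N := by
    rw [NatFamily.pull_reindex, NatFamily.pull_reindex, Function.comp_assoc,
      blockRotate_blockRotate_blockRotate,
      reindex_id, NatFamily.pull_id]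
  rw [← NatFamily.pull_reindex, coef_lie_lie, coef_lie_lie, coef_lie_lie]
  simp only [coef_conv_conv', coef_conv'_conv, h]
  ring

end FrolicherSpace

/-! ### Signs of block permutations -/

theorem val_finRotate_pow (n k : ℕ) (i : Fin n) : ((finRotate n ^ k) i : ℕ) = (i + k) % n := by
  induction k with
  | zero => simp [Nat.mod_eq_of_lt i.isLt]
  | succ k ih =>
    have := i.neZero
    rw [pow_succ', Equiv.Perm.mul_apply, finRotate_apply, Fin.val_add, ih, Fin.val_one']
    simp [Nat.add_assoc]

theorem WeilAlgebra.sign_blockRotate (p q r : ℕ) (h : q + (r + p) = p + (q + r)) :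
    Equiv.Perm.sign ((WeilAlgebra.blockRotate p q r).trans (finCongr h)) =
      (-1) ^ (p * (q + r)) := by
  have h1 : (WeilAlgebra.blockRotate p q r).trans (finCongr h) =
      finRotate (p + (q + r)) ^ (q + r) := by
    ext k
    rw [val_finRotate_pow]
    refine Fin.addCases (fun i => ?_) (fun j => Fin.addCases (fun j => ?_) (fun l => ?_) j) k
    · have := i.isLt
      rw [Equiv.trans_apply, WeilAlgebra.blockRotate_fst, Nat.mod_eq_of_lt (by rw [Fin.val_castAdd]; omega)]
      simp
      omega
    · have := j.isLt
      rw [Equiv.trans_apply, WeilAlgebra.blockRotate_snd]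
      have e : ((Fin.natAdd p (Fin.castAdd r j) : Fin (p + (q + r))) : ℕ) + (q + r) =
          j + (p + (q + r)) := by simp; omega
      rw [e, Nat.add_mod_right, Nat.mod_eq_of_lt (by omega)]
      simp
    · have := l.isLt
      rw [Equiv.trans_apply, WeilAlgebra.blockRotate_thd]
      have e : ((Fin.natAdd p (Fin.natAdd q l) : Fin (p + (q + r))) : ℕ) + (q + r) =
          (q + l) + (p + (q + r)) := by simp; omega
      rw [e, Nat.add_mod_right, Nat.mod_eq_of_lt (by omega)]
      simp
  rw [h1, map_pow, sign_finRotate, ← pow_mul]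
  generalize q + r = m
  cases m with
  | zero => simp
  | succ m =>
    have e : (p + (m + 1) - 1) * (m + 1) = p * (m + 1) + m * (m + 1) := by
      rw [← Nat.add_assoc, Nat.add_sub_cancel, Nat.add_mul]
    rw [e, pow_add, (Nat.even_mul_succ_self m).neg_one_pow, mul_one]

/-- The permutation of `{1, …, p + q}` which permutes the last `q` elements. -/
def rightPerm (p : ℕ) {q : ℕ} (σ : Equiv.Perm (Fin q)) : Equiv.Perm (Fin (p + q)) :=
  finSumFinEquiv.permCongr (Equiv.Perm.sumCongr 1 σ)

theorem rightPerm_castAdd {p q : ℕ} (σ : Equiv.Perm (Fin q)) (i : Fin p) :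
    rightPerm p σ (Fin.castAdd q i) = Fin.castAdd q i := by
  simp [rightPerm, Equiv.permCongr_apply]

theorem rightPerm_natAdd {p q : ℕ} (σ : Equiv.Perm (Fin q)) (j : Fin q) :
    rightPerm p σ (Fin.natAdd p j) = Fin.natAdd p (σ j) := by
  simp [rightPerm, Equiv.permCongr_apply]

theorem sign_rightPerm {p q : ℕ} (σ : Equiv.Perm (Fin q)) :
    Equiv.Perm.sign (rightPerm p σ) = Equiv.Perm.sign σ := by
  unfold rightPerm
  rw [Equiv.Perm.sign_permCongr, Equiv.Perm.sign_sumCongr, Equiv.Perm.sign_one, one_mul]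

/-- The sign of a permutation as a real number. -/
abbrev realSign {n : ℕ} (σ : Equiv.Perm (Fin n)) : ℝ := ((Equiv.Perm.sign σ : ℤ) : ℝ)

theorem realSign_mul {n : ℕ} (σ τ : Equiv.Perm (Fin n)) :
    realSign (σ * τ) = realSign σ * realSign τ := by
  simp [realSign]

theorem realSign_mul_self {n : ℕ} (σ : Equiv.Perm (Fin n)) : realSign σ * realSign σ = 1 := by
  rw [← realSign_mul, realSign, Equiv.Perm.sign_mul, Int.units_mul_self]
  simp

theorem sum_realSign_mul_left {n : ℕ} (ρ : Equiv.Perm (Fin n)) (f : Equiv.Perm (Fin n) → ℝ) :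
    ∑ τ, realSign τ * f (ρ * τ) = realSign ρ * ∑ τ, realSign τ * f τ := by
  rw [Finset.mul_sum, ← Equiv.sum_comp (Equiv.mulLeft ρ) fun τ => realSign ρ * (realSign τ * f τ)]
  refine Finset.sum_congr rfl fun τ _ => ?_
  rw [Equiv.coe_mulLeft, realSign_mul, ← mul_assoc, ← mul_assoc, realSign_mul_self, one_mul]

theorem sum_realSign_mul_right {n : ℕ} (ρ : Equiv.Perm (Fin n)) (f : Equiv.Perm (Fin n) → ℝ) :
    ∑ τ, realSign τ * f (τ * ρ) = realSign ρ * ∑ τ, realSign τ * f τ := by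
  rw [Finset.mul_sum, ← Equiv.sum_comp (Equiv.mulRight ρ) fun τ => realSign ρ * (realSign τ * f τ)]
  refine Finset.sum_congr rfl fun τ _ => ?_
  rw [Equiv.coe_mulRight, realSign_mul, mul_comm (realSign τ) (realSign ρ), ← mul_assoc,
    ← mul_assoc, realSign_mul_self, one_mul]

/-- An alternating sum over the permutations of `m` elements, in terms of permutations of `n = m`
elements and of a fixed bijection. -/
theorem sum_realSign_cast {m n : ℕ} (h : m = n) (e : Fin n ≃ Fin m) (f : (Fin n → Fin m) → ℝ) :
    ∑ τ : Equiv.Perm (Fin m), realSign τ * f (τ ∘ Fin.cast h.symm) =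
      realSign (e.trans (finCongr h)) * ∑ τ : Equiv.Perm (Fin n), realSign τ * f (e ∘ τ) := by
  subst h
  have h1 := sum_realSign_mul_left e fun τ => f τ
  have h2 : e.trans (finCongr rfl) = e := rfl
  have h3 : ∀ τ : Equiv.Perm (Fin m), (τ ∘ Fin.cast rfl : Fin m → Fin m) = τ := fun _ => rfl
  rw [h2]
  simp only [h3]
  simp only [Equiv.Perm.coe_mul] at h1
  rw [h1, ← mul_assoc, realSign_mul_self, one_mul]

namespace FrolicherSpace

open WeilAlgebra

variable {M : FrolicherSpace.{u}} (hM : M.Microlinear) (hE : M.WeilExponentiable) {p q r : ℕ}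

/-! ### Equivariance of the Lie bracket -/

theorem coef_lie_precomp {p' q' : ℕ} (φ : cube p' ⟶ cube p) (ψ : cube q' ⟶ cube q)
    (N : NatFamily (distr M (p' + q'))) (ξ₁ : tangent (distr M p)) (ξ₂ : tangent (distr M q)) :
    ((N.pull (precomp (prolongHom M (cubeSum φ ψ)) M)).lie hE ξ₁).coef ξ₂ =
      (N.lie hE ((prolongMap (precomp (prolongHom M φ) M) (cube 1)).1 ξ₁)).coef
        ((prolongMap (precomp (prolongHom M ψ) M) (cube 1)).1 ξ₂) := by
  rw [coef_lie, coef_lie]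
  refine congrArg₂ (· - ·) ?_ ?_
  · refine congrArg (fun z => coeff (0 : Fin 1) (coeffLeft _ (N.app _ z))) ?_
    rw [← prolongMap_prolongHom, ← prolongMap_prolongHom]
    exact prolongMap_prolongMap₂ (fun x y => (conv'_precomp hE φ ψ x y).symm) _ _
  · refine congrArg (fun z => coeff (0 : Fin 1) (coeffLeft _ (N.app _ z))) ?_
    rw [← prolongMap_prolongHom, ← prolongMap_prolongHom]
    exact prolongMap_prolongMap₂ (fun x y => (conv_precomp hE φ ψ x y).symm) _ _

theorem prolongMap_precomp_id (ξ : tangent (distr M p)) :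
    (prolongMap (precomp (prolongHom M (𝟙 (cube p))) M) (cube 1)).1 ξ = ξ := by
  rw [precomp_id, prolongMap_id]

theorem cubeMap_rightPerm (σ : Equiv.Perm (Fin q)) :
    cubeSum (𝟙 (cube p)) (cubeMap σ) = cubeMap (rightPerm p σ) :=
  infinitesimal_hom_ext fun k => by
    refine Fin.addCases (fun i => ?_) (fun j => ?_) k
    · rw [cubeSum_castAdd, cubeMap_coord, rightPerm_castAdd, toAlgHom_id, cubeLeft_coord]
    · rw [cubeSum_natAdd, cubeMap_coord, cubeMap_coord, rightPerm_natAdd, cubeRight_coord]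

theorem cubeScale_coord {n : ℕ} (α : ℝ) (i j : Fin n) :
    toAlgHom (cubeScale α i) (coord j) = if j = i then α • coord j else coord j :=
  toAlgHom_cubeLift _ _ _

theorem cubeSum_cubeScale_left (α : ℝ) (i : Fin p) :
    cubeSum (cubeScale α i) (𝟙 (cube q)) = cubeScale α (Fin.castAdd q i) :=
  infinitesimal_hom_ext fun k => by
    refine Fin.addCases (fun j => ?_) (fun j => ?_) k
    · rw [cubeSum_castAdd, cubeScale_coord, cubeScale_coord, apply_ite (toAlgHom (cubeLeft p q)),
        map_smul, cubeLeft_coord]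
      simp only [(Fin.castAdd_injective p q).eq_iff]
    · have h : Fin.natAdd p j ≠ Fin.castAdd q i := fun h => by
        have := congrArg Fin.val h
        have := i.isLt
        simp at *
        omega
      rw [cubeSum_natAdd, cubeScale_coord, toAlgHom_id, cubeRight_coord, if_neg h]

theorem cubeSum_cubeScale_right (α : ℝ) (i : Fin q) :
    cubeSum (𝟙 (cube p)) (cubeScale α i) = cubeScale α (Fin.natAdd p i) :=
  infinitesimal_hom_ext fun k => by
    refine Fin.addCases (fun j => ?_) (fun j => ?_) k
    · have h : Fin.castAdd q j ≠ Fin.natAdd p i := fun h => by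
        have := congrArg Fin.val h
        have := j.isLt
        simp at *
        omega
      rw [cubeSum_castAdd, cubeScale_coord, toAlgHom_id, cubeLeft_coord, if_neg h]
    · rw [cubeSum_natAdd, cubeScale_coord, cubeScale_coord, apply_ite (toAlgHom (cubeRight p q)),
        map_smul, cubeRight_coord]
      simp only [(Fin.natAdd_injective q p).eq_iff]

theorem coef_lie_permute (N : NatFamily (distr M (p + q))) (ξ₁ : tangent (distr M p))
    (ξ₂ : tangent (distr M q)) (σ : Equiv.Perm (Fin q)) :
    (N.lie hE ξ₁).coef (permute σ ξ₂) =
      ((N.pull (reindex M (rightPerm p σ))).lie hE ξ₁).coef ξ₂ := by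
  have h := coef_lie_precomp hE (𝟙 (cube p)) (cubeMap σ) N ξ₁ ξ₂
  rw [prolongMap_precomp_id, cubeMap_rightPerm] at h
  exact h.symm

theorem coef_lie_tsmul (N : NatFamily (distr M (p + q))) (α : ℝ) (ξ₁ : tangent (distr M p))
    (ξ₂ : tangent (distr M q)) :
    (N.lie hE (tsmul α ξ₁)).coef ξ₂ = α * (N.lie hE ξ₁).coef ξ₂ := by
  rw [coef_lie, coef_lie, NatFamily.coef_right_tsmul, NatFamily.coef_right_tsmul, mul_sub]

theorem coef_lie_cubeScale {ξ₁ : tangent (distr M p)} {ξ₂ : tangent (distr M q)}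
    (h₁ : IsTangentForm ξ₁) (h₂ : IsTangentForm ξ₂) (N : NatFamily (distr M (p + q))) (α : ℝ)
    (i : Fin (p + q)) :
    ((N.pull (precomp (prolongHom M (cubeScale α i)) M)).lie hE ξ₁).coef ξ₂ =
      α * (N.lie hE ξ₁).coef ξ₂ := by
  refine Fin.addCases (fun i => ?_) (fun i => ?_) i
  · have h := coef_lie_precomp hE (cubeScale α i) (𝟙 (cube q)) N ξ₁ ξ₂
    rw [prolongMap_precomp_id, cubeSum_cubeScale_left] at h
    rw [h, ← coef_lie_tsmul, ← h₁.homogeneous α i]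
    rfl
  · have h := coef_lie_precomp hE (𝟙 (cube p)) (cubeScale α i) N ξ₁ ξ₂
    rw [prolongMap_precomp_id, cubeSum_cubeScale_right] at h
    rw [h, ← NatFamily.coef_tsmul, ← h₂.homogeneous α i]
    rfl

/-! ### The Frölicher–Nijenhuis bracket -/

theorem proj_prolongMap_precomp {n m : ℕ} (φ : cube n ⟶ cube m) {ξ : tangent (distr M m)}
    (h : (proj _ (cube 1)).1 ξ = dirac M m) :
    (proj _ (cube 1)).1 ((prolongMap (precomp (prolongHom M φ) M) (cube 1)).1 ξ) = dirac M n := by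
  rw [proj_prolongMap, h, precomp_dirac]

include hM hE in
theorem alternate_spec {ξ : tangent (distr M p)} (h : (proj _ (cube 1)).1 ξ = dirac M p) :
    (proj _ (cube 1)).1 (alternate ξ) = dirac M p ∧ ∀ N : NatFamily (distr M p),
      N.coef (alternate ξ) = ∑ σ, realSign σ * (N.pull (reindex M σ)).coef ξ := by
  have key : ∀ l : List (Equiv.Perm (Fin p)),
      (proj _ (cube 1)).1 (l.foldr (fun σ s => tadd (tsmul ((Equiv.Perm.sign σ : ℤ) : ℝ)
        (permute σ ξ)) s) (tzero (dirac M p))) = dirac M p ∧ ∀ N : NatFamily (distr M p),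
      N.coef (l.foldr (fun σ s => tadd (tsmul ((Equiv.Perm.sign σ : ℤ) : ℝ)
        (permute σ ξ)) s) (tzero (dirac M p))) =
        (l.map fun σ => realSign σ * (N.pull (reindex M σ)).coef ξ).sum := by
    intro l
    induction l with
    | nil => exact ⟨rfl, fun N => N.coef_tzero _⟩
    | cons σ l ih =>
      have h1 : (proj _ (cube 1)).1 (tsmul ((Equiv.Perm.sign σ : ℤ) : ℝ) (permute σ ξ)) =
          dirac M p := (proj_tsmul _ _).trans (proj_prolongMap_precomp _ h)
      refine ⟨?_, fun N => ?_⟩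
      · rw [List.foldr_cons, proj_tadd hM hE (h1.trans ih.1.symm), h1]
      · rw [List.foldr_cons, coef_tadd hM hE N (h1.trans ih.1.symm), ih.2, NatFamily.coef_tsmul,
          List.map_cons, List.sum_cons]
        rfl
  refine ⟨(key _).1, fun N => ?_⟩
  rw [← Finset.sum_map_toList]
  exact (key _).2 N

include hM in
theorem proj_fnBracket {ξ₁ : tangent (distr M p)} {ξ₂ : tangent (distr M q)}
    (h₁ : (proj _ (cube 1)).1 ξ₁ = dirac M p) (h₂ : (proj _ (cube 1)).1 ξ₂ = dirac M q) :
    (proj _ (cube 1)).1 (fnBracket hE ξ₁ ξ₂) = dirac M (p + q) :=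
  (proj_tsmul _ _).trans (alternate_spec hM hE (proj_lieBracket hM hE h₁ h₂)).1

include hM in
theorem coef_fnBracket {ξ₁ : tangent (distr M p)} {ξ₂ : tangent (distr M q)}
    (h₁ : (proj _ (cube 1)).1 ξ₁ = dirac M p) (h₂ : (proj _ (cube 1)).1 ξ₂ = dirac M q)
    (N : NatFamily (distr M (p + q))) :
    N.coef (fnBracket hE ξ₁ ξ₂) = 1 / ((p.factorial : ℝ) * q.factorial) *
      ∑ σ, realSign σ * ((N.pull (reindex M σ)).lie hE ξ₁).coef ξ₂ := by
  unfold fnBracket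
  rw [NatFamily.coef_tsmul, (alternate_spec hM hE (proj_lieBracket hM hE h₁ h₂)).2]
  simp only [coef_lieBracket hM hE _ h₁ h₂]

include hM in
theorem isTangentForm_fnBracket {ξ₁ : tangent (distr M p)} {ξ₂ : tangent (distr M q)}
    (h₁ : IsTangentForm ξ₁) (h₂ : IsTangentForm ξ₂) : IsTangentForm (fnBracket hE ξ₁ ξ₂) := by
  have hfoot := proj_fnBracket hM hE h₁.foot h₂.foot
  refine ⟨hfoot, fun α i => ?_, fun σ => ?_⟩
  · refine tangent_ext ?_ fun N => ?_
    · exact (proj_prolongMap_precomp _ hfoot).trans ((proj_tsmul _ _).trans hfoot).symm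
    · have h : ∀ τ : Equiv.Perm (Fin (p + q)),
          (N.pull (precomp (prolongHom M (cubeScale α i)) M)).pull (reindex M τ) =
          (N.pull (reindex M τ)).pull (precomp (prolongHom M (cubeScale α (τ i))) M) := by
        intro τ
        have e : cubeScale α i ≫ cubeMap τ = cubeMap τ ≫ cubeScale α (τ i) :=
          infinitesimal_hom_ext fun j => by
            rw [toAlgHom_comp, toAlgHom_comp, cubeMap_coord, cubeScale_coord, cubeScale_coord,
              apply_ite (toAlgHom (cubeMap τ)), map_smul, cubeMap_coord]
            simp only [τ.injective.eq_iff]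
        rw [NatFamily.pull_pull, NatFamily.pull_pull]
        unfold reindex
        rw [precomp_comp, precomp_comp, e]
      have h' : N.coef (scaleArg α i (fnBracket hE ξ₁ ξ₂)) =
        (N.pull (precomp (prolongHom M (cubeScale α i)) M)).coef (fnBracket hE ξ₁ ξ₂) := rfl
      rw [h', NatFamily.coef_tsmul, coef_fnBracket hM hE h₁.foot h₂.foot,
        coef_fnBracket hM hE h₁.foot h₂.foot, mul_left_comm, Finset.mul_sum Finset.univ _ α]
      simp only [h, coef_lie_cubeScale hE h₁ h₂, mul_left_comm _ α]
  · refine tangent_ext ?_ fun N => ?_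
    · exact (proj_prolongMap_precomp _ hfoot).trans ((proj_tsmul _ _).trans hfoot).symm
    · have h' : N.coef (permute σ (fnBracket hE ξ₁ ξ₂)) =
        (N.pull (reindex M σ)).coef (fnBracket hE ξ₁ ξ₂) := rfl
      have h := sum_realSign_mul_right σ
        fun τ => ((N.pull (reindex M τ)).lie hE ξ₁).coef ξ₂
      rw [h', NatFamily.coef_tsmul, coef_fnBracket hM hE h₁.foot h₂.foot,
        coef_fnBracket hM hE h₁.foot h₂.foot, mul_left_comm]
      simp only [NatFamily.pull_reindex]
      exact congrArg _ h

include hM in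
/-- In the iterated bracket the inner alternation is absorbed by the outer one. -/
theorem coef_fnBracket_fnBracket {ξ₁ : tangent (distr M p)} {ξ₂ : tangent (distr M q)}
    {ξ₃ : tangent (distr M r)} (h₁ : IsTangentForm ξ₁) (h₂ : IsTangentForm ξ₂)
    (h₃ : IsTangentForm ξ₃) (N : NatFamily (distr M (p + (q + r)))) :
    N.coef (fnBracket hE ξ₁ (fnBracket hE ξ₂ ξ₃)) =
      1 / ((p.factorial : ℝ) * q.factorial * r.factorial) *
        ∑ τ, realSign τ * (((N.pull (reindex M τ)).lie hE ξ₁).lie hE ξ₂).coef ξ₃ := by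
  set S := ∑ τ, realSign τ * (((N.pull (reindex M τ)).lie hE ξ₁).lie hE ξ₂).coef ξ₃ with hS
  have inner : ∀ τ : Equiv.Perm (Fin (p + (q + r))),
      ((N.pull (reindex M τ)).lie hE ξ₁).coef (fnBracket hE ξ₂ ξ₃) =
      1 / ((q.factorial : ℝ) * r.factorial) * ∑ σ : Equiv.Perm (Fin (q + r)), realSign σ *
        (((N.pull (reindex M (rightPerm p σ * τ : Equiv.Perm _))).lie hE ξ₁).lie hE ξ₂).coef
          ξ₃ := by
    intro τ
    rw [coef_fnBracket hM hE h₂.foot h₃.foot]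
    refine congrArg _ (Finset.sum_congr rfl fun σ _ => congrArg _ ?_)
    rw [← coef_lieBracket hM hE _ h₂.foot h₃.foot, NatFamily.coef_pull, ← permute_eq,
      coef_lie_permute, coef_lieBracket hM hE _ h₂.foot h₃.foot, NatFamily.pull_reindex,
      Equiv.Perm.coe_mul]
  have outer : ∑ τ : Equiv.Perm (Fin (p + (q + r))), realSign τ *
      ∑ σ : Equiv.Perm (Fin (q + r)), realSign σ *
        (((N.pull (reindex M (rightPerm p σ * τ : Equiv.Perm _))).lie hE ξ₁).lie hE ξ₂).coef ξ₃ =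
      (q + r).factorial * S := by
    simp only [Finset.mul_sum]
    rw [Finset.sum_comm]
    have h : ∀ σ : Equiv.Perm (Fin (q + r)), ∑ τ : Equiv.Perm (Fin (p + (q + r))),
        realSign τ * (realSign σ *
          (((N.pull (reindex M (rightPerm p σ * τ : Equiv.Perm _))).lie hE ξ₁).lie hE ξ₂).coef
            ξ₃) = S := by
      intro σ
      have h1 := sum_realSign_mul_left (rightPerm p σ)
        fun τ => (((N.pull (reindex M τ)).lie hE ξ₁).lie hE ξ₂).coef ξ₃
      have h2 : realSign (rightPerm p σ) = realSign σ := by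
        unfold realSign
        rw [sign_rightPerm]
      simp only [mul_left_comm _ (realSign σ)]
      rw [← Finset.mul_sum, h1, h2, ← mul_assoc, realSign_mul_self, one_mul]
    simp only [h]
    rw [Finset.sum_const, Finset.card_univ, Fintype.card_perm, Fintype.card_fin, nsmul_eq_mul]
  rw [coef_fnBracket hM hE h₁.foot (proj_fnBracket hM hE h₂.foot h₃.foot)]
  simp only [inner, mul_left_comm _ (1 / ((q.factorial : ℝ) * r.factorial))]
  rw [← Finset.mul_sum, outer]
  have e1 : (p.factorial : ℝ) ≠ 0 := by exact_mod_cast p.factorial_ne_zero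
  have e2 : (q.factorial : ℝ) ≠ 0 := by exact_mod_cast q.factorial_ne_zero
  have e3 : (r.factorial : ℝ) ≠ 0 := by exact_mod_cast r.factorial_ne_zero
  have e4 : ((q + r).factorial : ℝ) ≠ 0 := by exact_mod_cast (q + r).factorial_ne_zero
  field_simp

theorem coef_castDegree {n m : ℕ} (h : m = n) (ξ : tangent (distr M m))
    (N : NatFamily (distr M n)) :
    N.coef (castDegree h ξ) = (N.pull (reindex M (Fin.cast h.symm))).coef ξ := by
  subst h
  have : (Fin.cast rfl : Fin m → Fin m) = id := rfl
  rw [this, reindex_id, NatFamily.pull_id]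
  rfl

theorem proj_castDegree {n m : ℕ} (h : m = n) {ξ : tangent (distr M m)}
    (hξ : (proj _ (cube 1)).1 ξ = dirac M m) :
    (proj _ (cube 1)).1 (castDegree h ξ) = dirac M n := by
  subst h
  exact hξ

theorem realSign_blockRotate (p q r : ℕ) (h : q + (r + p) = p + (q + r)) :
    realSign ((blockRotate p q r).trans (finCongr h)) = (-1) ^ (p * (q + r)) := by
  rw [realSign, sign_blockRotate]
  simp

theorem realSign_blockRotate_blockRotate (p q r : ℕ) (h : r + (p + q) = p + (q + r)) :
    realSign (((blockRotate p q r).trans (blockRotate q r p)).trans (finCongr h)) =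
      (-1) ^ (r * (p + q)) := by
  have h1 : q + (r + p) = p + (q + r) := by omega
  have h2 : r + (p + q) = q + (r + p) := by omega
  have e : ((blockRotate p q r).trans (blockRotate q r p)).trans (finCongr h) =
      (finCongr h1).permCongr ((blockRotate q r p).trans (finCongr h2)) *
        (blockRotate p q r).trans (finCongr h1) := by
    ext k
    simp [Equiv.permCongr_apply]
  rw [e, realSign_mul, realSign_blockRotate]
  have h3 : realSign ((finCongr h1).permCongr ((blockRotate q r p).trans (finCongr h2))) =
      (-1) ^ (q * (r + p)) := by
    rw [← realSign_blockRotate q r p h2, realSign, realSign, Equiv.Perm.sign_permCongr]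
  rw [h3, ← pow_add]
  have h4 : q * (r + p) + p * (q + r) = r * (p + q) + 2 * (p * q) := by ring
  rw [h4, pow_add, pow_mul (-1 : ℝ) 2, neg_one_sq, one_pow, mul_one]

end FrolicherSpace

end

theorem theorem4p2p3 (M : FrolicherSpace.{u}) (hM : M.Microlinear) (hE : M.WeilExponentiable)
    (p q r : ℕ)
    (ξ₁ : FrolicherSpace.tangent (FrolicherSpace.distr M p))
    (ξ₂ : FrolicherSpace.tangent (FrolicherSpace.distr M q))
    (ξ₃ : FrolicherSpace.tangent (FrolicherSpace.distr M r))
    (h₁ : FrolicherSpace.IsTangentForm ξ₁) (h₂ : FrolicherSpace.IsTangentForm ξ₂)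
    (h₃ : FrolicherSpace.IsTangentForm ξ₃) :
    (FrolicherSpace.IsTangentForm (FrolicherSpace.fnBracket hE ξ₂ ξ₃) ∧
      FrolicherSpace.IsTangentForm (FrolicherSpace.fnBracket hE ξ₃ ξ₁) ∧
      FrolicherSpace.IsTangentForm (FrolicherSpace.fnBracket hE ξ₁ ξ₂)) ∧
    FrolicherSpace.tadd
      (FrolicherSpace.tadd
        (FrolicherSpace.fnBracket hE ξ₁ (FrolicherSpace.fnBracket hE ξ₂ ξ₃))
        (FrolicherSpace.tsmul ((-1) ^ (p * (q + r)))
          (FrolicherSpace.castDegree (show q + (r + p) = p + (q + r) by omega)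
            (FrolicherSpace.fnBracket hE ξ₂ (FrolicherSpace.fnBracket hE ξ₃ ξ₁)))))
      (FrolicherSpace.tsmul ((-1) ^ (r * (p + q)))
        (FrolicherSpace.castDegree (show r + (p + q) = p + (q + r) by omega)
          (FrolicherSpace.fnBracket hE ξ₃ (FrolicherSpace.fnBracket hE ξ₁ ξ₂)))) =
    FrolicherSpace.tzero (FrolicherSpace.dirac M (p + (q + r))) := by
  have f23 := FrolicherSpace.isTangentForm_fnBracket hM hE h₂ h₃
  have f31 := FrolicherSpace.isTangentForm_fnBracket hM hE h₃ h₁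
  have f12 := FrolicherSpace.isTangentForm_fnBracket hM hE h₁ h₂
  refine ⟨⟨f23, f31, f12⟩, ?_⟩
  have hq : q + (r + p) = p + (q + r) := by omega
  have hr : r + (p + q) = p + (q + r) := by omega
  have fA := FrolicherSpace.proj_fnBracket hM hE h₁.foot f23.foot
  have fB := (FrolicherSpace.proj_tsmul ((-1) ^ (p * (q + r))) _).trans
    (FrolicherSpace.proj_castDegree hq (FrolicherSpace.proj_fnBracket hM hE h₂.foot f31.foot))
  have fC := (FrolicherSpace.proj_tsmul ((-1) ^ (r * (p + q))) _).trans
    (FrolicherSpace.proj_castDegree hr (FrolicherSpace.proj_fnBracket hM hE h₃.foot f12.foot))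
  have fAB := (FrolicherSpace.proj_tadd hM hE (fA.trans fB.symm)).trans fA
  refine FrolicherSpace.tangent_ext
    ((FrolicherSpace.proj_tadd hM hE (fAB.trans fC.symm)).trans fAB) fun N => ?_
  rw [FrolicherSpace.coef_tadd hM hE N (fAB.trans fC.symm),
    FrolicherSpace.coef_tadd hM hE N (fA.trans fB.symm), N.coef_tsmul, N.coef_tsmul,
    FrolicherSpace.coef_castDegree, FrolicherSpace.coef_castDegree,
    FrolicherSpace.coef_fnBracket_fnBracket hM hE h₁ h₂ h₃,
    FrolicherSpace.coef_fnBracket_fnBracket hM hE h₂ h₃ h₁,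
    FrolicherSpace.coef_fnBracket_fnBracket hM hE h₃ h₁ h₂, N.coef_tzero]
  simp only [FrolicherSpace.NatFamily.pull_reindex]
  -- the alternating sums are rewritten as sums over the permutations of `p + (q + r)` elements
  have eB := sum_realSign_cast hq (WeilAlgebra.blockRotate p q r) fun e =>
    (((N.pull (FrolicherSpace.reindex M e)).lie hE ξ₂).lie hE ξ₃).coef ξ₁
  have eC := sum_realSign_cast hr
    ((WeilAlgebra.blockRotate p q r).trans (WeilAlgebra.blockRotate q r p)) fun e =>
    (((N.pull (FrolicherSpace.reindex M e)).lie hE ξ₃).lie hE ξ₁).coef ξ₂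
  rw [FrolicherSpace.realSign_blockRotate] at eB
  rw [FrolicherSpace.realSign_blockRotate_blockRotate] at eC
  rw [eB, eC]
  have jac := fun τ : Equiv.Perm (Fin (p + (q + r))) =>
    FrolicherSpace.jacobi_lie hE (N.pull (FrolicherSpace.reindex M τ)) ξ₁ ξ₂ ξ₃
  simp only [FrolicherSpace.NatFamily.pull_reindex] at jac
  have hs : ∀ n : ℕ, ((-1 : ℝ) ^ n) * (-1) ^ n = 1 := fun n => by
    rw [← mul_pow, neg_one_mul, neg_neg, one_pow]
  have hsum : ∑ τ : Equiv.Perm (Fin (p + (q + r))), realSign τ *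
        (((N.pull (FrolicherSpace.reindex M τ)).lie hE ξ₁).lie hE ξ₂).coef ξ₃ +
      ∑ τ : Equiv.Perm (Fin (p + (q + r))), realSign τ *
        (((N.pull (FrolicherSpace.reindex M (WeilAlgebra.blockRotate p q r ∘ τ))).lie hE
          ξ₂).lie hE ξ₃).coef ξ₁ +
      ∑ τ : Equiv.Perm (Fin (p + (q + r))), realSign τ *
        (((N.pull (FrolicherSpace.reindex M
          (((WeilAlgebra.blockRotate p q r).trans (WeilAlgebra.blockRotate q r p)) ∘ τ))).lie hE
          ξ₃).lie hE ξ₁).coef ξ₂ = 0 := by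
    rw [← Finset.sum_add_distrib, ← Finset.sum_add_distrib]
    refine Finset.sum_eq_zero fun τ _ => ?_
    rw [← mul_add, ← mul_add]
    exact mul_eq_zero_of_right _ (jac τ)
  have e1 := hs (p * (q + r))
  have e2 := hs (r * (p + q))
  generalize ∑ τ : Equiv.Perm (Fin (p + (q + r))), realSign τ *
    (((N.pull (FrolicherSpace.reindex M τ)).lie hE ξ₁).lie hE ξ₂).coef ξ₃ = a at hsum ⊢
  generalize ∑ τ : Equiv.Perm (Fin (p + (q + r))), realSign τ *
    (((N.pull (FrolicherSpace.reindex M (WeilAlgebra.blockRotate p q r ∘ τ))).lie hE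
      ξ₂).lie hE ξ₃).coef ξ₁ = b at hsum ⊢
  generalize ∑ τ : Equiv.Perm (Fin (p + (q + r))), realSign τ *
    (((N.pull (FrolicherSpace.reindex M
      (((WeilAlgebra.blockRotate p q r).trans (WeilAlgebra.blockRotate q r p)) ∘ τ))).lie hE
      ξ₃).lie hE ξ₁).coef ξ₂ = c at hsum ⊢
  linear_combination (1 / ((p.factorial : ℝ) * q.factorial * r.factorial)) * hsum +
    (1 / ((p.factorial : ℝ) * q.factorial * r.factorial)) * b * e1 +
    (1 / ((p.factorial : ℝ) * q.factorial * r.factorial)) * c * e2
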